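/- Wright's equation with parameter $\alpha$ is $y'(t)=-\alpha\,y(t-1)\,[1+y(t)]$, $t\in\mathbb R$. A *periodic solution with frequency $\omega>0$* is a nonconstant function $y:\mathbb R\to\mathbb R$ that satisfies the equation for all $t\in\mathbb R$ and has (not necessarily minimal) period $2\pi/\omega$. For each $\alpha\in(\tfrac{\pi}{2},\tfrac{\pi}{2}+5.53\times10^{-3}]$ there is, up to time translation, at most one periodic solution $y$ of Wright's equation that for some frequency $\omega$ with $|\omega-\tfrac{\pi}{2}|\le 0.0924$ satisfies $\|y'\|_{L^2([0,2\pi/\omega])}\le 0.302$. Moreover, this solution (if it exists) is the one on the branch originating from the Hopf bifurcation at $\alpha=\tfrac{\pi}{2}$. That is, there are $\epsilon_0>0$ and a continuous curve $\epsilon\mapsto(\hat\alpha_\epsilon,\hat\omega_\epsilon,\hat c_\epsilon)\in\mathbb R\times\mathbb R\times\ell^1(\{k\ge2\};\mathbb C)$, $0\le\epsilon\le\epsilon_0$, starting at $(\hat\alpha_0,\hat\omega_0,\hat c_0)=(\tfrac\pi2,\tfrac\pi2,0)$, such that for every $0<\epsilon\le\epsilon_0$ the number $\hat\omega_\epsilon$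 is positive and $$\hat y_\epsilon(t)=\epsilon\left(e^{i\hat\omega_\epsilon t}+e^{-i\hat\omega_\epsilon t}\right)+\epsilon\sum_{k\ge2}\left((\hat c_\epsilon)_k\,e^{i\hat\omega_\epsilon kt}+\overline{(\hat c_\epsilon)_k}\,e^{-i\hat\omega_\epsilon kt}\right)$$ is a periodic solution of Wright's equation with parameter $\hat\alpha_\epsilon$ and frequency $\hat\omega_\epsilon$, and such that for every $\alpha\in(\tfrac{\pi}{2},\tfrac{\pi}{2}+5.53\times10^{-3}]$ there is exactly one $\epsilon\in(0,\epsilon_0]$ with $\hat\alpha_\epsilon=\alpha$, and every periodic solution $y$ with parameter $\alpha$ and frequency $\omega$ that satisfies $|\omega-\tfrac\pi2|\le0.0924$ and $\|y'\|_{L^2([0,2\pi/\omega])}\le0.302$ has $\omega=\hat\omega_\epsilon$ and is a time translate of $\hat y_\epsilon$ for this $\epsilon$. -/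

import Mathlib

open Real Set MeasureTheory

noncomputable section

/-- `y : ℝ → ℝ` solves Wright's equation `y'(t) = -α y(t-1) (1 + y(t))` for all `t`. -/
def SolvesWright (α : ℝ) (y : ℝ → ℝ) : Prop :=
  ∀ t : ℝ, HasDerivAt y (-α * y (t - 1) * (1 + y t)) t

/-- `y` is a nonconstant periodic solution of Wright's equation with frequency `ω > 0`, that is,
with (not necessarily minimal) period `2π/ω`. -/
structure IsPeriodicSolution (α ω : ℝ) (y : ℝ → ℝ) : Prop where
  solves : SolvesWright α y
  freq_pos : 0 < ω
  periodic : Function.Periodic y (2 * π / ω)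
  nonconstant : ¬ ∃ a : ℝ, ∀ t : ℝ, y t = a

/-- The neighbourhood considered: frequency `|ω - π/2| ≤ 0.0924` and
`‖y'‖ ≤ 0.302` in `L²([0, 2π/ω])`. -/
def InNeighbourhood (ω : ℝ) (y : ℝ → ℝ) : Prop :=
  |ω - π / 2| ≤ 0.0924 ∧
    eLpNorm (deriv y) 2 (volume.restrict (Icc 0 (2 * π / ω))) ≤ ENNReal.ofReal 0.302

/-- `y₁` and `y₂` agree up to a time translation. -/
def EqUpToTranslation (y₁ y₂ : ℝ → ℝ) : Prop :=
  ∃ τ : ℝ, ∀ t : ℝ, y₁ t = y₂ (t + τ)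

/-- The real function with Fourier series
`ε (e^{iωt} + e^{-iωt}) + ε ∑_{k ≥ 2} (c_k e^{iωkt} + c̄_k e^{-iωkt})`;
it is used with sequences `c ∈ ℓ¹` with `c₀ = c₁ = 0`. -/
def fourierProfile (ε ω : ℝ) (c : lp (fun _ : ℕ => ℂ) 1) (t : ℝ) : ℝ :=
  ε * (2 * Real.cos (ω * t)) +
    ε * ∑' k : ℕ, 2 * (c k * Complex.exp (Complex.I * ω * k * t)).re

/-- `ε ↦ (α ε, ω ε, c ε)`, `0 ≤ ε ≤ ε₀`, is a branch of periodic solutions of Wright's equation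
that originates from the Hopf bifurcation at `α = π/2`, parametrized by the amplitude `ε` of the
first Fourier mode: a continuous curve in `ℝ × ℝ × ℓ¹` that starts at `(π/2, π/2, 0)` and
for `0 < ε ≤ ε₀` gives a solution of Wright's equation with parameter `α ε`, frequency `ω ε` and
Fourier coefficients `ε` (for `k = 1`) and `ε (c ε)_k` (for `k ≥ 2`). -/
structure IsHopfBranch (ε₀ : ℝ) (α ω : ℝ → ℝ) (c : ℝ → lp (fun _ : ℕ => ℂ) 1) : Prop where
  pos : 0 < ε₀
  continuous_α : ContinuousOn α (Icc 0 ε₀)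
  continuous_ω : ContinuousOn ω (Icc 0 ε₀)
  continuous_c : ContinuousOn c (Icc 0 ε₀)
  α_zero : α 0 = π / 2
  ω_zero : ω 0 = π / 2
  c_zero : c 0 = 0
  mode_zero : ∀ ε ∈ Icc 0 ε₀, c ε 0 = 0
  mode_one : ∀ ε ∈ Icc 0 ε₀, c ε 1 = 0
  isSolution : ∀ ε ∈ Ioc 0 ε₀,
    IsPeriodicSolution (α ε) (ω ε) (fourierProfile ε (ω ε) (c ε))

end

/-! Write a periodic solution as `ε (2 cos ωt + c)`, where `c` consists of the modes `|k| ≥ 2`, and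
put `s = ω / α`. After division by `α`, the `k`-th Fourier mode of the equation reads `(isk +
e^{-iωk}) u_k + ε N_k = 0`, where `u = 2 cos + c` and `N` is the convolution of the delayed `u` with
`u`. For `|k| ≥ 2` the symbol is at least a multiple of `|k|` near the Hopf point and can be
inverted, which determines `c`. For `k = 1` the equation is `cos ω + i (s - sin ω) = -ε N_1`, which
determines `ω` and `s`. For given `ε` the solutions are thus fixed points of a map in `(ω, s, d)`,
where `d_k = |k| c_k`. The weight `|k|` is there because `e^{-iωk}` is Lipschitz in `ω` only with
constant `|k|`; inverting the symbol gains this factor back. For `0 ≤ ε ≤ 0.1` the map is a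
contraction (`abs_new_sub_le`), so there is exactly one fixed point, Lipschitz in `ε`
(`exists_isFixed`, `IsFixed.unique`, `IsFixed.sub_le`). This is the branch.

A fixed point satisfies every mode of the equation except the mode 0, so its series solves the
equation up to a constant, which vanishes because `log (1 + y)` plus a delayed primitive of `αy` is
periodic (`IsFixed.isPeriodicSolution`). Conversely, a solution in the neighbourhood has mean zero,
its `L²` bound on `y'` becomes an `ℓ¹` bound on the coefficients, and a translation makes its first
coefficient positive; the bounds then place it in the domain of the contraction
(`exists_isFixed_of_isPeriodicSolution`).

It remains to show that `α = ω / s` is strictly increasing along the branch and passes the right end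
of the interval. Eliminating `c_2` turns the mode 1 into `cos ω + i (s - sin ω) = ε² (1 - 3i) / 5 +
...`, so that `ω ≈ π/2 - ε²/5`, `s ≈ 1 - 3ε²/5` and `α ≈ π/2 + (3π/10 - 1/5) ε²`. The rigorous form
compares two fixed points (`IsFixed.norm_resid_sub_sub_le`) and rests on bootstrapped bounds for one
fixed point (`IsFixed.sharp`) and for differences (`IsFixed.diffBound`). Monotonicity and the
intermediate value theorem then finish the proof. -/

noncomputable section
namespace Wright

/-- Absolutely summable two-sided complex sequences. -/
abbrev Coeff := lp (fun _ : ℤ => ℂ) 1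

/-! ### The convolution algebra ℓ¹(ℤ), multipliers and Hermitian symmetry -/

namespace Coeff

lemma hasSum_norm (f : Coeff) : HasSum (fun k => ‖f k‖) ‖f‖ := by
  simpa using lp.hasSum_norm (p := 1) (by simp) f

lemma summable_norm (f : Coeff) : Summable fun k => ‖f k‖ := (hasSum_norm f).summable

lemma norm_def (f : Coeff) : ‖f‖ = ∑' k, ‖f k‖ := (hasSum_norm f).tsum_eq.symm

lemma norm_apply_le (f : Coeff) (k : ℤ) : ‖f k‖ ≤ ‖f‖ := lp.norm_apply_le_norm (by simp) f k

/-- The sequence in `ℓ¹` with the given entries. -/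
def ofSummable (f : ℤ → ℂ) (h : Summable fun k => ‖f k‖) : Coeff :=
  ⟨f, memℓp_gen (by simpa using h)⟩

@[simp] lemma ofSummable_apply (f : ℤ → ℂ) (h : Summable fun k => ‖f k‖) (k : ℤ) :
    ofSummable f h k = f k := rfl

lemma ext' {f g : Coeff} (h : ∀ k, f k = g k) : f = g := lp.ext (funext h)

@[simp] lemma add_apply (f g : Coeff) (k : ℤ) : (f + g) k = f k + g k := rfl
@[simp] lemma sub_apply (f g : Coeff) (k : ℤ) : (f - g) k = f k - g k := rfl
@[simp] lemma zero_apply (k : ℤ) : (0 : Coeff) k = 0 := rfl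
@[simp] lemma smul_apply (c : ℂ) (f : Coeff) (k : ℤ) : (c • f) k = c * f k := rfl

lemma norm_le_of_le {f g : Coeff} {C : ℝ} (h : ∀ k, ‖f k‖ ≤ C * ‖g k‖) : ‖f‖ ≤ C * ‖g‖ := by
  rw [norm_def, norm_def, ← tsum_mul_left]
  exact (summable_norm f).tsum_le_tsum h ((summable_norm g).mul_left C)

lemma norm_le_of_le₂ {f g₁ g₂ : Coeff} {C₁ C₂ : ℝ}
    (h : ∀ k, ‖f k‖ ≤ C₁ * ‖g₁ k‖ + C₂ * ‖g₂ k‖) : ‖f‖ ≤ C₁ * ‖g₁‖ + C₂ * ‖g₂‖ := by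
  rw [norm_def, norm_def g₁, norm_def g₂, ← tsum_mul_left, ← tsum_mul_left,
    ← ((summable_norm g₁).mul_left C₁).tsum_add ((summable_norm g₂).mul_left C₂)]
  exact (summable_norm f).tsum_le_tsum h
    (((summable_norm g₁).mul_left C₁).add ((summable_norm g₂).mul_left C₂))

/-! ### Convolution -/

lemma summable_conv (f g : Coeff) (k : ℤ) : Summable fun j => ‖f j * g (k - j)‖ := by
  refine Summable.of_nonneg_of_le (fun j => norm_nonneg _) (fun j => ?_)
    ((summable_norm f).mul_right ‖g‖)
  rw [norm_mul]
  exact mul_le_mul_of_nonneg_left (norm_apply_le g _) (norm_nonneg _)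

/-- The shear `(k, j) ↦ (j, k - j)` is a bijection of `ℤ × ℤ` that reduces this to the product of
two summable families. -/
lemma summable_conv_prod (f g : Coeff) :
    Summable fun x : ℤ × ℤ => ‖f x.2 * g (x.1 - x.2)‖ := by
  have h := (summable_norm f).mul_of_nonneg (summable_norm g) (fun _ => norm_nonneg _)
    (fun _ => norm_nonneg _)
  let e : ℤ × ℤ ≃ ℤ × ℤ :=
    { toFun := fun x => (x.2, x.1 - x.2)
      invFun := fun x => (x.1 + x.2, x.1)
      left_inv := fun x => by simp
      right_inv := fun x => by simp }
  have h' := e.summable_iff.2 h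
  refine h'.congr fun x => ?_
  simp [e]

lemma summable_norm_conv (f g : Coeff) : Summable fun k : ℤ => ‖∑' j, f j * g (k - j)‖ :=
  Summable.of_nonneg_of_le (fun _ => norm_nonneg _)
    (fun k => norm_tsum_le_tsum_norm (summable_conv f g k)) (summable_conv_prod f g).prod

/-- Convolution of two sequences in `ℓ¹`. -/
def conv (f g : Coeff) : Coeff := ofSummable (fun k => ∑' j, f j * g (k - j)) (summable_norm_conv f g)

lemma conv_apply (f g : Coeff) (k : ℤ) : conv f g k = ∑' j, f j * g (k - j) := by
  rw [conv, ofSummable_apply]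

lemma norm_conv_le (f g : Coeff) : ‖conv f g‖ ≤ ‖f‖ * ‖g‖ := by
  have hp := summable_conv_prod f g
  have h1 : ‖conv f g‖ ≤ ∑' k : ℤ, ∑' j : ℤ, ‖f j * g (k - j)‖ := by
    rw [norm_def]
    refine (summable_norm (conv f g)).tsum_le_tsum (fun k => ?_) hp.prod
    rw [conv_apply]
    exact norm_tsum_le_tsum_norm (summable_conv f g k)
  have h2 : ∑' k : ℤ, ∑' j : ℤ, ‖f j * g (k - j)‖ = ∑' j : ℤ, ∑' k : ℤ, ‖f j * g (k - j)‖ :=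
    (Summable.tsum_comm (f := fun k j : ℤ => ‖f j * g (k - j)‖) hp).symm
  refine h1.trans (le_of_eq ?_)
  rw [h2]
  calc ∑' j : ℤ, ∑' k : ℤ, ‖f j * g (k - j)‖
    _ = ∑' j, ‖f j‖ * ‖g‖ := by
        congr 1; ext j
        simp_rw [norm_mul]
        rw [tsum_mul_left, norm_def g]
        congr 1
        exact (Equiv.subRight j).tsum_eq fun k => ‖g k‖
    _ = ‖f‖ * ‖g‖ := by rw [tsum_mul_right, ← norm_def]

/-- Pairing of `ℓ¹` with `ℓ^∞`. For Hermitian `g` without mean one may take `b = ‖g‖ / 2`, which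
gains a factor 2 over `norm_conv_le` at a single mode. -/
lemma norm_conv_apply_le {f g : Coeff} {b : ℝ} (hb : ∀ j, ‖g j‖ ≤ b) (k : ℤ) :
    ‖conv f g k‖ ≤ ‖f‖ * b := by
  calc ‖conv f g k‖ ≤ ∑' j, ‖f j * g (k - j)‖ := norm_tsum_le_tsum_norm (summable_conv f g k)
    _ ≤ ∑' j, ‖f j‖ * b := by
        refine (summable_conv f g k).tsum_le_tsum (fun j => ?_) ((summable_norm f).mul_right b)
        rw [norm_mul]
        exact mul_le_mul_of_nonneg_left (hb _) (norm_nonneg _)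
    _ = ‖f‖ * b := by rw [tsum_mul_right, ← norm_def]

lemma conv_comm (f g : Coeff) : conv f g = conv g f := by
  refine ext' fun k => ?_
  rw [conv_apply, conv_apply, ← (Equiv.subLeft k).tsum_eq]
  refine tsum_congr fun j => ?_
  simp [mul_comm]

lemma conv_add_left (f g h : Coeff) : conv (f + g) h = conv f h + conv g h := by
  refine ext' fun k => ?_
  rw [add_apply, conv_apply, conv_apply, conv_apply,
    ← (summable_conv f h k).of_norm.tsum_add (summable_conv g h k).of_norm]
  exact tsum_congr fun j => by rw [add_apply]; ring

lemma conv_smul_left (c : ℂ) (f h : Coeff) : conv (c • f) h = c • conv f h := by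
  refine ext' fun k => ?_
  rw [smul_apply, conv_apply, conv_apply, ← tsum_mul_left]
  exact tsum_congr fun j => by rw [smul_apply]; ring

lemma conv_neg_left (f h : Coeff) : conv (-f) h = - conv f h := by
  have := conv_smul_left (-1) f h
  simpa using this

lemma conv_sub_left (f g h : Coeff) : conv (f - g) h = conv f h - conv g h := by
  rw [sub_eq_add_neg, conv_add_left, conv_neg_left, ← sub_eq_add_neg]

lemma conv_add_right (f g h : Coeff) : conv f (g + h) = conv f g + conv f h := by
  rw [conv_comm, conv_add_left, conv_comm g, conv_comm h]

lemma conv_sub_right (f g h : Coeff) : conv f (g - h) = conv f g - conv f h := by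
  rw [conv_comm, conv_sub_left, conv_comm g, conv_comm h]

lemma conv_smul_right (c : ℂ) (f h : Coeff) : conv f (c • h) = c • conv f h := by
  rw [conv_comm, conv_smul_left, conv_comm]

lemma conv_single_left (i : ℤ) (a : ℂ) (g : Coeff) (k : ℤ) :
    conv (lp.single 1 i a) g k = a * g (k - i) := by
  rw [conv_apply, tsum_eq_single i]
  · rw [lp.single_apply_self]
  · intro j hj
    rw [lp.single_apply_ne _ _ _ hj, zero_mul]

/-! ### Multipliers -/

open Classical in
/-- Entrywise multiplication by `m`, if the result is summable. -/
def mul (m : ℤ → ℂ) (f : Coeff) : Coeff :=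
  -- The default value 0 only makes the definition total; all estimates concern bounded multipliers,
  -- for which `mul_apply` holds.
  if h : Summable fun k => ‖m k * f k‖ then ofSummable _ h else 0

lemma mul_apply {m : ℤ → ℂ} {C : ℝ} (hm : ∀ k, ‖m k‖ ≤ C) (f : Coeff) (k : ℤ) :
    mul m f k = m k * f k := by
  have h : Summable fun k => ‖m k * f k‖ := by
    refine Summable.of_nonneg_of_le (fun j => norm_nonneg _) (fun j => ?_)
      ((summable_norm f).mul_left C)
    rw [norm_mul]
    exact mul_le_mul_of_nonneg_right (hm j) (norm_nonneg _)
  rw [mul, dif_pos h, ofSummable_apply]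

lemma norm_mul_le {m : ℤ → ℂ} {C : ℝ} (hm : ∀ k, ‖m k‖ ≤ C) (f : Coeff) :
    ‖mul m f‖ ≤ C * ‖f‖ := by
  refine norm_le_of_le fun k => ?_
  rw [mul_apply hm, norm_mul]
  exact mul_le_mul_of_nonneg_right (hm k) (norm_nonneg _)

/-! ### Hermitian sequences -/

/-- `f` is the sequence of Fourier coefficients of a real function. -/
def Herm (f : Coeff) : Prop := ∀ k, f (-k) = (starRingEnd ℂ) (f k)

lemma Herm.add {f g : Coeff} (hf : Herm f) (hg : Herm g) : Herm (f + g) := fun k => by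
  simp [hf k, hg k]

lemma Herm.sub {f g : Coeff} (hf : Herm f) (hg : Herm g) : Herm (f - g) := fun k => by
  simp [hf k, hg k]

lemma Herm.conv {f g : Coeff} (hf : Herm f) (hg : Herm g) : Herm (conv f g) := fun k => by
  rw [conv_apply, conv_apply, Complex.conj_tsum, ← (Equiv.neg ℤ).tsum_eq]
  refine tsum_congr fun j => ?_
  rw [map_mul, ← hf, ← hg, Equiv.neg_apply]
  rw [show -k - -j = -(k - j) by ring]

lemma Herm.mul {m : ℤ → ℂ} {C : ℝ} (hm : ∀ k, ‖m k‖ ≤ C)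
    (hm' : ∀ k, m (-k) = (starRingEnd ℂ) (m k)) {f : Coeff} (hf : Herm f) : Herm (mul m f) :=
  fun k => by rw [mul_apply hm, mul_apply hm, map_mul, hm', hf]

lemma Herm.smul {f : Coeff} (hf : Herm f) (c : ℝ) : Herm ((c : ℂ) • f) := fun k => by
  rw [smul_apply, smul_apply, hf k, map_mul, Complex.conj_ofReal]

lemma Herm.norm_neg {f : Coeff} (hf : Herm f) (k : ℤ) : ‖f (-k)‖ = ‖f k‖ := by
  rw [hf k, RCLike.norm_conj]

/-- The modes `k` and `-k` have equal modulus and both count in the norm. -/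
lemma two_norm_apply_le {f : Coeff} (hf : Herm f) {k : ℤ} (hk : k ≠ 0) : 2 * ‖f k‖ ≤ ‖f‖ := by
  have h := (summable_norm f).sum_le_tsum {k, -k} (fun _ _ => norm_nonneg _)
  rw [Finset.sum_pair (by omega), hf.norm_neg, ← norm_def] at h
  linarith

lemma norm_apply_le_half {f : Coeff} (hf : Herm f) (h0 : f 0 = 0) (k : ℤ) : ‖f k‖ ≤ ‖f‖ / 2 := by
  rcases eq_or_ne k 0 with rfl | hk
  · rw [h0, norm_zero]; positivity
  · linarith [two_norm_apply_le hf hk]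

lemma isClosed_herm : IsClosed {f : Coeff | Herm f} := by
  have : {f : Coeff | Herm f} = ⋂ k, {f : Coeff | f (-k) = (starRingEnd ℂ) (f k)} := by
    ext f; simp [Herm]
  rw [this]
  refine isClosed_iInter fun k => ?_
  have h : ∀ k : ℤ, Continuous fun f : Coeff => f k := fun k =>
    (lp.lipschitzWith_one_eval (E := fun _ : ℤ => ℂ) 1 k).continuous
  exact isClosed_eq (h _) (Complex.continuous_conj.comp (h _))

end Coeff
end Wright
end

/-! ### Delay, division by `|k|`, and the quadratic nonlinearity on coefficients -/

noncomputable section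
namespace Wright
open Coeff

/-- The factor `e^{-iωk}` by which a unit delay acts on the `k`-th mode. -/
def delay (ω : ℝ) (k : ℤ) : ℂ := Complex.exp (-(Complex.I * ω * k))

lemma norm_delay (ω : ℝ) (k : ℤ) : ‖delay ω k‖ = 1 := by
  rw [delay, show -(Complex.I * ω * k) = ((-(ω * k) : ℝ) : ℂ) * Complex.I by push_cast; ring,
    Complex.norm_exp_ofReal_mul_I]

lemma norm_delay_le (ω : ℝ) (k : ℤ) : ‖delay ω k‖ ≤ 1 := (norm_delay ω k).le

lemma delay_neg (ω : ℝ) (k : ℤ) : delay ω (-k) = (starRingEnd ℂ) (delay ω k) := by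
  rw [delay, delay, ← Complex.exp_conj]
  congr 1
  simp

/-- This is `|e^{ix} - 1| ≤ |x|`. The factor `|k|` is the reason for the weighted unknown `d`. -/
lemma norm_delay_sub_le (ω ω' : ℝ) (k : ℤ) : ‖delay ω k - delay ω' k‖ ≤ |(k : ℝ)| * |ω - ω'| := by
  have h : delay ω k - delay ω' k =
      delay ω' k * (Complex.exp (Complex.I * ((-(k * (ω - ω')) : ℝ) : ℂ)) - 1) := by
    rw [mul_sub, mul_one, delay, delay, ← Complex.exp_add]
    congr 2
    push_cast; ring
  rw [h, norm_mul, norm_delay, one_mul]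
  refine (Real.norm_exp_I_mul_ofReal_sub_one_le).trans ?_
  rw [Real.norm_eq_abs, abs_neg, abs_mul]

/-- The coefficient sequence of `y(· - 1)`, given that of `y`. -/
def shift (ω : ℝ) (f : Coeff) : Coeff := mul (delay ω) f

lemma shift_apply (ω : ℝ) (f : Coeff) (k : ℤ) : shift ω f k = delay ω k * f k :=
  mul_apply (norm_delay_le ω) f k

lemma shift_add (ω : ℝ) (f g : Coeff) : shift ω (f + g) = shift ω f + shift ω g :=
  ext' fun k => by simp only [shift_apply, add_apply]; ring

lemma shift_sub (ω : ℝ) (f g : Coeff) : shift ω (f - g) = shift ω f - shift ω g :=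
  ext' fun k => by simp only [shift_apply, sub_apply]; ring

lemma shift_smul (ω : ℝ) (c : ℂ) (f : Coeff) : shift ω (c • f) = c • shift ω f :=
  ext' fun k => by simp only [shift_apply, smul_apply]; ring

lemma norm_shift_le (ω : ℝ) (f : Coeff) : ‖shift ω f‖ ≤ ‖f‖ := by
  simpa [shift] using norm_mul_le (norm_delay_le ω) f

lemma herm_shift {ω : ℝ} {f : Coeff} (hf : Herm f) : Herm (shift ω f) :=
  hf.mul (norm_delay_le ω) (delay_neg ω)

/-- The multiplier `1/|k|` on the modes `|k| ≥ 2`. -/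
def invAbs (k : ℤ) : ℂ := if |k| < 2 then 0 else ((1 / |(k : ℝ)| : ℝ) : ℂ)

lemma abs_cast_ge {k : ℤ} {n : ℕ} (hk : ¬ |k| < n) : (n : ℝ) ≤ |(k : ℝ)| := by
  have : (n : ℤ) ≤ |k| := not_lt.1 hk
  exact_mod_cast this

lemma norm_invAbs_le (k : ℤ) : ‖invAbs k‖ ≤ 1 / 2 := by
  rw [invAbs]
  split_ifs with h
  · simp
  · have := abs_cast_ge (n := 2) h
    rw [Complex.norm_real, Real.norm_eq_abs, abs_of_nonneg (by positivity)]
    exact one_div_le_one_div_of_le (by norm_num) (by exact_mod_cast this)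

lemma invAbs_neg (k : ℤ) : invAbs (-k) = (starRingEnd ℂ) (invAbs k) := by
  simp only [invAbs, abs_neg, Int.cast_neg]
  split_ifs
  · simp
  · rw [Complex.conj_ofReal]

/-- Division of the `k`-th mode by `|k|`; the modes `|k| < 2` are dropped. -/
def smooth (d : Coeff) : Coeff := mul invAbs d

lemma smooth_apply (d : Coeff) (k : ℤ) : smooth d k = invAbs k * d k := mul_apply norm_invAbs_le d k

lemma smooth_apply_of_lt (d : Coeff) {k : ℤ} (hk : |k| < 2) : smooth d k = 0 := by
  rw [smooth_apply, invAbs, if_pos hk, zero_mul]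

lemma abs_mul_norm_smooth_apply_le (d : Coeff) (k : ℤ) : |(k : ℝ)| * ‖smooth d k‖ ≤ ‖d k‖ := by
  rw [smooth_apply, invAbs]
  split_ifs with h
  · simp
  · have := abs_cast_ge (n := 2) h
    have h0 : |(k : ℝ)| ≠ 0 := by push_cast at this; linarith
    rw [norm_mul, Complex.norm_real, Real.norm_eq_abs, abs_one_div, abs_abs, ← mul_assoc,
      mul_one_div_cancel h0, one_mul]

lemma norm_smooth_le (d : Coeff) : ‖smooth d‖ ≤ ‖d‖ / 2 := by
  have := norm_mul_le norm_invAbs_le d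
  rw [smooth]; linarith

lemma smooth_sub (d d' : Coeff) : smooth (d - d') = smooth d - smooth d' :=
  ext' fun k => by simp only [smooth_apply, sub_apply]; ring

lemma herm_smooth {d : Coeff} (hd : Herm d) : Herm (smooth d) := hd.mul norm_invAbs_le invAbs_neg

/-- The factor `|k|` of `norm_delay_sub_le` cancels the `1/|k|` in `smooth`: the delay is Lipschitz
in `ω` on smoothed sequences, although not on all of `ℓ¹`. -/
lemma norm_shift_sub_shift_smooth_le (ω ω' : ℝ) (d : Coeff) :
    ‖shift ω (smooth d) - shift ω' (smooth d)‖ ≤ |ω - ω'| * ‖d‖ := by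
  refine norm_le_of_le fun k => ?_
  rw [sub_apply, shift_apply, shift_apply, ← sub_mul, norm_mul]
  calc _ ≤ |(k : ℝ)| * |ω - ω'| * ‖smooth d k‖ :=
        mul_le_mul_of_nonneg_right (norm_delay_sub_le ω ω' k) (norm_nonneg _)
    _ = |ω - ω'| * (|(k : ℝ)| * ‖smooth d k‖) := by ring
    _ ≤ _ := mul_le_mul_of_nonneg_left (abs_mul_norm_smooth_apply_le d k) (abs_nonneg _)

lemma norm_shift_sub_shift_le (ω ω' : ℝ) (d d' : Coeff) :
    ‖shift ω (smooth d) - shift ω' (smooth d')‖ ≤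
      ‖smooth d - smooth d'‖ + |ω - ω'| * ‖d'‖ := by
  have h : shift ω (smooth d) - shift ω' (smooth d') =
      shift ω (smooth d - smooth d') + (shift ω (smooth d') - shift ω' (smooth d')) := by
    rw [shift_sub]; abel
  rw [h]
  exact (norm_add_le _ _).trans
    (add_le_add (norm_shift_le _ _) (norm_shift_sub_shift_smooth_le _ _ _))

/-- The sequence of Fourier coefficients of `2 cos`. -/
def cosSeq : Coeff := lp.single 1 1 1 + lp.single 1 (-1) 1

lemma single_apply' (i : ℤ) (a : ℂ) (k : ℤ) :
    (lp.single 1 i a : Coeff) k = if k = i then a else 0 := by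
  split_ifs with h
  · subst h; exact lp.single_apply_self _ _ _
  · exact lp.single_apply_ne _ _ _ h

lemma norm_single' (i : ℤ) (a : ℂ) : ‖(lp.single 1 i a : Coeff)‖ = ‖a‖ :=
  lp.norm_single (E := fun _ : ℤ => ℂ) (p := 1) (by norm_num) i a

lemma cosSeq_apply (k : ℤ) :
    cosSeq k = (if k = 1 then 1 else 0) + if k = -1 then 1 else 0 := by
  rw [cosSeq, add_apply, single_apply', single_apply']

lemma norm_pair_le (i j : ℤ) (a b : ℂ) :
    ‖(lp.single 1 i a + lp.single 1 j b : Coeff)‖ ≤ ‖a‖ + ‖b‖ :=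
  (norm_add_le _ _).trans (by rw [norm_single', norm_single'])

lemma norm_cosSeq_le : ‖cosSeq‖ ≤ 2 :=
  (norm_pair_le _ _ _ _).trans (by norm_num)

lemma herm_cosSeq : Herm cosSeq := fun k => by
  simp only [cosSeq_apply, map_add, apply_ite (starRingEnd ℂ), map_one, map_zero]
  rw [add_comm]
  congr 2 <;> simp [neg_eq_iff_eq_neg]

lemma shift_cosSeq (ω : ℝ) :
    shift ω cosSeq = lp.single 1 1 (delay ω 1) + lp.single 1 (-1) (delay ω (-1)) := by
  refine ext' fun k => ?_
  rw [shift_apply, cosSeq_apply, add_apply, single_apply', single_apply']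
  split_ifs <;> simp_all

lemma norm_shift_cosSeq_sub_le (ω ω' : ℝ) :
    ‖shift ω cosSeq - shift ω' cosSeq‖ ≤ 2 * |ω - ω'| := by
  have h : shift ω cosSeq - shift ω' cosSeq = lp.single 1 1 (delay ω 1 - delay ω' 1) +
      lp.single 1 (-1) (delay ω (-1) - delay ω' (-1)) := by
    rw [shift_cosSeq, shift_cosSeq, lp.single_sub, lp.single_sub]; abel
  have h1 := norm_delay_sub_le ω ω' 1
  have h2 := norm_delay_sub_le ω ω' (-1)
  rw [h]
  refine (norm_pair_le _ _ _ _).trans ?_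
  simp at h1 h2
  linarith

lemma conv_cosSeq_right (f : Coeff) (k : ℤ) : conv f cosSeq k = f (k - 1) + f (k + 1) := by
  rw [conv_comm, cosSeq, conv_add_left, add_apply, conv_single_left, conv_single_left]
  simp

lemma conv_shift_cosSeq_left (ω : ℝ) (f : Coeff) (k : ℤ) :
    conv (shift ω cosSeq) f k = delay ω 1 * f (k - 1) + delay ω (-1) * f (k + 1) := by
  rw [shift_cosSeq, conv_add_left, add_apply, conv_single_left, conv_single_left]
  simp

/-! ### The nonlinearity -/

/-- The coefficients of the quadratic part of `y(t-1) y(t)`. -/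
def quad (ω : ℝ) (c : Coeff) : Coeff := conv (shift ω c) c

/-- The coefficients of the part of `y(t-1) y(t)` mixing the first mode and the remainder. -/
def cross (ω : ℝ) (c : Coeff) : Coeff := conv (shift ω cosSeq) c + conv (shift ω c) cosSeq

/-- The coefficients `k = ±2` of the square of the first mode. -/
def second (ω : ℝ) : Coeff := lp.single 1 2 (delay ω 1) + lp.single 1 (-2) (delay ω (-1))

/-- The coefficients of `y(t-1) y(t)`, with that of index `0` modified. -/
def nonlin (ω : ℝ) (c : Coeff) : Coeff := second ω + cross ω c + quad ω c

/-- The product of the first modes only reaches the indices 0 and ±2. Dropping its part at 0, which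
the fixed point map does not use, lowers the constant term in `norm_nonlin_le` from 4 to 2. -/
lemma conv_shift_eq_nonlin (ω : ℝ) (c : Coeff) {k : ℤ} (hk : k ≠ 0) :
    conv (shift ω (cosSeq + c)) (cosSeq + c) k = nonlin ω c k := by
  have h : conv (shift ω cosSeq) cosSeq k = second ω k := by
    rw [conv_cosSeq_right, shift_cosSeq, second]
    simp only [add_apply, single_apply']
    have e1 : k - 1 = 1 ↔ k = 2 := by omega
    have e2 : ¬ (k - 1 = -1) := by omega
    have e3 : ¬ (k + 1 = 1) := by omega
    have e4 : k + 1 = -1 ↔ k = -2 := by omega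
    simp only [e1, e2, e3, e4, if_false]
    ring
  rw [shift_add, conv_add_left, conv_add_right, conv_add_right, nonlin, cross, quad]
  simp only [add_apply, h]
  ring

lemma norm_second_le (ω : ℝ) : ‖second ω‖ ≤ 2 :=
  (norm_pair_le _ _ _ _).trans (by rw [norm_delay, norm_delay]; norm_num)

lemma norm_cross_le (ω : ℝ) (c : Coeff) : ‖cross ω c‖ ≤ 4 * ‖c‖ := by
  have h1 := norm_conv_le (shift ω cosSeq) c
  have h2 := norm_conv_le (shift ω c) cosSeq
  have h3 := (norm_shift_le ω cosSeq).trans norm_cosSeq_le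
  have h4 := norm_shift_le ω c
  have h5 := mul_le_mul_of_nonneg_right h3 (norm_nonneg c)
  have h6 := mul_le_mul h4 norm_cosSeq_le (norm_nonneg _) (norm_nonneg _)
  have := norm_add_le (conv (shift ω cosSeq) c) (conv (shift ω c) cosSeq)
  rw [cross]; linarith

lemma norm_quad_le (ω : ℝ) (c : Coeff) : ‖quad ω c‖ ≤ ‖c‖ ^ 2 := by
  refine (norm_conv_le _ _).trans ?_
  rw [sq]
  exact mul_le_mul_of_nonneg_right (norm_shift_le ω c) (norm_nonneg _)

lemma norm_nonlin_le (ω : ℝ) (c : Coeff) : ‖nonlin ω c‖ ≤ 2 + 4 * ‖c‖ + ‖c‖ ^ 2 :=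
  norm_add₃_le.trans (by
    gcongr
    exacts [norm_second_le ω, norm_cross_le ω c, norm_quad_le ω c])

lemma norm_second_sub_le (ω ω' : ℝ) : ‖second ω - second ω'‖ ≤ 2 * |ω - ω'| := by
  have h : second ω - second ω' = lp.single 1 2 (delay ω 1 - delay ω' 1) +
      lp.single 1 (-2) (delay ω (-1) - delay ω' (-1)) := by
    rw [second, second, lp.single_sub, lp.single_sub]; abel
  have h1 := norm_delay_sub_le ω ω' 1
  have h2 := norm_delay_sub_le ω ω' (-1)
  rw [h]
  refine (norm_pair_le _ _ _ _).trans ?_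
  simp at h1 h2
  linarith

lemma norm_cross_sub_le (ω ω' : ℝ) (d d' : Coeff) :
    ‖cross ω (smooth d) - cross ω' (smooth d')‖ ≤ 4 * ‖smooth d - smooth d'‖ +
      |ω - ω'| * (2 * ‖smooth d'‖ + 2 * ‖d'‖) := by
  set c := smooth d
  set c' := smooth d'
  have h : cross ω c - cross ω' c' = conv (shift ω cosSeq) (c - c') +
      conv (shift ω cosSeq - shift ω' cosSeq) c' + conv (shift ω c - shift ω' c') cosSeq := by
    simp only [cross, conv_sub_left, conv_sub_right]; abel
  have h1 := norm_conv_le (shift ω cosSeq) (c - c')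
  have h2 := norm_conv_le (shift ω cosSeq - shift ω' cosSeq) c'
  have h3 := norm_conv_le (shift ω c - shift ω' c') cosSeq
  have h4 := mul_le_mul_of_nonneg_right ((norm_shift_le ω cosSeq).trans norm_cosSeq_le)
    (norm_nonneg (c - c'))
  have h5 := mul_le_mul_of_nonneg_right (norm_shift_cosSeq_sub_le ω ω') (norm_nonneg c')
  have h6 := mul_le_mul (norm_shift_sub_shift_le ω ω' d d') norm_cosSeq_le (norm_nonneg _)
    (by positivity)
  rw [h]
  refine norm_add₃_le.trans ?_
  linarith

lemma quad_sub (ω ω' : ℝ) (c c' : Coeff) : quad ω c - quad ω' c' =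
    conv (shift ω c - shift ω' c') c + conv (shift ω' c') (c - c') := by
  simp only [quad, conv_sub_left, conv_sub_right]; abel

lemma norm_quad_sub_le (ω ω' : ℝ) (d d' : Coeff) :
    ‖quad ω (smooth d) - quad ω' (smooth d')‖ ≤
      (‖smooth d - smooth d'‖ + |ω - ω'| * ‖d'‖) * ‖smooth d‖ +
        ‖smooth d'‖ * ‖smooth d - smooth d'‖ := by
  rw [quad_sub]
  refine (norm_add_le _ _).trans (add_le_add ?_ ?_)
  · exact (norm_conv_le _ _).trans
      (mul_le_mul_of_nonneg_right (norm_shift_sub_shift_le _ _ _ _) (norm_nonneg _))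
  · exact (norm_conv_le _ _).trans
      (mul_le_mul_of_nonneg_right (norm_shift_le _ _) (norm_nonneg _))

lemma norm_nonlin_sub_le (ω ω' : ℝ) (d d' : Coeff) :
    ‖nonlin ω (smooth d) - nonlin ω' (smooth d')‖ ≤ 2 * |ω - ω'| +
      (4 * ‖smooth d - smooth d'‖ + |ω - ω'| * (2 * ‖smooth d'‖ + 2 * ‖d'‖)) +
      ((‖smooth d - smooth d'‖ + |ω - ω'| * ‖d'‖) * ‖smooth d‖ +
        ‖smooth d'‖ * ‖smooth d - smooth d'‖) := by
  have h : nonlin ω (smooth d) - nonlin ω' (smooth d') = (second ω - second ω') +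
      (cross ω (smooth d) - cross ω' (smooth d')) +
      (quad ω (smooth d) - quad ω' (smooth d')) := by
    simp only [nonlin]; abel
  rw [h]
  exact norm_add₃_le.trans (add_le_add (add_le_add (norm_second_sub_le _ _)
    (norm_cross_sub_le _ _ _ _)) (norm_quad_sub_le _ _ _ _))

lemma herm_second (ω : ℝ) : Herm (second ω) := fun k => by
  simp only [second, add_apply, single_apply', map_add, apply_ite (starRingEnd ℂ), map_zero,
    ← delay_neg, neg_neg]
  rw [add_comm]
  congr 2 <;> simp [neg_eq_iff_eq_neg]

lemma herm_quad (ω : ℝ) {c : Coeff} (hc : Herm c) : Herm (quad ω c) := (herm_shift hc).conv hc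

lemma herm_nonlin (ω : ℝ) {c : Coeff} (hc : Herm c) : Herm (nonlin ω c) :=
  ((herm_second ω).add (((herm_shift herm_cosSeq).conv hc).add
    ((herm_shift hc).conv herm_cosSeq))).add (herm_quad ω hc)

/-- The nonlinearity at index `1`. -/
lemma nonlin_one (ω : ℝ) (d : Coeff) : nonlin ω (smooth d) 1 =
    (delay ω 2 + delay ω (-1)) * smooth d 2 + quad ω (smooth d) 1 := by
  simp only [nonlin, second, cross, add_apply, conv_shift_cosSeq_left, conv_cosSeq_right,
    shift_apply, single_apply']
  norm_num
  rw [smooth_apply_of_lt d (k := 0) (by norm_num)]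
  ring

/-- The nonlinearity at index `2`. -/
lemma nonlin_two (ω : ℝ) (d : Coeff) : nonlin ω (smooth d) 2 =
    delay ω 1 + (delay ω 3 + delay ω (-1)) * smooth d 3 + quad ω (smooth d) 2 := by
  simp only [nonlin, second, cross, add_apply, conv_shift_cosSeq_left, conv_cosSeq_right,
    shift_apply, single_apply']
  norm_num
  rw [smooth_apply_of_lt d (k := 1) (by norm_num)]
  ring

lemma norm_quad_apply_le (ω : ℝ) {c : Coeff} {m : ℝ} (hm : ∀ j, ‖c j‖ ≤ m) (k : ℤ) :
    ‖quad ω c k‖ ≤ ‖c‖ * m :=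
  (norm_conv_apply_le hm k).trans (mul_le_mul_of_nonneg_right (norm_shift_le ω c)
    ((norm_nonneg _).trans (hm 0)))

lemma norm_quad_sub_apply_le (ω ω' : ℝ) {d d' : Coeff} {m n : ℝ} (hm : ∀ j, ‖smooth d j‖ ≤ m)
    (hn : ∀ j, ‖(smooth d - smooth d') j‖ ≤ n) (k : ℤ) :
    ‖quad ω (smooth d) k - quad ω' (smooth d') k‖ ≤
      (‖smooth d - smooth d'‖ + |ω - ω'| * ‖d'‖) * m + ‖smooth d'‖ * n := by
  rw [← sub_apply, quad_sub, add_apply]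
  refine (norm_add_le _ _).trans (add_le_add ?_ ?_)
  · exact (norm_conv_apply_le hm k).trans (mul_le_mul_of_nonneg_right
      (norm_shift_sub_shift_le _ _ _ _) ((norm_nonneg _).trans (hm 0)))
  · exact (norm_conv_apply_le hn k).trans (mul_le_mul_of_nonneg_right (norm_shift_le _ _)
      ((norm_nonneg _).trans (hn 0)))

end Wright
end

/-! ### The symbol near the Hopf point and the estimates for the fixed point map -/

noncomputable section
namespace Wright
open Coeff

/-! ### The linear part -/

/-- The symbol `isk + e^{-iωk}` of the linear part of Wright's equation, `s = ω/α`. -/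
def linSymb (s ω : ℝ) (k : ℤ) : ℂ := Complex.I * s * k + delay ω k

lemma linSymb_neg (s ω : ℝ) (k : ℤ) : linSymb s ω (-k) = (starRingEnd ℂ) (linSymb s ω k) := by
  simp only [linSymb, delay_neg, map_add, map_mul, Complex.conj_I, Complex.conj_ofReal,
    map_intCast]
  push_cast; ring

lemma norm_linSymb_neg (s ω : ℝ) (k : ℤ) : ‖linSymb s ω (-k)‖ = ‖linSymb s ω k‖ := by
  rw [linSymb_neg, RCLike.norm_conj]

lemma norm_linSymb_sub_le (s s' ω ω' : ℝ) (k : ℤ) :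
    ‖linSymb s ω k - linSymb s' ω' k‖ ≤ |(k : ℝ)| * (|ω - ω'| + |s - s'|) := by
  have h : linSymb s ω k - linSymb s' ω' k =
      (delay ω k - delay ω' k) + Complex.I * ((s - s' : ℝ) : ℂ) * ((k : ℝ) : ℂ) := by
    simp only [linSymb]; push_cast; ring
  rw [h]
  refine (norm_add_le _ _).trans ?_
  have := norm_delay_sub_le ω ω' k
  simp only [norm_mul, Complex.norm_I, Complex.norm_real, Real.norm_eq_abs]
  linarith

lemma delay_one_pi_div_two : delay (π / 2) 1 = -Complex.I := by
  rw [delay, show -(Complex.I * ((π / 2 : ℝ) : ℂ) * ((1 : ℤ) : ℂ)) = -(π / 2 * Complex.I) by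
    push_cast; ring, Complex.exp_neg, Complex.exp_pi_div_two_mul_I, Complex.inv_I]

lemma delay_natCast (ω : ℝ) (n : ℕ) : delay ω n = delay ω 1 ^ n := by
  rw [delay, delay, ← Complex.exp_nat_mul]
  congr 1; push_cast; ring

lemma delay_two (ω : ℝ) : delay ω 2 = delay ω 1 ^ 2 := delay_natCast ω 2
lemma delay_three (ω : ℝ) : delay ω 3 = delay ω 1 ^ 3 := delay_natCast ω 3
lemma delay_four (ω : ℝ) : delay ω 4 = delay ω 1 ^ 4 := delay_natCast ω 4

lemma linSymb_two_center : linSymb 1 (π / 2) 2 = -1 + 2 * Complex.I := by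
  rw [linSymb, delay_two, delay_one_pi_div_two]
  push_cast; ring_nf; rw [Complex.I_sq]; ring

lemma linSymb_three_center : linSymb 1 (π / 2) 3 = 4 * Complex.I := by
  rw [linSymb, delay_three, delay_one_pi_div_two]
  push_cast; ring_nf; rw [Complex.I_pow_three]; ring

lemma linSymb_four_center : linSymb 1 (π / 2) 4 = 1 + 4 * Complex.I := by
  rw [linSymb, delay_four, delay_one_pi_div_two]
  push_cast; ring_nf; rw [Complex.I_pow_four]; ring

/-- A perturbation bound whose error grows with `|k|`, hence meant for low modes; `le_norm_linSymb`
serves the high ones. The moduli at the centre for `k = 2, 3, 4` are `√5`, `4` and `√17`. -/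
lemma le_norm_linSymb_of_center {s ω b : ℝ} {k : ℤ} (hb : b ≤ ‖linSymb 1 (π / 2) k‖) :
    b - |(k : ℝ)| * (|ω - π / 2| + |s - 1|) ≤ ‖linSymb s ω k‖ := by
  have h1 := norm_linSymb_sub_le s 1 ω (π / 2) k
  have h2 := norm_sub_norm_le (linSymb 1 (π / 2) k) (linSymb s ω k)
  rw [norm_sub_rev] at h2
  linarith

lemma le_norm_of_sq_le {z : ℂ} {b : ℝ} (hb : b ^ 2 ≤ z.re ^ 2 + z.im ^ 2) : b ≤ ‖z‖ := by
  refine (le_abs_self b).trans (abs_le_of_sq_le_sq ?_ (norm_nonneg z))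
  rw [Complex.sq_norm, Complex.normSq_apply]; linarith

lemma norm_le_of_sq_le {z : ℂ} {b : ℝ} (h0 : 0 ≤ b) (hb : z.re ^ 2 + z.im ^ 2 ≤ b ^ 2) :
    ‖z‖ ≤ b := by
  refine (pow_le_pow_iff_left₀ (norm_nonneg z) h0 two_ne_zero).1 ?_
  rw [Complex.sq_norm, Complex.normSq_apply]; linarith

lemma le_norm_linSymb_two (s ω : ℝ) :
    2.236 - 2 * (|ω - π / 2| + |s - 1|) ≤ ‖linSymb s ω 2‖ := by
  have h : (2.236 : ℝ) ≤ ‖linSymb 1 (π / 2) 2‖ := by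
    rw [linSymb_two_center]; apply le_norm_of_sq_le; norm_num
  simpa using le_norm_linSymb_of_center (s := s) (ω := ω) h

lemma le_norm_linSymb_three (s ω : ℝ) :
    4 - 3 * (|ω - π / 2| + |s - 1|) ≤ ‖linSymb s ω 3‖ := by
  have h : (4 : ℝ) ≤ ‖linSymb 1 (π / 2) 3‖ := by
    rw [linSymb_three_center]; apply le_norm_of_sq_le; norm_num
  simpa using le_norm_linSymb_of_center (s := s) (ω := ω) h

lemma le_norm_linSymb_four (s ω : ℝ) :
    4.12 - 4 * (|ω - π / 2| + |s - 1|) ≤ ‖linSymb s ω 4‖ := by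
  have h : (4.12 : ℝ) ≤ ‖linSymb 1 (π / 2) 4‖ := by
    rw [linSymb_four_center]; apply le_norm_of_sq_le; norm_num
  simpa using le_norm_linSymb_of_center (s := s) (ω := ω) h

lemma le_norm_linSymb (s ω : ℝ) (k : ℤ) : s * |(k : ℝ)| - 1 ≤ ‖linSymb s ω k‖ := by
  have h := norm_sub_le (linSymb s ω k) (delay ω k)
  have e : linSymb s ω k - delay ω k = Complex.I * s * ((k : ℝ) : ℂ) := by
    simp [linSymb]
  rw [e, norm_delay] at h
  simp only [norm_mul, Complex.norm_I, Complex.norm_real, Real.norm_eq_abs, one_mul] at h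
  have := mul_le_mul_of_nonneg_right (le_abs_self s) (abs_nonneg (k : ℝ))
  linarith

/-- Induction principle for properties of the symbol on the modes `|k| ≥ 2`. -/
lemma forall_mode {P : ℤ → Prop} (hneg : ∀ k, P (-k) → P k) (h2 : P 2) (h3 : P 3) (h4 : P 4)
    (h5 : ∀ k : ℤ, 5 ≤ k → P k) {k : ℤ} (hk : ¬ |k| < 2) : P k := by
  have hpos : ∀ k : ℤ, 2 ≤ k → P k := fun k hk => by
    rcases (show k = 2 ∨ k = 3 ∨ k = 4 ∨ 5 ≤ k by omega) with rfl | rfl | rfl | h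
    exacts [h2, h3, h4, h5 k h]
  rcases le_abs.1 (not_lt.1 hk) with h | h
  · exact hpos k h
  · exact hneg k (hpos _ h)

/-- Parameters `(ω, s)` close to those of the Hopf bifurcation. -/
def NearHopf (s ω : ℝ) : Prop := |ω - π / 2| ≤ 0.0924 ∧ |s - 1| ≤ 0.0625

/-- The constant is `11/16 = (1 - 0.0625) - 1/4`: this is what `s|k| - 1` leaves once `1 ≤ |k|/4`.
The low modes have room to spare when compared with the centre. -/
lemma NearHopf.abs_le_norm {s ω : ℝ} (h : NearHopf s ω) {k : ℤ} (hk : ¬ |k| < 2) :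
    0.6875 * |(k : ℝ)| ≤ ‖linSymb s ω k‖ := by
  obtain ⟨h1, h2⟩ := h
  refine forall_mode (P := fun k => 0.6875 * |(k : ℝ)| ≤ ‖linSymb s ω k‖) (fun k hk => ?_)
    ?_ ?_ ?_ (fun k hk => ?_) hk
  · rwa [norm_linSymb_neg, Int.cast_neg, abs_neg] at hk
  · have := le_norm_linSymb_two s ω
    norm_num; linarith
  · have := le_norm_linSymb_three s ω
    norm_num; linarith
  · have := le_norm_linSymb_four s ω
    norm_num; linarith
  · have := le_norm_linSymb s ω k
    have hk' : (5 : ℝ) ≤ |(k : ℝ)| := (by exact_mod_cast hk : (5 : ℝ) ≤ k).trans (le_abs_self _)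
    have hs := (abs_le.1 h2).1
    nlinarith

/-- The multiplier `|k| / (isk + e^{-iωk})` on the modes `|k| ≥ 2`. -/
def invSymb (s ω : ℝ) (k : ℤ) : ℂ := if |k| < 2 then 0 else (|(k : ℝ)| : ℝ) / linSymb s ω k

lemma invSymb_neg (s ω : ℝ) (k : ℤ) : invSymb s ω (-k) = (starRingEnd ℂ) (invSymb s ω k) := by
  simp only [invSymb, abs_neg, Int.cast_neg]
  split_ifs
  · simp
  · rw [map_div₀, Complex.conj_ofReal, linSymb_neg]

lemma NearHopf.norm_invSymb_le {s ω : ℝ} (h : NearHopf s ω) (k : ℤ) :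
    ‖invSymb s ω k‖ ≤ 16 / 11 := by
  rw [invSymb]
  split_ifs with hk
  · norm_num
  · have h1 := h.abs_le_norm hk
    have h2 := abs_cast_ge (n := 2) hk
    push_cast at h2
    rw [norm_div, Complex.norm_real, Real.norm_eq_abs, abs_abs, div_le_iff₀ (by linarith)]
    linarith

/-- In `a/L - a/L' = (a/L)(a/L')(L' - L)/a` with `a = |k|`, the last division removes the `|k|` in
`norm_linSymb_sub_le`. -/
lemma norm_invSymb_sub_le {s s' ω ω' : ℝ} (h : NearHopf s ω) (h' : NearHopf s' ω') (k : ℤ) :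
    ‖invSymb s ω k - invSymb s' ω' k‖ ≤ (16 / 11) ^ 2 * (|ω - ω'| + |s - s'|) := by
  have h1 := h.norm_invSymb_le k
  have h1' := h'.norm_invSymb_le k
  rw [invSymb, invSymb] at *
  split_ifs at * with hk
  · simp; positivity
  · have h2 := abs_cast_ge (n := 2) hk
    push_cast at h2
    have h3 := h.abs_le_norm hk
    have h3' := h'.abs_le_norm hk
    have n1 : linSymb s ω k ≠ 0 := norm_pos_iff.1 (by linarith)
    have n2 : linSymb s' ω' k ≠ 0 := norm_pos_iff.1 (by linarith)
    have n3 : ((|(k : ℝ)| : ℝ) : ℂ) ≠ 0 := by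
      rw [Complex.ofReal_ne_zero]; linarith
    set a : ℂ := ((|(k : ℝ)| : ℝ) : ℂ)
    have e : a / linSymb s ω k - a / linSymb s' ω' k =
        (a / linSymb s ω k) * (a / linSymb s' ω' k) *
          ((linSymb s' ω' k - linSymb s ω k) / a) := by
      field_simp
    have h4 := norm_linSymb_sub_le s' s ω' ω k
    rw [abs_sub_comm ω', abs_sub_comm s'] at h4
    have h5 : ‖(linSymb s' ω' k - linSymb s ω k) / a‖ ≤ |ω - ω'| + |s - s'| := by
      rw [norm_div, show ‖a‖ = |(k : ℝ)| by simp [a], div_le_iff₀ (by linarith)]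
      linarith
    rw [e, norm_mul, norm_mul, sq]
    gcongr

/-! ### The fixed point map -/

/-- The first mode of the (rescaled) nonlinear term. -/
def resid (ε ω : ℝ) (d : Coeff) : ℂ := -(ε : ℂ) * nonlin ω (smooth d) 1

/-- The new frequency. -/
def newFreq (ε ω : ℝ) (d : Coeff) : ℝ := arccos (resid ε ω d).re

/-- The new value of `s`. -/
def newRatio (ε ω : ℝ) (d : Coeff) : ℝ := sin (newFreq ε ω d) + (resid ε ω d).im

/-- The new value of `d`. -/
def newCoeff (ε s ω : ℝ) (d : Coeff) : Coeff :=
  (-(ε : ℂ)) • mul (invSymb s ω) (nonlin ω (smooth d))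

/-- The domain of the fixed point map. -/
structure Region (ω s : ℝ) (d : Coeff) : Prop where
  near : NearHopf s ω
  norm_le : ‖d‖ ≤ 0.62
  herm : Herm d

lemma smooth_norm_le_half {d : Coeff} (hd : Herm d) (k : ℤ) : ‖smooth d k‖ ≤ ‖smooth d‖ / 2 :=
  norm_apply_le_half (herm_smooth hd) (smooth_apply_of_lt d (by norm_num)) k

lemma smooth_sub_norm_le_half {d d' : Coeff} (hd : Herm d) (hd' : Herm d') (k : ℤ) :
    ‖(smooth d - smooth d') k‖ ≤ ‖smooth d - smooth d'‖ / 2 := by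
  rw [← smooth_sub]; exact smooth_norm_le_half (hd.sub hd') k

lemma norm_delay_add_le (ω : ℝ) (j k : ℤ) : ‖delay ω j + delay ω k‖ ≤ 2 :=
  (norm_add_le _ _).trans (by rw [norm_delay, norm_delay]; norm_num)

lemma norm_nonlin_one_le (ω : ℝ) (d : Coeff) :
    ‖nonlin ω (smooth d) 1‖ ≤ 2 * ‖smooth d 2‖ + ‖quad ω (smooth d) 1‖ := by
  rw [nonlin_one]
  refine (norm_add_le _ _).trans ?_
  rw [norm_mul]
  gcongr
  exact norm_delay_add_le _ _ _

lemma norm_nonlin_one_sub_le (ω ω' : ℝ) (d d' : Coeff) :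
    ‖nonlin ω (smooth d) 1 - nonlin ω' (smooth d') 1‖ ≤
      2 * ‖(smooth d - smooth d') 2‖ + 3 * |ω - ω'| * ‖smooth d' 2‖ +
        ‖quad ω (smooth d) 1 - quad ω' (smooth d') 1‖ := by
  have e : nonlin ω (smooth d) 1 - nonlin ω' (smooth d') 1 =
      (delay ω 2 + delay ω (-1)) * (smooth d - smooth d') 2 +
      ((delay ω 2 - delay ω' 2) + (delay ω (-1) - delay ω' (-1))) * smooth d' 2 +
      (quad ω (smooth d) 1 - quad ω' (smooth d') 1) := by
    rw [nonlin_one, nonlin_one, sub_apply]; ring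
  have h2 := norm_delay_sub_le ω ω' 2
  have h1 := norm_delay_sub_le ω ω' (-1)
  have h3 := norm_add_le (delay ω 2 - delay ω' 2) (delay ω (-1) - delay ω' (-1))
  norm_num at h1 h2
  rw [e]
  refine norm_add₃_le.trans ?_
  rw [norm_mul, norm_mul]
  gcongr
  · exact norm_delay_add_le _ _ _
  · linarith

lemma Region.norm_smooth_le {ω s : ℝ} {d : Coeff} (h : Region ω s d) : ‖smooth d‖ ≤ 0.31 := by
  have := Wright.norm_smooth_le d
  have := h.norm_le
  linarith

/-- Entries of `smooth d` are at most half its norm, that is `0.155`, and `2 * 0.155 + 0.31 * 0.155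
≤ 0.3581`. The first modes alone contribute nothing at index 1. -/
lemma Region.norm_nonlin_one_le {ω s : ℝ} {d : Coeff} (h : Region ω s d) :
    ‖nonlin ω (smooth d) 1‖ ≤ 0.3581 := by
  have h1 := Wright.norm_nonlin_one_le ω d
  have h2 := smooth_norm_le_half h.herm 2
  have h3 := norm_quad_apply_le ω (smooth_norm_le_half h.herm) 1
  have h4 := h.norm_smooth_le
  have h5 := norm_nonneg (smooth d)
  nlinarith

lemma Region.norm_nonlin_le {ω s : ℝ} {d : Coeff} (h : Region ω s d) :
    ‖nonlin ω (smooth d)‖ ≤ 3.3361 := by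
  have h1 := Wright.norm_nonlin_le ω (smooth d)
  have h4 := h.norm_smooth_le
  have h5 := norm_nonneg (smooth d)
  nlinarith

lemma norm_resid_sub_le {ε ε' ω ω' s s' : ℝ} {d d' : Coeff} (h0 : 0 ≤ ε) (hε : ε ≤ 0.1)
    (h : Region ω s d) (h' : Region ω' s' d') :
    ‖resid ε ω d - resid ε' ω' d'‖ ≤
      0.0656 * ‖d - d'‖ + 0.0562 * |ω - ω'| + 0.3581 * |ε - ε'| := by
  have e : resid ε ω d - resid ε' ω' d' =
      -(ε : ℂ) * (nonlin ω (smooth d) 1 - nonlin ω' (smooth d') 1) -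
        ((ε - ε' : ℝ) : ℂ) * nonlin ω' (smooth d') 1 := by
    simp only [resid]; push_cast; ring
  have h1 := norm_nonlin_one_sub_le ω ω' d d'
  have h2 := smooth_sub_norm_le_half h.herm h'.herm
  have h3 := norm_quad_sub_apply_le ω ω' (smooth_norm_le_half h.herm) h2 1
  have h4 := h.norm_smooth_le
  have h4' := h'.norm_smooth_le
  have h5 := Wright.norm_smooth_le (d - d')
  rw [smooth_sub] at h5
  have h6 := h'.norm_nonlin_one_le
  have h7 := smooth_norm_le_half h'.herm 2
  have h8 := h'.norm_le
  have h9 := h2 2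
  set X := ‖nonlin ω (smooth d) 1 - nonlin ω' (smooth d') 1‖
  set n := ‖smooth d - smooth d'‖
  set τ := |ω - ω'|
  have p1 : 0 ≤ n := norm_nonneg _
  have p2 : 0 ≤ τ := abs_nonneg _
  have p3 : 0 ≤ ‖smooth d‖ := norm_nonneg _
  have p4 : 0 ≤ ‖d'‖ := norm_nonneg _
  have q1 : (n + τ * ‖d'‖) * (‖smooth d‖ / 2) ≤ (n + τ * 0.62) * 0.155 := by
    gcongr; linarith
  have q2 : ‖smooth d'‖ * (n / 2) ≤ 0.31 * (n / 2) := by gcongr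
  have q3 : 3 * τ * ‖smooth d' 2‖ ≤ 3 * τ * 0.155 := by gcongr; linarith
  have q4 : X ≤ 0.656 * ‖d - d'‖ + 0.562 * τ := by linarith
  rw [e]
  refine (norm_sub_le _ _).trans ?_
  rw [norm_mul, norm_mul, norm_neg, Complex.norm_real, Complex.norm_real, Real.norm_eq_abs,
    Real.norm_eq_abs, abs_of_nonneg h0]
  have q5 : ε * X ≤ 0.1 * (0.656 * ‖d - d'‖ + 0.562 * τ) := by
    gcongr
  have q6 : |ε - ε'| * ‖nonlin ω' (smooth d') 1‖ ≤ |ε - ε'| * 0.3581 := by gcongr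
  linarith

lemma Region.norm_resid_le {ε ω s : ℝ} {d : Coeff} (h0 : 0 ≤ ε) (hε : ε ≤ 0.1)
    (h : Region ω s d) : ‖resid ε ω d‖ ≤ 0.03581 := by
  rw [resid, norm_mul, norm_neg, Complex.norm_real, Real.norm_eq_abs, abs_of_nonneg h0]
  have := h.norm_nonlin_one_le
  have p := norm_nonneg (nonlin ω (smooth d) 1)
  nlinarith

lemma newCoeff_apply {ε ω s : ℝ} {d : Coeff} (h : NearHopf s ω) (k : ℤ) :
    newCoeff ε s ω d k = -(ε : ℂ) * (invSymb s ω k * nonlin ω (smooth d) k) := by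
  rw [newCoeff, smul_apply, mul_apply h.norm_invSymb_le]

/-- The variation is split among nonlinearity, symbol and amplitude. The coefficients of `ω` and `s`
are too large for a contraction in the plain maximum metric, so `d` has to be rescaled. -/
lemma norm_newCoeff_sub_le {ε ε' ω ω' s s' : ℝ} {d d' : Coeff} (h0 : 0 ≤ ε) (hε : ε ≤ 0.1)
    (h : Region ω s d) (h' : Region ω' s' d') :
    ‖newCoeff ε s ω d - newCoeff ε' s' ω' d'‖ ≤
      0.34 * ‖d - d'‖ + 1.31 * |ω - ω'| + 0.71 * |s - s'| + 4.86 * |ε - ε'| := by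
  set N := nonlin ω (smooth d) with hN
  set N' := nonlin ω' (smooth d') with hN'
  set τ := |ω - ω'| with hτ
  set σ := |s - s'| with hσ
  have p2 : 0 ≤ τ := abs_nonneg _
  have pσ : 0 ≤ σ := abs_nonneg _
  have key : ‖newCoeff ε s ω d - newCoeff ε' s' ω' d'‖ ≤ (0.1 * (16 / 11)) * ‖N - N'‖ +
      (0.1 * ((16 / 11) ^ 2 * (τ + σ)) + |ε - ε'| * (16 / 11)) * ‖N'‖ := by
    refine norm_le_of_le₂ fun k => ?_
    rw [sub_apply, newCoeff_apply h.near, newCoeff_apply h'.near, sub_apply]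
    have e : -(ε : ℂ) * (invSymb s ω k * N k) - -(ε' : ℂ) * (invSymb s' ω' k * N' k) =
        -((ε : ℂ) * invSymb s ω k * (N k - N' k)) +
        -((ε * (invSymb s ω k - invSymb s' ω' k) + ((ε - ε' : ℝ) : ℂ) * invSymb s' ω' k)
          * N' k) := by
      push_cast; ring
    rw [e]
    refine (norm_add_le _ _).trans ?_
    rw [norm_neg, norm_neg, norm_mul, norm_mul, norm_mul]
    have nε : ‖(ε : ℂ)‖ ≤ 0.1 := by
      rwa [Complex.norm_real, Real.norm_eq_abs, abs_of_nonneg h0]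
    gcongr
    · exact h.near.norm_invSymb_le k
    · refine (norm_add_le _ _).trans ?_
      rw [norm_mul, norm_mul, Complex.norm_real (ε - ε'), Real.norm_eq_abs]
      gcongr
      · exact norm_invSymb_sub_le h.near h'.near k
      · exact h'.near.norm_invSymb_le k
  have h3 := norm_nonlin_sub_le ω ω' d d'
  have h4 := h.norm_smooth_le
  have h4' := h'.norm_smooth_le
  have h5 := Wright.norm_smooth_le (d - d')
  rw [smooth_sub] at h5
  have h6 := h'.norm_nonlin_le
  have h8 := h'.norm_le
  set n := ‖smooth d - smooth d'‖
  have p1 : 0 ≤ n := norm_nonneg _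
  have p3 : 0 ≤ ‖smooth d‖ := norm_nonneg _
  have p4 : 0 ≤ ‖d'‖ := norm_nonneg _
  have q1 : (n + τ * ‖d'‖) * ‖smooth d‖ ≤ (n + τ * 0.62) * 0.31 := by gcongr
  have q2 : ‖smooth d'‖ * n ≤ 0.31 * n := by gcongr
  have q3 : τ * (2 * ‖smooth d'‖ + 2 * ‖d'‖) ≤ τ * (2 * 0.31 + 2 * 0.62) := by gcongr
  have q4 : (0.1 * ((16 / 11) ^ 2 * (τ + σ)) + |ε - ε'| * (16 / 11)) * ‖N'‖ ≤
      (0.1 * ((16 / 11) ^ 2 * (τ + σ)) + |ε - ε'| * (16 / 11)) * 3.3361 := by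
    gcongr
  have p5 := abs_nonneg (ε - ε')
  have p6 := norm_nonneg (d - d')
  linarith

lemma Region.norm_newCoeff_le {ε ω s : ℝ} {d : Coeff} (h0 : 0 ≤ ε) (hε : ε ≤ 0.1)
    (h : Region ω s d) : ‖newCoeff ε s ω d‖ ≤ 0.62 := by
  rw [newCoeff, norm_smul, norm_neg, Complex.norm_real, Real.norm_eq_abs, abs_of_nonneg h0]
  have h1 := norm_mul_le h.near.norm_invSymb_le (nonlin ω (smooth d))
  have h2 := h.norm_nonlin_le
  have p := norm_nonneg (mul (invSymb s ω) (nonlin ω (smooth d)))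
  nlinarith

lemma Region.herm_newCoeff {ε ω s : ℝ} {d : Coeff} (h : Region ω s d) :
    Herm (newCoeff ε s ω d) := by
  have := ((herm_nonlin ω (herm_smooth h.herm)).mul h.near.norm_invSymb_le
    (invSymb_neg s ω)).smul (-ε)
  rw [newCoeff]
  simpa using this

end Wright
end

/-! ### The contraction: existence, uniqueness and Lipschitz dependence on `ε` -/

noncomputable section
namespace Wright
open Coeff

/-! ### Trigonometric estimates -/

/-- Mean value inequality; `√u ≥ u` for `0 ≤ u ≤ 1` makes the constant rational. -/
lemma abs_arcsin_sub_le {δ x y : ℝ} (hδ : δ < 1) (hx : |x| ≤ δ) (hy : |y| ≤ δ) :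
    |arcsin x - arcsin y| ≤ |x - y| / (1 - δ ^ 2) := by
  have h0 : 0 ≤ δ := (abs_nonneg x).trans hx
  have hpos : 0 < 1 - δ ^ 2 := by nlinarith
  have hd : ∀ t ∈ Icc (-δ) δ, HasDerivWithinAt arcsin (1 / √(1 - t ^ 2)) (Icc (-δ) δ) t := by
    intro t ht
    exact (hasDerivAt_arcsin (by linarith [ht.1]) (by linarith [ht.2])).hasDerivWithinAt
  have hb : ∀ t ∈ Icc (-δ) δ, ‖1 / √(1 - t ^ 2)‖ ≤ 1 / (1 - δ ^ 2) := by
    intro t ht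
    rw [Real.norm_eq_abs, abs_of_nonneg (by positivity)]
    refine one_div_le_one_div_of_le hpos (Real.le_sqrt_of_sq_le ?_)
    have : t ^ 2 ≤ δ ^ 2 := sq_le_sq' ht.1 ht.2
    nlinarith
  have := (convex_Icc (-δ) δ).norm_image_sub_le_of_norm_hasDerivWithin_le hd hb
    (abs_le.1 hy) (abs_le.1 hx)
  simp only [Real.norm_eq_abs] at this
  rw [div_eq_inv_mul, ← one_div]
  exact this

lemma abs_arccos_sub_le {δ x y : ℝ} (hδ : δ < 1) (hx : |x| ≤ δ) (hy : |y| ≤ δ) :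
    |arccos x - arccos y| ≤ |x - y| / (1 - δ ^ 2) := by
  have : arccos x - arccos y = -(arcsin x - arcsin y) := by simp only [arccos]; ring
  rw [this, abs_neg]
  exact abs_arcsin_sub_le hδ hx hy

/-- The function `√(1 - x²)` is flat at 0: the difference of the two roots carries the factor `x +
y`, of size at most `2δ`. -/
lemma abs_sin_arccos_sub_le {δ x y : ℝ} (hδ : δ < 1) (hx : |x| ≤ δ) (hy : |y| ≤ δ) :
    |sin (arccos x) - sin (arccos y)| ≤ δ / (1 - δ ^ 2) * |x - y| := by
  have h0 : 0 ≤ δ := (abs_nonneg x).trans hx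
  have hpos : 0 < 1 - δ ^ 2 := by nlinarith
  rw [sin_arccos, sin_arccos]
  have hs : ∀ t : ℝ, |t| ≤ δ → 1 - δ ^ 2 ≤ √(1 - t ^ 2) ∧ √(1 - t ^ 2) ^ 2 = 1 - t ^ 2 := by
    intro t ht
    have h1 : t ^ 2 ≤ δ ^ 2 := sq_le_sq' (abs_le.1 ht).1 (abs_le.1 ht).2
    exact ⟨Real.le_sqrt_of_sq_le (by nlinarith), Real.sq_sqrt (by nlinarith)⟩
  obtain ⟨a1, a2⟩ := hs x hx
  obtain ⟨b1, b2⟩ := hs y hy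
  have e : (√(1 - x ^ 2) - √(1 - y ^ 2)) * (√(1 - x ^ 2) + √(1 - y ^ 2)) = -((x + y) * (x - y)) := by
    linear_combination a2 - b2
  have e' : |√(1 - x ^ 2) - √(1 - y ^ 2)| * (√(1 - x ^ 2) + √(1 - y ^ 2)) =
      |x + y| * |x - y| := by
    rw [← abs_mul, ← abs_neg ((x + y) * (x - y)), ← e, abs_mul (_ - _), abs_of_nonneg (a := _ + _) (by positivity)]
  have h2 : |x + y| ≤ 2 * δ := (abs_add_le x y).trans (by linarith)
  rw [div_mul_eq_mul_div, le_div_iff₀ hpos]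
  have h3 := mul_le_mul_of_nonneg_right h2 (abs_nonneg (x - y))
  have h4 := mul_le_mul_of_nonneg_left (add_le_add a1 b1)
    (abs_nonneg (√(1 - x ^ 2) - √(1 - y ^ 2)))
  linarith

/-! ### Fixed points -/

/-- `(ω, s, d)` is a fixed point of the map with amplitude `ε`. -/
structure IsFixed (ε ω s : ℝ) (d : Coeff) : Prop where
  region : Region ω s d
  freq : newFreq ε ω d = ω
  ratio : newRatio ε ω d = s
  coeff : newCoeff ε s ω d = d

section contraction
variable {ε ε' ω ω' s s' : ℝ} {d d' : Coeff}

lemma Region.new (h0 : 0 ≤ ε) (hε : ε ≤ 0.1) (h : Region ω s d) :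
    Region (newFreq ε ω d) (newRatio ε ω d) (newCoeff ε s ω d) := by
  have hr := h.norm_resid_le h0 hε
  have hre := (Complex.abs_re_le_norm _).trans hr
  have him := (Complex.abs_im_le_norm _).trans hr
  have hz : |(0 : ℝ)| ≤ 0.03581 := by norm_num
  have h1 := abs_arccos_sub_le (by norm_num) hre hz
  have h2 := abs_sin_arccos_sub_le (by norm_num) hre hz
  rw [arccos_zero, sub_zero] at h1
  rw [arccos_zero, sin_pi_div_two, sub_zero] at h2
  refine ⟨⟨?_, ?_⟩, h.norm_newCoeff_le h0 hε, h.herm_newCoeff⟩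
  · refine h1.trans ?_
    rw [div_le_iff₀ (by norm_num)]; norm_num; linarith
  · rw [newRatio, newFreq, add_sub_right_comm]
    refine (abs_add_le _ _).trans ?_
    norm_num at h2 ⊢; linarith

/-- Contraction by `0.7` in the maximum of `|Δω|`, `|Δs|` and `‖Δd‖ / 6`. The weight 6 is large
enough for the last component, as `6 * 0.34 + 1.31 + 0.71 ≤ 6 * 0.7` and `4.86 ≤ 6`, and harmless in
the others, where `‖Δd‖` has coefficient about `0.0656`. -/
lemma abs_new_sub_le {M : ℝ} (h0 : 0 ≤ ε) (hε : ε ≤ 0.1) (h0' : 0 ≤ ε') (hε' : ε' ≤ 0.1)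
    (h : Region ω s d) (h' : Region ω' s' d') (h1 : |ω - ω'| ≤ M) (h2 : |s - s'| ≤ M)
    (h3 : ‖d - d'‖ ≤ 6 * M) :
    |newFreq ε ω d - newFreq ε' ω' d'| ≤ 0.7 * M + |ε - ε'| ∧
    |newRatio ε ω d - newRatio ε' ω' d'| ≤ 0.7 * M + |ε - ε'| ∧
    ‖newCoeff ε s ω d - newCoeff ε' s' ω' d'‖ ≤ 6 * (0.7 * M + |ε - ε'|) := by
  have hM : 0 ≤ M := (abs_nonneg _).trans h1
  have hh := abs_nonneg (ε - ε')
  have hr := h.norm_resid_le h0 hε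
  have hre := (Complex.abs_re_le_norm _).trans hr
  have hr' := h'.norm_resid_le h0' hε'
  have hre' := (Complex.abs_re_le_norm _).trans hr'
  have hd := norm_resid_sub_le (ε' := ε') h0 hε h h'
  have dre := (Complex.abs_re_le_norm _).trans hd
  have dim := (Complex.abs_im_le_norm _).trans hd
  rw [Complex.sub_re] at dre
  rw [Complex.sub_im] at dim
  have e1 := abs_arccos_sub_le (by norm_num) hre hre'
  have e2 := abs_sin_arccos_sub_le (by norm_num) hre hre'
  refine ⟨e1.trans ?_, ?_, ?_⟩
  · rw [div_le_iff₀ (by norm_num)]; norm_num at dre ⊢; linarith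
  · rw [newRatio, newRatio, newFreq, newFreq, add_sub_add_comm]
    refine (abs_add_le _ _).trans ?_
    norm_num at dre dim e2 ⊢; linarith
  · have := norm_newCoeff_sub_le (ε' := ε') h0 hε h h'
    linarith

/-- Two fixed points satisfy `M ≤ 0.7 M + |ε - ε'|`. This yields both uniqueness (`ε = ε'`) and
continuity of the branch. -/
lemma IsFixed.sub_le (h0 : 0 ≤ ε) (hε : ε ≤ 0.1) (h0' : 0 ≤ ε') (hε' : ε' ≤ 0.1)
    (h : IsFixed ε ω s d) (h' : IsFixed ε' ω' s' d') :
    |ω - ω'| ≤ 10 / 3 * |ε - ε'| ∧ |s - s'| ≤ 10 / 3 * |ε - ε'| ∧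
      ‖d - d'‖ ≤ 20 * |ε - ε'| := by
  set M := max (|ω - ω'|) (max (|s - s'|) (‖d - d'‖ / 6)) with hM
  have h1 : |ω - ω'| ≤ M := le_max_left _ _
  have h2 : |s - s'| ≤ M := (le_max_left _ _).trans (le_max_right _ _)
  have h3 : ‖d - d'‖ / 6 ≤ M := (le_max_right _ _).trans (le_max_right _ _)
  obtain ⟨e1, e2, e3⟩ := abs_new_sub_le h0 hε h0' hε' h.region h'.region h1 h2 (by linarith)
  rw [h.freq, h'.freq] at e1
  rw [h.ratio, h'.ratio] at e2
  rw [h.coeff, h'.coeff] at e3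
  have : M ≤ 0.7 * M + |ε - ε'| := max_le e1 (max_le e2 (by linarith))
  refine ⟨?_, ?_, ?_⟩ <;> linarith

lemma IsFixed.unique (h0 : 0 ≤ ε) (hε : ε ≤ 0.1)
    (h : IsFixed ε ω s d) (h' : IsFixed ε ω' s' d') : ω = ω' ∧ s = s' ∧ d = d' := by
  obtain ⟨h1, h2, h3⟩ := h.sub_le h0 hε h0 hε h'
  rw [sub_self, abs_zero, mul_zero] at h1 h2 h3
  exact ⟨sub_eq_zero.1 (abs_nonpos_iff.1 h1), sub_eq_zero.1 (abs_nonpos_iff.1 h2),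
    sub_eq_zero.1 (norm_le_zero_iff.1 h3)⟩

/-- The fixed point map in coordinates in which it contracts the maximum metric. -/
def step (ε : ℝ) (x : ℝ × ℝ × Coeff) : ℝ × ℝ × Coeff :=
  (newFreq ε x.1 ((6 : ℂ) • x.2.2), newRatio ε x.1 ((6 : ℂ) • x.2.2),
    (6 : ℂ)⁻¹ • newCoeff ε x.2.1 x.1 ((6 : ℂ) • x.2.2))

lemma isClosed_region : IsClosed {x : ℝ × ℝ × Coeff | Region x.1 x.2.1 ((6 : ℂ) • x.2.2)} := by
  have : {x : ℝ × ℝ × Coeff | Region x.1 x.2.1 ((6 : ℂ) • x.2.2)} =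
      ({x | |x.1 - π / 2| ≤ 0.0924} ∩ {x | |x.2.1 - 1| ≤ 0.0625}) ∩
        ({x | ‖(6 : ℂ) • x.2.2‖ ≤ 0.62} ∩ (fun x => (6 : ℂ) • x.2.2) ⁻¹' {f | Herm f}) := by
    ext x
    exact ⟨fun h => ⟨⟨h.near.1, h.near.2⟩, h.norm_le, h.herm⟩,
      fun h => ⟨⟨h.1.1, h.1.2⟩, h.2.1, h.2.2⟩⟩
  rw [this]
  refine (IsClosed.inter ?_ ?_).inter (IsClosed.inter ?_ ?_)
  · exact isClosed_le (by fun_prop) (by fun_prop)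
  · exact isClosed_le (by fun_prop) (by fun_prop)
  · exact isClosed_le (by fun_prop) (by fun_prop)
  · exact isClosed_herm.preimage (by fun_prop)

/-- Banach's theorem on the closed set of triples `(ω, s, d / 6)`, started at the Hopf point. -/
lemma exists_isFixed (h0 : 0 ≤ ε) (hε : ε ≤ 0.1) :
    ∃ (ω s : ℝ) (d : Coeff), IsFixed ε ω s d := by
  set S := {x : ℝ × ℝ × Coeff | Region x.1 x.2.1 ((6 : ℂ) • x.2.2)} with hS
  have h6 : (6 : ℂ) ≠ 0 := by norm_num
  have hmaps : MapsTo (step ε) S S := fun x hx => by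
    have := Region.new h0 hε hx
    simp only [hS, step, mem_ofPred_eq, smul_inv_smul₀ h6]
    exact this
  have hcontr : ContractingWith (7 / 10) (hmaps.restrict (step ε) S S) := by
    refine ⟨by rw [div_lt_one (by norm_num)]; norm_num, LipschitzWith.of_dist_le_mul ?_⟩
    rintro ⟨x, hx⟩ ⟨y, hy⟩
    have n6 : ∀ f : Coeff, ‖(6 : ℂ) • f‖ = 6 * ‖f‖ := fun f => by rw [norm_smul]; norm_num
    have h1 : |x.1 - y.1| ≤ dist x y := (le_max_left _ _)
    have h2 : |x.2.1 - y.2.1| ≤ dist x y := (le_max_left _ _).trans (le_max_right _ _)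
    have h3 : ‖x.2.2 - y.2.2‖ ≤ dist x y := by
      rw [← dist_eq_norm]; exact (le_max_right _ _).trans (le_max_right _ _)
    obtain ⟨e1, e2, e3⟩ := abs_new_sub_le (M := dist x y) h0 hε h0 hε hx hy h1 h2
      (by rw [← smul_sub, n6]; linarith)
    rw [sub_self, abs_zero, add_zero] at e1 e2 e3
    rw [Subtype.dist_eq, Subtype.dist_eq]
    push_cast
    norm_num at e1 e2 e3
    refine max_le ?_ (max_le ?_ ?_)
    · simpa [step, Real.dist_eq] using e1
    · simpa [step, Real.dist_eq] using e2
    · simp only [MapsTo.val_restrict_apply, step]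
      rw [dist_eq_norm, ← smul_sub, norm_smul]
      norm_num
      linarith
  have hx0 : ((π / 2, 1, 0) : ℝ × ℝ × Coeff) ∈ S :=
    ⟨⟨by norm_num, by norm_num⟩, by norm_num, fun k => by simp⟩
  obtain ⟨x, hxS, hx, -⟩ := hcontr.exists_fixedPoint' isClosed_region.isComplete hmaps hx0
    (edist_ne_top _ _)
  refine ⟨x.1, x.2.1, (6 : ℂ) • x.2.2, hxS, ?_, ?_, ?_⟩
  · exact congrArg Prod.fst hx
  · exact congrArg (fun x => x.2.1) hx
  · have := congrArg (fun x => (6 : ℂ) • x.2.2) hx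
    simpa only [step, smul_inv_smul₀ h6] using this

end contraction
end Wright
end

/-! ### Bootstrapped bounds for a single fixed point -/

noncomputable section
namespace Wright
open Coeff

namespace Coeff

lemma norm_le_of_le₃ {f g₁ g₂ g₃ : Coeff} {C C₁ C₂ C₃ : ℝ}
    (h : ∀ k, C * ‖f k‖ ≤ C₁ * ‖g₁ k‖ + C₂ * ‖g₂ k‖ + C₃ * ‖g₃ k‖) :
    C * ‖f‖ ≤ C₁ * ‖g₁‖ + C₂ * ‖g₂‖ + C₃ * ‖g₃‖ :=
  hasSum_le h ((hasSum_norm f).mul_left C) ((((hasSum_norm g₁).mul_left C₁).add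
    ((hasSum_norm g₂).mul_left C₂)).add ((hasSum_norm g₃).mul_left C₃))

end Coeff

/-- The indicator of the modes `|k| ≥ 3`. -/
def tailInd (k : ℤ) : ℂ := if |k| < 3 then 0 else 1

lemma norm_tailInd_le (k : ℤ) : ‖tailInd k‖ ≤ 1 := by
  rw [tailInd]; split_ifs <;> simp

/-- The modes `|k| ≥ 3` of a sequence. -/
def tail (c : Coeff) : Coeff := mul tailInd c

lemma tail_apply (c : Coeff) (k : ℤ) : tail c k = if |k| < 3 then 0 else c k := by
  rw [tail, mul_apply norm_tailInd_le, tailInd]; split_ifs <;> simp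

lemma herm_tail {c : Coeff} (hc : Herm c) : Herm (tail c) := fun k => by
  rw [tail_apply, tail_apply, abs_neg, hc k]; split_ifs <;> simp

lemma two_norm_three_le {c : Coeff} (hc : Herm c) : 2 * ‖c 3‖ ≤ ‖tail c‖ := by
  have := two_norm_apply_le (herm_tail hc) (k := 3) (by norm_num)
  rwa [tail_apply, if_neg (by norm_num)] at this

lemma norm_le_two_add_tail {c : Coeff} (hc : Herm c) (h0 : ∀ k : ℤ, |k| < 2 → c k = 0) :
    ‖c‖ ≤ 2 * ‖c 2‖ + ‖tail c‖ := by
  have e : c = lp.single 1 2 (c 2) + lp.single 1 (-2) (c (-2)) + tail c := by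
    refine ext' fun k => ?_
    simp only [add_apply, single_apply', tail_apply]
    rcases lt_trichotomy |k| 2 with h | h | h
    · rw [h0 k h, if_neg (by rintro rfl; simp at h), if_neg (by rintro rfl; simp at h),
        if_pos (by omega)]; simp
    · rcases eq_or_eq_neg_of_abs_eq h with rfl | rfl <;> simp
    · rw [if_neg (by rintro rfl; simp at h), if_neg (by rintro rfl; simp at h),
        if_neg (by omega)]; simp
  have h1 := norm_pair_le 2 (-2) (c 2) (c (-2))
  have h2 := norm_add_le (lp.single 1 2 (c 2) + lp.single 1 (-2) (c (-2))) (tail c)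
  rw [← e] at h2
  rw [hc.norm_neg] at h1
  linarith

/-- In the first mode of the quadratic term, one of the factors belongs to the tail. -/
lemma norm_quad_one_le (ω : ℝ) {c : Coeff} {m : ℝ} (h0 : ∀ k : ℤ, |k| < 2 → c k = 0)
    (hm : ∀ j, ‖c j‖ ≤ m) : ‖quad ω c 1‖ ≤ 2 * m * ‖tail c‖ := by
  have hm0 : 0 ≤ m := (norm_nonneg _).trans (hm 0)
  rw [quad, conv_apply]
  have hs := summable_conv (shift ω c) c 1
  refine (norm_tsum_le_tsum_norm hs).trans ?_
  have h1 := (hasSum_norm (tail c)).mul_left m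
  have h2 : HasSum (fun j : ℤ => m * ‖tail c (1 - j)‖) (m * ‖tail c‖) :=
    (Equiv.subLeft (1 : ℤ)).hasSum_iff.2 h1
  have := hasSum_le (fun j => ?_) hs.hasSum (h1.add h2)
  · linarith
  rw [norm_mul, shift_apply, norm_mul, norm_delay, one_mul, tail_apply, tail_apply]
  -- If `|j|` and `|1 - j|` are both below 3, one of `j`, `1 - j` lies in `{-1, 0, 1}`, where `c`
  -- vanishes.
  by_cases hj : |j| < 3
  · by_cases hj' : |1 - j| < 3
    · rw [abs_lt] at hj hj'
      have : c j = 0 ∨ c (1 - j) = 0 := by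
        rcases (show j = -1 ∨ j = 0 ∨ j = 1 ∨ j = 2 by omega) with rfl | rfl | rfl | rfl
        · exact Or.inl (h0 _ (by norm_num))
        · exact Or.inl (h0 _ (by norm_num))
        · exact Or.inl (h0 _ (by norm_num))
        · exact Or.inr (h0 _ (by norm_num))
      rcases this with h | h <;> rw [h] <;> simp <;> positivity
    · rw [if_pos hj, if_neg hj', norm_zero, mul_zero, zero_add]
      exact mul_le_mul_of_nonneg_right (hm j) (norm_nonneg _)
  · rw [if_neg hj]
    have := mul_le_mul_of_nonneg_left (hm (1 - j)) (norm_nonneg (c j))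
    have : 0 ≤ m * ‖(if |1 - j| < 3 then 0 else c (1 - j) : ℂ)‖ := by positivity
    linarith

variable {ε ε' ω ω' s s' : ℝ} {d d' : Coeff}

lemma IsFixed.mode (h : IsFixed ε ω s d) {k : ℤ} (hk : ¬ |k| < 2) :
    linSymb s ω k * smooth d k = -(ε : ℂ) * nonlin ω (smooth d) k := by
  have h1 := h.region.near.abs_le_norm hk
  have h2 := abs_cast_ge (n := 2) hk
  push_cast at h2
  have n1 : linSymb s ω k ≠ 0 := norm_pos_iff.1 (by linarith)
  have n3 : ((|(k : ℝ)| : ℝ) : ℂ) ≠ 0 := by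
    rw [Complex.ofReal_ne_zero]; linarith
  have e := newCoeff_apply (ε := ε) (d := d) h.region.near k
  rw [h.coeff, invSymb, if_neg hk] at e
  rw [smooth_apply, e, invAbs, if_neg hk]
  push_cast at n3 ⊢
  field_simp

lemma IsFixed.norm_mode (h0 : 0 ≤ ε) (h : IsFixed ε ω s d) {k : ℤ} (hk : ¬ |k| < 2) :
    ‖linSymb s ω k‖ * ‖smooth d k‖ = ε * ‖nonlin ω (smooth d) k‖ := by
  rw [← norm_mul, h.mode hk, norm_mul, norm_neg, Complex.norm_real, Real.norm_eq_abs,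
    abs_of_nonneg h0]

/-- Obtained by summing the mode equations. The right side involves `‖smooth d‖` again, so that each
known bound yields a better one. -/
lemma norm_smooth_mul_le (h0 : 0 ≤ ε) (h : IsFixed ε ω s d) {b : ℝ}
    (hb : ∀ k : ℤ, ¬ |k| < 2 → b ≤ ‖linSymb s ω k‖) :
    b * ‖smooth d‖ ≤ ε * (2 + 4 * ‖smooth d‖ + ‖smooth d‖ ^ 2) := by
  have h1 : b * ‖smooth d‖ ≤ ε * ‖nonlin ω (smooth d)‖ := by
    have := norm_le_of_le₃ (f := smooth d) (g₁ := nonlin ω (smooth d)) (g₂ := 0) (g₃ := 0)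
      (C := b) (C₁ := ε) (C₂ := 0) (C₃ := 0) fun k => by
        simp only [zero_mul, add_zero]
        by_cases hk : |k| < 2
        · rw [smooth_apply_of_lt d hk]; simp; positivity
        · rw [← h.norm_mode h0 hk]
          exact mul_le_mul_of_nonneg_right (hb k hk) (norm_nonneg _)
    simpa using this
  exact h1.trans (mul_le_mul_of_nonneg_left (norm_nonlin_le _ _) h0)

/-- The feedback step of the bootstrap: a smaller residual confines `ω` and `s`, which improves the
lower bounds of the symbol. -/
lemma norm_freq_ratio_sub_le {δ : ℝ} (hδ : δ ≤ 0.04) (h : IsFixed ε ω s d)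
    (hr : ‖resid ε ω d‖ ≤ δ) : |ω - π / 2| ≤ 1.0017 * δ ∧ |s - 1| ≤ (1 + 1.0017 * δ) * δ := by
  have hre := (Complex.abs_re_le_norm _).trans hr
  have him := (Complex.abs_im_le_norm _).trans hr
  have h0 : 0 ≤ δ := (abs_nonneg _).trans hre
  have hz : |(0 : ℝ)| ≤ δ := by simpa
  have h1 := abs_arccos_sub_le (by linarith) hre hz
  have h2 := abs_sin_arccos_sub_le (by linarith) hre hz
  rw [arccos_zero, sub_zero] at h1
  rw [arccos_zero, sin_pi_div_two, sub_zero] at h2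
  have hd : 0.9984 ≤ 1 - δ ^ 2 := by nlinarith
  have h3 : δ / (1 - δ ^ 2) ≤ 1.0017 * δ := by
    rw [div_le_iff₀ (by linarith)]; nlinarith
  have e1 := h.freq
  have e2 := h.ratio
  rw [newFreq] at e1
  rw [newRatio, newFreq] at e2
  rw [e1] at h1 h2
  rw [e1] at e2
  refine ⟨h1.trans (le_trans ?_ h3), ?_⟩
  · gcongr
  · rw [← e2, add_sub_right_comm]
    refine (abs_add_le _ _).trans ?_
    have := mul_le_mul h3 hre (abs_nonneg _) (by positivity)
    linarith

/-- Second mode of the nonlinearity without its leading part. -/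
def secondRem (ω : ℝ) (d : Coeff) : ℂ :=
  (delay ω 3 + delay ω (-1)) * smooth d 3 + quad ω (smooth d) 2

/-- Sharp bounds for a fixed point. -/
structure Sharp (ε ω s : ℝ) (d : Coeff) : Prop where
  freq : |ω - π / 2| ≤ 0.0096
  ratio : |s - 1| ≤ 0.0097
  resid : ‖resid ε ω d‖ ≤ 0.0096
  norm_d : ‖d‖ ≤ 0.355
  norm_c : ‖smooth d‖ ≤ 1.07 * ε
  apply_le : ∀ k, ‖smooth d k‖ ≤ 0.47 * ε
  three : ‖smooth d 3‖ ≤ 0.635 * ε ^ 2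
  quad_one : ‖quad ω (smooth d) 1‖ ≤ 1.2 * ε ^ 3
  second : ‖secondRem ω d‖ ≤ 1.85 * ε ^ 2
  first : ‖nonlin ω (smooth d) 1‖ ≤ 0.952 * ε
  symb_two : 2.19 ≤ ‖linSymb s ω 2‖
  symb : ∀ k : ℤ, ¬ |k| < 3 → 3.9 ≤ ‖linSymb s ω k‖

lemma norm_secondRem_le (ω : ℝ) (d : Coeff) :
    ‖secondRem ω d‖ ≤ 2 * ‖smooth d 3‖ + ‖quad ω (smooth d) 2‖ := by
  rw [secondRem]
  refine (norm_add_le _ _).trans ?_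
  rw [norm_mul]
  gcongr
  exact norm_delay_add_le _ _ _

lemma IsFixed.norm_resid_le (h0 : 0 ≤ ε) {b : ℝ} (hb : ‖nonlin ω (smooth d) 1‖ ≤ b) :
    ‖resid ε ω d‖ ≤ ε * b := by
  rw [resid, norm_mul, norm_neg, Complex.norm_real, Real.norm_eq_abs, abs_of_nonneg h0]
  gcongr

lemma forall_tail {P : ℤ → Prop} (hneg : ∀ k, P (-k) → P k) (h3 : P 3) (h4 : P 4)
    (h5 : ∀ k : ℤ, 5 ≤ k → P k) {k : ℤ} (hk : ¬ |k| < 3) : P k := by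
  have := forall_mode (P := fun k => ¬ |k| < 3 → P k)
    (fun k hk h => hneg k (hk (by rwa [abs_neg]))) (fun h => absurd (by norm_num) h)
    (fun _ => h3) (fun _ => h4) (fun k hk _ => h5 k hk) (k := k) (by omega)
  exact this hk

/-- The only term of order 1 in the nonlinearity sits at `k = ±2`, so the tail is of order `ε²` as
soon as `smooth d` is of order `ε`. -/
lemma norm_tail_mul_le (h0 : 0 ≤ ε) (h : IsFixed ε ω s d)
    (hb : ∀ k : ℤ, ¬ |k| < 3 → 3.9 ≤ ‖linSymb s ω k‖) :
    3.9 * ‖tail (smooth d)‖ ≤ ε * (4 * ‖smooth d‖ + ‖smooth d‖ ^ 2) := by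
  have := norm_le_of_le₃ (f := tail (smooth d)) (g₁ := cross ω (smooth d))
    (g₂ := quad ω (smooth d)) (g₃ := 0)
    (C := 3.9) (C₁ := ε) (C₂ := ε) (C₃ := 0) fun k => by
      simp only [zero_mul, add_zero]
      rw [tail_apply]
      split_ifs with hk
      · simp; positivity
      · have h1 := h.norm_mode h0 (k := k) (by omega)
        have h2 := mul_le_mul_of_nonneg_right (hb k hk) (norm_nonneg (smooth d k))
        have h3 : nonlin ω (smooth d) k = cross ω (smooth d) k + quad ω (smooth d) k := by
          rw [nonlin, add_apply, add_apply, Wright.second, add_apply, single_apply',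
            single_apply', if_neg (by rintro rfl; simp at hk),
            if_neg (by rintro rfl; simp at hk)]
          ring
        have h4 := norm_add_le (cross ω (smooth d) k) (quad ω (smooth d) k)
        rw [← h3] at h4
        have h5 := mul_le_mul_of_nonneg_left h4 h0
        linarith
  have h1 := mul_le_mul_of_nonneg_left (norm_cross_le ω (smooth d)) h0
  have h2 := mul_le_mul_of_nonneg_left (norm_quad_le ω (smooth d)) h0
  linarith

lemma IsFixed.rough (h0 : 0 ≤ ε) (hε : ε ≤ 0.1) (h : IsFixed ε ω s d) :
    ‖smooth d‖ ≤ 1.44 * ε ∧ |ω - π / 2| ≤ 0.0156 ∧ |s - 1| ≤ 0.0158 := by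
  set c := smooth d with hc
  have hn := norm_nonneg c
  have a1 : ‖c‖ ≤ 0.31 := h.region.norm_smooth_le
  have b1 : ∀ k : ℤ, ¬ |k| < 2 → 1.9 ≤ ‖linSymb s ω k‖ := by
    intro k hk
    obtain ⟨n1, n2⟩ := h.region.near
    by_cases h3 : |k| < 3
    · rcases eq_or_eq_neg_of_abs_eq (show |k| = 2 by omega) with rfl | rfl
      · have := le_norm_linSymb_two s ω; linarith
      · rw [norm_linSymb_neg]
        have := le_norm_linSymb_two s ω; linarith
    · have e1 := h.region.near.abs_le_norm hk
      have e2 := abs_cast_ge (n := 3) h3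
      push_cast at e2; linarith
  have a2 := norm_smooth_mul_le h0 h b1
  rw [← hc] at a2
  have a3 : ‖c‖ ≤ 1.76 * ε := by nlinarith
  have a4 : ‖c‖ ≤ 1.44 * ε := by nlinarith
  have a5 : ‖nonlin ω c 1‖ ≤ 1.55 * ε := by
    have e1 := norm_nonlin_one_le ω d
    have e2 := smooth_norm_le_half h.region.herm 2
    have e3 := norm_quad_apply_le ω (smooth_norm_le_half h.region.herm) 1
    rw [← hc] at e1 e2 e3
    nlinarith
  have a6 : ‖resid ε ω d‖ ≤ 0.0155 :=
    (IsFixed.norm_resid_le h0 a5).trans (by nlinarith)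
  obtain ⟨f1, f2⟩ := norm_freq_ratio_sub_le (by norm_num) h a6
  norm_num at f1 f2
  exact ⟨a4, by linarith, by linarith⟩

lemma le_norm_linSymb_tail (hω : |ω - π / 2| ≤ 0.0156) (hs : |s - 1| ≤ 0.0158) {k : ℤ}
    (hk : ¬ |k| < 3) : 3.9 ≤ ‖linSymb s ω k‖ := by
  refine forall_tail (P := fun k => 3.9 ≤ ‖linSymb s ω k‖) (fun k hk => ?_)
    ?_ ?_ (fun k hk => ?_) hk
  · rwa [norm_linSymb_neg] at hk
  · have := le_norm_linSymb_three s ω; linarith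
  · have := le_norm_linSymb_four s ω; linarith
  · have := le_norm_linSymb s ω k
    have hk' : (5 : ℝ) ≤ |(k : ℝ)| :=
      (by exact_mod_cast hk : (5 : ℝ) ≤ k).trans (le_abs_self _)
    have hs := (abs_le.1 hs).1
    nlinarith

/-- Second round of the bootstrap. The mode 2, of order `ε`, is separated from the tail, of order
`ε²`; only the former matters for the leading constants. -/
lemma IsFixed.sharp (h0 : 0 ≤ ε) (hε : ε ≤ 0.1) (h : IsFixed ε ω s d) : Sharp ε ω s d := by
  obtain ⟨a4, f1, f2⟩ := h.rough h0 hε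
  set c := smooth d with hc
  have hn := norm_nonneg c
  have hherm : Herm c := herm_smooth h.region.herm
  have hlow : ∀ k : ℤ, |k| < 2 → c k = 0 := fun k hk => smooth_apply_of_lt d hk
  have hε2 : ε ^ 2 ≤ 0.01 := by nlinarith
  have b2 : 2.17 ≤ ‖linSymb s ω 2‖ := by
    have := le_norm_linSymb_two s ω; linarith
  have b3 : ∀ k : ℤ, ¬ |k| < 3 → 3.9 ≤ ‖linSymb s ω k‖ :=
    fun k hk => le_norm_linSymb_tail f1 f2 hk
  have b4 : ∀ k : ℤ, ¬ |k| < 2 → 2.17 ≤ ‖linSymb s ω k‖ := by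
    intro k hk
    by_cases h3 : |k| < 3
    · rcases eq_or_eq_neg_of_abs_eq (show |k| = 2 by omega) with rfl | rfl
      · exact b2
      · rwa [norm_linSymb_neg]
    · linarith [b3 k h3]
  have a7 := norm_smooth_mul_le h0 h b4
  rw [← hc] at a7
  have a8 : ‖c‖ ≤ 1.2 * ε := by nlinarith
  have t1 := norm_tail_mul_le h0 h b3
  rw [← hc] at t1
  have t2 : ‖tail c‖ ≤ 1.27 * ε ^ 2 := by nlinarith
  have t3 : ‖c 3‖ ≤ 0.635 * ε ^ 2 := by linarith [two_norm_three_le hherm]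
  have s1 : ‖secondRem ω d‖ ≤ 2 * (0.635 * ε ^ 2) + ‖c‖ ^ 2 / 2 := by
    have e1 := norm_secondRem_le ω d
    have e3 := norm_quad_apply_le ω (smooth_norm_le_half h.region.herm) 2
    rw [← hc] at e1 e3
    linarith
  have hc2 : ‖c 2‖ ≤ 0.47 * ε := by
    have e1 := h.norm_mode h0 (k := 2) (by norm_num)
    rw [nonlin_two, add_assoc] at e1
    change _ = ε * ‖delay ω 1 + secondRem ω d‖ at e1
    have e2 := norm_add_le (delay ω 1) (secondRem ω d)
    rw [norm_delay] at e2
    -- Here `2 * 0.635 + 1.2² / 2 = 1.99` and `ε² ≤ 0.01`.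
    have e3 : ‖delay ω 1 + secondRem ω d‖ ≤ 1.0199 := by nlinarith
    have e4 := mul_le_mul_of_nonneg_left e3 h0
    have e5 := mul_le_mul_of_nonneg_right b2 (norm_nonneg (c 2))
    rw [← hc] at e1
    linarith
  have hcn : ‖c‖ ≤ 1.07 * ε := by
    have := norm_le_two_add_tail hherm hlow
    nlinarith
  have hap : ∀ k, ‖c k‖ ≤ 0.47 * ε := by
    intro k
    by_cases hk : |k| < 2
    · rw [hlow k hk, norm_zero]; positivity
    by_cases hk3 : |k| < 3
    · rcases eq_or_eq_neg_of_abs_eq (show |k| = 2 by omega) with rfl | rfl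
      · exact hc2
      · rwa [hherm.norm_neg]
    · have := norm_apply_le (tail c) k
      rw [tail_apply, if_neg hk3] at this
      nlinarith
  have hq : ‖quad ω c 1‖ ≤ 1.2 * ε ^ 3 := by
    refine (norm_quad_one_le ω hlow hap).trans ?_
    have := mul_le_mul_of_nonneg_left t2 (show 0 ≤ 2 * (0.47 * ε) by positivity)
    have p : 0 ≤ ε ^ 3 := by positivity
    linarith
  have hone : ‖nonlin ω c 1‖ ≤ 0.952 * ε := by
    have e1 := norm_nonlin_one_le ω d
    rw [← hc] at e1
    have p : ε ^ 3 ≤ 0.01 * ε := by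
      rw [pow_succ]; exact mul_le_mul_of_nonneg_right hε2 h0
    linarith [hap 2]
  have hres : ‖resid ε ω d‖ ≤ 0.00952 :=
    (IsFixed.norm_resid_le h0 hone).trans (by nlinarith)
  obtain ⟨g1, g2⟩ := norm_freq_ratio_sub_le (by norm_num) h hres
  norm_num at g1 g2
  refine ⟨by linarith, by linarith, by linarith, ?_, hcn, hap, t3, hq, ?_, hone, ?_, b3⟩
  · have e1 := norm_mul_le h.region.near.norm_invSymb_le (nonlin ω c)
    have e2 := norm_nonlin_le ω c
    have e3 := h.coeff
    rw [newCoeff, ← hc] at e3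
    have e4 : ‖nonlin ω c‖ ≤ 2.4395 := by nlinarith
    rw [← e3, norm_smul, norm_neg, Complex.norm_real, Real.norm_eq_abs, abs_of_nonneg h0]
    have e5 := norm_nonneg (mul (invSymb s ω) (nonlin ω c))
    nlinarith
  -- Now `s1` is used with the improved bound `1.07 * ε`: `1.27 + 1.07² / 2 ≤ 1.85`.
  · nlinarith
  · have := le_norm_linSymb_two s ω; linarith

end Wright
end

/-! ### Differences of two fixed points -/

noncomputable section
namespace Wright
open Coeff

variable {ε ε' ω ω' s s' : ℝ} {d d' : Coeff}

/-- Arranged so that the variation of the symbol, which costs a factor `|k|`, falls on `smooth d'`,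
where the weighted norm of `d'` pays for it. -/
lemma mode_sub (h : IsFixed ε ω s d) (h' : IsFixed ε' ω' s' d') {k : ℤ} (hk : ¬ |k| < 2) :
    linSymb s ω k * (smooth d - smooth d') k =
      -((ε - ε' : ℝ) : ℂ) * nonlin ω (smooth d) k
        - ε' * (nonlin ω (smooth d) k - nonlin ω' (smooth d') k)
        - (linSymb s ω k - linSymb s' ω' k) * smooth d' k := by
  have e := h.mode hk
  have e' := h'.mode hk
  rw [sub_apply]
  push_cast
  linear_combination e - e'

lemma norm_mode_sub_le (h0 : 0 ≤ ε') (hεε : ε' ≤ ε) (h : IsFixed ε ω s d)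
    (h' : IsFixed ε' ω' s' d') {k : ℤ} (hk : ¬ |k| < 2) :
    ‖linSymb s ω k‖ * ‖(smooth d - smooth d') k‖ ≤ (ε - ε') * ‖nonlin ω (smooth d) k‖ +
      ε' * ‖nonlin ω (smooth d) k - nonlin ω' (smooth d') k‖ +
      |(k : ℝ)| * (|ω - ω'| + |s - s'|) * ‖smooth d' k‖ := by
  rw [← norm_mul, mode_sub h h' hk]
  refine (norm_sub_le _ _).trans (add_le_add ((norm_sub_le _ _).trans (add_le_add ?_ ?_)) ?_)
  · rw [norm_mul, norm_neg, Complex.norm_real, Real.norm_eq_abs, abs_of_nonneg (by linarith)]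
  · rw [norm_mul, Complex.norm_real, Real.norm_eq_abs, abs_of_nonneg h0]
  · rw [norm_mul]
    exact mul_le_mul_of_nonneg_right (norm_linSymb_sub_le _ _ _ _ _) (norm_nonneg _)

lemma nonlin_apply_tail (ω : ℝ) (c : Coeff) {k : ℤ} (hk : ¬ |k| < 3) :
    nonlin ω c k = (cross ω c + quad ω c) k := by
  rw [nonlin, add_apply, add_apply, Wright.second, add_apply, single_apply',
    single_apply', if_neg (by rintro rfl; simp at hk),
    if_neg (by rintro rfl; simp at hk), add_apply]
  ring

lemma norm_tail_sub_le (h0 : 0 ≤ ε') (hεε : ε' ≤ ε) (h : IsFixed ε ω s d)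
    (h' : IsFixed ε' ω' s' d') (hb : ∀ k : ℤ, ¬ |k| < 3 → 3.9 ≤ ‖linSymb s ω k‖) :
    3.9 * ‖tail (smooth d - smooth d')‖ ≤
      (ε - ε') * ‖cross ω (smooth d) + quad ω (smooth d)‖ +
      ε' * ‖cross ω (smooth d) + quad ω (smooth d) -
        (cross ω' (smooth d') + quad ω' (smooth d'))‖ +
      (|ω - ω'| + |s - s'|) * ‖d'‖ := by
  refine norm_le_of_le₃ fun k => ?_
  rw [tail_apply]
  split_ifs with hk
  · have : 0 ≤ ε - ε' := by linarith
    simp only [norm_zero, mul_zero]; positivity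
  · have h1 := norm_mode_sub_le h0 hεε h h' (k := k) (by omega)
    rw [nonlin_apply_tail ω _ hk, nonlin_apply_tail ω' _ hk, ← sub_apply] at h1
    have h2 := mul_le_mul_of_nonneg_right (hb k hk) (norm_nonneg ((smooth d - smooth d') k))
    have h3 := mul_le_mul_of_nonneg_left (abs_mul_norm_smooth_apply_le d' k)
      (show 0 ≤ |ω - ω'| + |s - s'| by positivity)
    linarith

lemma norm_secondRem_sub_le (ω ω' : ℝ) (d d' : Coeff) :
    ‖secondRem ω d - secondRem ω' d'‖ ≤ 2 * ‖(smooth d - smooth d') 3‖ +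
      4 * |ω - ω'| * ‖smooth d' 3‖ + ‖quad ω (smooth d) 2 - quad ω' (smooth d') 2‖ := by
  have e : secondRem ω d - secondRem ω' d' =
      (delay ω 3 + delay ω (-1)) * (smooth d - smooth d') 3 +
      ((delay ω 3 - delay ω' 3) + (delay ω (-1) - delay ω' (-1))) * smooth d' 3 +
      (quad ω (smooth d) 2 - quad ω' (smooth d') 2) := by
    simp only [secondRem, sub_apply]; ring
  have h2 := norm_delay_sub_le ω ω' 3
  have h1 := norm_delay_sub_le ω ω' (-1)
  have h3 := norm_add_le (delay ω 3 - delay ω' 3) (delay ω (-1) - delay ω' (-1))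
  norm_num at h1 h2
  rw [e]
  refine norm_add₃_le.trans ?_
  rw [norm_mul, norm_mul]
  gcongr
  · exact norm_delay_add_le _ _ _
  · linarith

lemma nonlin_two_eq (ω : ℝ) (d : Coeff) :
    nonlin ω (smooth d) 2 = delay ω 1 + secondRem ω d := by
  rw [nonlin_two, secondRem]; ring

/-- Bounds for the difference of two fixed points in terms of that of the amplitudes. -/
structure DiffBound (h ω ω' s s' : ℝ) (d d' : Coeff) : Prop where
  freq : |ω - ω'| ≤ 0.22 * h
  ratio : |s - s'| ≤ 0.22 * h
  second : ‖secondRem ω d - secondRem ω' d'‖ ≤ 0.45 * h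
  quad_one : ‖quad ω (smooth d) 1 - quad ω' (smooth d') 1‖ ≤ 0.14 * h

/-- To leading order `ω` follows the real part of the residual and `s` the imaginary part. Keeping
the two apart preserves the signs needed for the monotonicity of `ω / s`. -/
lemma IsFixed.freq_sub_le (h : IsFixed ε ω s d) (h' : IsFixed ε' ω' s' d') {δ : ℝ} (hδ : δ ≤ 0.01)
    (hr : ‖resid ε ω d‖ ≤ δ) (hr' : ‖resid ε' ω' d'‖ ≤ δ) :
    |ω - ω'| ≤ 1.001 * |(resid ε ω d).re - (resid ε' ω' d').re| ∧
    |(s - s') - ((resid ε ω d).im - (resid ε' ω' d').im)| ≤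
      0.0101 * |(resid ε ω d).re - (resid ε' ω' d').re| := by
  have hre := ((Complex.abs_re_le_norm _).trans hr).trans hδ
  have hre' := ((Complex.abs_re_le_norm _).trans hr').trans hδ
  have h1 := abs_arccos_sub_le (by norm_num) hre hre'
  have h2 := abs_sin_arccos_sub_le (by norm_num) hre hre'
  have e1 : arccos (resid ε ω d).re = ω := h.freq
  have e1' : arccos (resid ε' ω' d').re = ω' := h'.freq
  have e2 : sin (arccos (resid ε ω d).re) + (resid ε ω d).im = s := h.ratio
  have e2' : sin (arccos (resid ε' ω' d').re) + (resid ε' ω' d').im = s' := h'.ratio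
  rw [e1, e1'] at h1 h2
  rw [e1] at e2
  rw [e1'] at e2'
  have p := abs_nonneg ((resid ε ω d).re - (resid ε' ω' d').re)
  refine ⟨h1.trans ?_, ?_⟩
  · rw [div_le_iff₀ (by norm_num)]; linarith
  · rw [← e2, ← e2', show ∀ a b c d : ℝ, a + b - (c + d) - (b - d) = a - c by intros; ring]
    refine h2.trans ?_
    norm_num
    linarith

lemma norm_resid_sub_le' (h0 : 0 ≤ ε') (hεε : ε' ≤ ε) :
    ‖resid ε ω d - resid ε' ω' d'‖ ≤ (ε - ε') * ‖nonlin ω (smooth d) 1‖ +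
      ε' * ‖nonlin ω (smooth d) 1 - nonlin ω' (smooth d') 1‖ := by
  have e : resid ε ω d - resid ε' ω' d' = -(((ε - ε' : ℝ) : ℂ) * nonlin ω (smooth d) 1 +
      (ε' : ℂ) * (nonlin ω (smooth d) 1 - nonlin ω' (smooth d') 1)) := by
    simp only [resid]; push_cast; ring
  rw [e, norm_neg]
  refine (norm_add_le _ _).trans ?_
  rw [norm_mul, norm_mul, Complex.norm_real, Complex.norm_real, Real.norm_eq_abs,
    Real.norm_eq_abs, abs_of_nonneg h0, abs_of_nonneg (by linarith : 0 ≤ ε - ε')]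

lemma Sharp.small (hε : ε ≤ 0.1) (S : Sharp ε ω s d) :
    ‖smooth d‖ ≤ 0.107 ∧ ‖smooth d 2‖ ≤ 0.047 ∧ ‖smooth d 3‖ ≤ 0.00635 ∧
      ‖secondRem ω d‖ ≤ 0.0185 ∧ ‖nonlin ω (smooth d) 1‖ ≤ 0.0952 := by
  have h0 : 0 ≤ ε := by linarith [S.norm_c, norm_nonneg (smooth d)]
  have hε2 : ε ^ 2 ≤ 0.01 := by nlinarith
  exact ⟨by linarith [S.norm_c], by linarith [S.apply_le 2], by linarith [S.three],
    by linarith [S.second], by linarith [S.first]⟩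

lemma norm_quad_apply_sub_le (hε : ε ≤ 0.1) (hε' : ε' ≤ 0.1) (h : IsFixed ε ω s d)
    (h' : IsFixed ε' ω' s' d') (S : Sharp ε ω s d) (S' : Sharp ε' ω' s' d') (k : ℤ) :
    ‖quad ω (smooth d) k - quad ω' (smooth d') k‖ ≤
      0.1005 * ‖smooth d - smooth d'‖ + 0.0167 * |ω - ω'| := by
  have e1 := norm_quad_sub_apply_le ω ω' (d := d) (d' := d') (m := 0.047)
    (fun j => (S.apply_le j).trans (by linarith))
    (smooth_sub_norm_le_half h.region.herm h'.region.herm) k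
  have p := norm_nonneg (smooth d - smooth d')
  have e2 := mul_le_mul_of_nonneg_left S'.norm_d (abs_nonneg (ω - ω'))
  have e3 := mul_le_mul_of_nonneg_right (S'.small hε').1
    (by positivity : 0 ≤ ‖smooth d - smooth d'‖ / 2)
  linarith [abs_nonneg (ω - ω')]

lemma norm_secondRem_sub_le' (hε : ε ≤ 0.1) (hε' : ε' ≤ 0.1) (h : IsFixed ε ω s d)
    (h' : IsFixed ε' ω' s' d') (S : Sharp ε ω s d) (S' : Sharp ε' ω' s' d') :
    ‖secondRem ω d - secondRem ω' d'‖ ≤ ‖tail (smooth d - smooth d')‖ +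
      0.1005 * ‖smooth d - smooth d'‖ + 0.0422 * |ω - ω'| := by
  have e1 := norm_secondRem_sub_le ω ω' d d'
  have e2 := norm_quad_apply_sub_le hε hε' h h' S S' 2
  have e3 := mul_le_mul_of_nonneg_left (S'.small hε').2.2.1
    (by positivity : 0 ≤ 4 * |ω - ω'|)
  have e4 := two_norm_three_le
    ((herm_smooth h.region.herm).sub (herm_smooth h'.region.herm))
  linarith [abs_nonneg (ω - ω')]

lemma norm_second_mode_sub_le (h0 : 0 ≤ ε') (hεε : ε' ≤ ε) (hε : ε ≤ 0.1) (h : IsFixed ε ω s d)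
    (h' : IsFixed ε' ω' s' d') (S : Sharp ε ω s d) (S' : Sharp ε' ω' s' d') :
    2.19 * ‖(smooth d - smooth d') 2‖ ≤ 1.0185 * (ε - ε') +
      0.1 * (|ω - ω'| + (‖tail (smooth d - smooth d')‖ +
      0.1005 * ‖smooth d - smooth d'‖ + 0.0422 * |ω - ω'|)) +
      2 * (|ω - ω'| + |s - s'|) * 0.047 := by
  have hε' := hεε.trans hε
  have e1 := norm_mode_sub_le h0 hεε h h' (k := 2) (by norm_num)
  rw [nonlin_two_eq, nonlin_two_eq, add_sub_add_comm] at e1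
  have e2 := norm_add_le (delay ω 1 - delay ω' 1) (secondRem ω d - secondRem ω' d')
  have e3 := norm_delay_sub_le ω ω' 1
  have e4 := norm_add_le (delay ω 1) (secondRem ω d)
  rw [norm_delay] at e4
  rw [Int.cast_one, abs_one, one_mul] at e3
  have e5 := mul_le_mul_of_nonneg_left (e4.trans (add_le_add_right (S.small hε).2.2.2.1 1))
    (sub_nonneg.2 hεε)
  have e6 := mul_le_mul hε' (e2.trans (add_le_add e3 (norm_secondRem_sub_le' hε hε' h h' S S')))
    (norm_nonneg _) (by norm_num)
  have e7 := mul_le_mul_of_nonneg_left (S'.small hε').2.1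
    (by positivity : 0 ≤ 2 * (|ω - ω'| + |s - s'|))
  have e8 := mul_le_mul_of_nonneg_right S.symb_two (norm_nonneg ((smooth d - smooth d') 2))
  rw [show |((2 : ℤ) : ℝ)| = 2 by norm_num] at e1
  linarith

lemma norm_tail_sub_le' (h0 : 0 ≤ ε') (hεε : ε' ≤ ε) (hε : ε ≤ 0.1) (h : IsFixed ε ω s d)
    (h' : IsFixed ε' ω' s' d') (S : Sharp ε ω s d) (S' : Sharp ε' ω' s' d') :
    3.9 * ‖tail (smooth d - smooth d')‖ ≤ 0.4395 * (ε - ε') +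
      0.1 * (4.214 * ‖smooth d - smooth d'‖ + 0.962 * |ω - ω'|) +
      0.355 * (|ω - ω'| + |s - s'|) := by
  have hε' := hεε.trans hε
  have pτ := abs_nonneg (ω - ω')
  have pn := norm_nonneg (smooth d - smooth d')
  have cb := (S.small hε).1
  have cb' := (S'.small hε').1
  have e1 := norm_tail_sub_le h0 hεε h h' S.symb
  have e2 := norm_cross_le ω (smooth d)
  have e3 := norm_quad_le ω (smooth d)
  have e4 := pow_le_pow_left₀ (norm_nonneg _) cb 2
  have e5 := norm_add_le (cross ω (smooth d)) (quad ω (smooth d))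
  have e6 := norm_cross_sub_le ω ω' d d'
  have e7 := norm_quad_sub_le ω ω' d d'
  have e15 := mul_le_mul_of_nonneg_left S'.norm_d pτ
  have e8 := mul_le_mul (add_le_add_right e15 ‖smooth d - smooth d'‖) cb (norm_nonneg _)
    (by positivity)
  have e9 := mul_le_mul_of_nonneg_right cb' pn
  have e10 := mul_le_mul_of_nonneg_left cb' pτ
  have e11 := norm_add_le (cross ω (smooth d) - cross ω' (smooth d'))
    (quad ω (smooth d) - quad ω' (smooth d'))
  rw [← add_sub_add_comm] at e11
  have e12 := mul_le_mul_of_nonneg_left (show ‖cross ω (smooth d) + quad ω (smooth d)‖ ≤ 0.4395 by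
    linarith) (sub_nonneg.2 hεε)
  have e13 := mul_le_mul hε' (show ‖cross ω (smooth d) + quad ω (smooth d) -
      (cross ω' (smooth d') + quad ω' (smooth d'))‖ ≤
      4.214 * ‖smooth d - smooth d'‖ + 0.962 * |ω - ω'| by linarith)
    (norm_nonneg _) (by norm_num)
  have e14 := mul_le_mul_of_nonneg_left S'.norm_d
    (by positivity : 0 ≤ |ω - ω'| + |s - s'|)
  linarith

lemma norm_resid_sub_le_modes (h0 : 0 ≤ ε') (hεε : ε' ≤ ε) (hε : ε ≤ 0.1) (h : IsFixed ε ω s d)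
    (h' : IsFixed ε' ω' s' d') (S : Sharp ε ω s d) (S' : Sharp ε' ω' s' d') :
    ‖resid ε ω d - resid ε' ω' d'‖ ≤ 0.0952 * (ε - ε') +
      0.1 * (2 * ‖(smooth d - smooth d') 2‖ + 0.1005 * ‖smooth d - smooth d'‖ +
        0.158 * |ω - ω'|) := by
  have hε' := hεε.trans hε
  have e1 := norm_resid_sub_le' (ω := ω) (ω' := ω') (d := d) (d' := d') h0 hεε
  have e2 := norm_nonlin_one_sub_le ω ω' d d'
  have e3 := norm_quad_apply_sub_le hε hε' h h' S S' 1
  have e4 := mul_le_mul_of_nonneg_left (S.small hε).2.2.2.2 (sub_nonneg.2 hεε)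
  have e5 := mul_le_mul_of_nonneg_left (S'.small hε').2.1
    (by positivity : 0 ≤ 3 * |ω - ω'|)
  have e6 := mul_le_mul hε' (show ‖nonlin ω (smooth d) 1 - nonlin ω' (smooth d') 1‖ ≤
      2 * ‖(smooth d - smooth d') 2‖ + 0.1005 * ‖smooth d - smooth d'‖ +
        0.158 * |ω - ω'| by linarith [abs_nonneg (ω - ω')]) (norm_nonneg _) (by norm_num)
  linarith

/-- The constants improve greatly on `IsFixed.sub_le`. The estimates for residual, mode 2, tail and
parameters form a coupled linear system with weak feedback, which is solved. -/
lemma IsFixed.diffBound (h0 : 0 ≤ ε') (hεε : ε' ≤ ε) (hε : ε ≤ 0.1) (h : IsFixed ε ω s d)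
    (h' : IsFixed ε' ω' s' d') : DiffBound (ε - ε') ω ω' s s' d d' := by
  have hε' := hεε.trans hε
  have S := h.sharp (h0.trans hεε) hε
  have S' := h'.sharp h0 hε'
  have hh : 0 ≤ ε - ε' := by linarith
  have hermΔ : Herm (smooth d - smooth d') :=
    (herm_smooth h.region.herm).sub (herm_smooth h'.region.herm)
  have hsplit := norm_le_two_add_tail hermΔ fun k hk => by
    rw [sub_apply, smooth_apply_of_lt d hk, smooth_apply_of_lt d' hk, sub_zero]
  have h1 := norm_resid_sub_le_modes h0 hεε hε h h' S S'
  have h2 := norm_second_mode_sub_le h0 hεε hε h h' S S'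
  have h3 := norm_tail_sub_le' h0 hεε hε h h' S S'
  have hq := norm_quad_apply_sub_le hε hε' h h' S S' 1
  have hs := norm_secondRem_sub_le' hε hε' h h' S S'
  obtain ⟨f1, f2⟩ := h.freq_sub_le h' (by norm_num) S.resid S'.resid
  have r1 := Complex.abs_re_le_norm (resid ε ω d - resid ε' ω' d')
  have r2 := Complex.abs_im_le_norm (resid ε ω d - resid ε' ω' d')
  rw [Complex.sub_re] at r1
  rw [Complex.sub_im] at r2
  have f4 := abs_sub_abs_le_abs_sub (s - s') ((resid ε ω d).im - (resid ε' ω' d').im)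
  -- With all norms replaced by real variables, only linear inequalities remain.
  generalize ‖resid ε ω d - resid ε' ω' d'‖ = R at *
  generalize |(resid ε ω d).re - (resid ε' ω' d').re| = R1 at *
  generalize |(resid ε ω d).im - (resid ε' ω' d').im| = R2 at *
  have hdef : DiffBound (ε - ε') ω ω' s s' d d' ↔ |ω - ω'| ≤ 0.22 * (ε - ε') ∧
      |s - s'| ≤ 0.22 * (ε - ε') ∧ ‖secondRem ω d - secondRem ω' d'‖ ≤ 0.45 * (ε - ε') ∧
      ‖quad ω (smooth d) 1 - quad ω' (smooth d') 1‖ ≤ 0.14 * (ε - ε') :=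
    ⟨fun ⟨a, b, c, d⟩ => ⟨a, b, c, d⟩, fun ⟨a, b, c, d⟩ => ⟨a, b, c, d⟩⟩
  rw [hdef]
  have pn := norm_nonneg (smooth d - smooth d')
  have pτ := abs_nonneg (ω - ω')
  have pσ := abs_nonneg (s - s')
  generalize ‖smooth d - smooth d'‖ = n at *
  generalize ‖(smooth d - smooth d') 2‖ = n2 at *
  generalize ‖tail (smooth d - smooth d')‖ = nt at *
  generalize ‖secondRem ω d - secondRem ω' d'‖ = x at *
  generalize ‖quad ω (smooth d) 1 - quad ω' (smooth d') 1‖ = y at *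
  generalize |s - s' - ((resid ε ω d).im - (resid ε' ω' d').im)| = R3 at *
  generalize |ω - ω'| = τ at *
  generalize |s - s'| = σ at *
  generalize ε - ε' = t at *
  clear hdef S S' h h' hermΔ
  have f3 : τ ≤ 1.001 * R := by linarith
  have f5 : σ ≤ 1.0111 * R := by linarith
  have hR' : R ≤ 0.217 * t := by linarith
  have hnn : n ≤ 1.34 * t := by linarith
  have hnt' : nt ≤ 0.302 * t := by linarith
  refine ⟨by linarith, by linarith, by linarith, by linarith⟩

end Wright
end

/-! ### The reduced equation and the monotonicity of the parameter -/

noncomputable section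
namespace Wright
open Coeff

variable {ε ε' ω ω' s s' : ℝ} {d d' : Coeff}

/-- The value at the bifurcation point of the leading coefficient of the reduced equation. -/
def hopfCoeff : ℂ := (1 - 3 * Complex.I) / 5

/-- The leading coefficient of the reduced equation. -/
def leadCoeff (s ω : ℝ) : ℂ := (delay ω 3 + 1) / linSymb s ω 2

/-- The correction to the leading coefficient of the reduced equation. -/
def remCoeff (s ω : ℝ) (d : Coeff) : ℂ :=
  (delay ω 2 + delay ω (-1)) * secondRem ω d / linSymb s ω 2

lemma delay_add_mul_delay_one (ω : ℝ) :
    (delay ω 2 + delay ω (-1)) * delay ω 1 = delay ω 3 + 1 := by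
  have h : delay ω (-1) * delay ω 1 = 1 := by
    rw [delay, delay, ← Complex.exp_add]; simp
  rw [add_mul, h, delay_two, delay_three]; ring

lemma norm_hopfCoeff_le : ‖hopfCoeff‖ ≤ 0.6325 := by
  apply norm_le_of_sq_le (by norm_num)
  have h1 : hopfCoeff.re = 1 / 5 := by simp [hopfCoeff]
  have h2 : hopfCoeff.im = -3 / 5 := by simp [hopfCoeff]
  rw [h1, h2]; norm_num

lemma IsFixed.symb_two_ne (S : Sharp ε ω s d) : linSymb s ω 2 ≠ 0 :=
  norm_pos_iff.1 (by linarith [S.symb_two])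

/-- The mode 2 is solved for `c_2` and inserted into the mode 1. The last term is of order `ε⁴`,
since the quadratic part at index 1 is of order `ε³`. -/
lemma IsFixed.resid_eq (h : IsFixed ε ω s d) (S : Sharp ε ω s d) :
    resid ε ω d = (ε : ℂ) ^ 2 * leadCoeff s ω + (ε : ℂ) ^ 2 * remCoeff s ω d -
      ε * quad ω (smooth d) 1 := by
  have n := IsFixed.symb_two_ne S
  have e := h.mode (k := 2) (by norm_num)
  rw [nonlin_two_eq] at e
  have e2 : smooth d 2 = -(ε : ℂ) * (delay ω 1 + secondRem ω d) / linSymb s ω 2 := by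
    rw [← e]; field_simp
  rw [resid, nonlin_one, e2, leadCoeff, remCoeff, ← delay_add_mul_delay_one]
  field_simp
  ring

/-- Quotients by the symbol at `k = 2` are estimated after multiplication by it. -/
lemma le_of_mul_le_norm {z L : ℂ} {b x : ℝ} (hL : 2.19 ≤ ‖L‖) (h : ‖z * L‖ ≤ x)
    (hb : x ≤ 2.19 * b) : ‖z‖ ≤ b := by
  rw [norm_mul] at h
  have := mul_le_mul_of_nonneg_left hL (norm_nonneg z)
  linarith

lemma norm_leadCoeff_sub_hopfCoeff_le (S : Sharp ε ω s d) :
    ‖leadCoeff s ω - hopfCoeff‖ ≤ 0.0245 := by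
  have n := IsFixed.symb_two_ne S
  -- At the centre `(1 - 3i)/5 * (-1 + 2i) = 1 + i = e^{-3πi/2} + 1`, so only variations of delay
  -- and symbol survive.
  have e : (leadCoeff s ω - hopfCoeff) * linSymb s ω 2 =
      (delay ω 3 - delay (π / 2) 3) - hopfCoeff * (linSymb s ω 2 - linSymb 1 (π / 2) 2) := by
    rw [sub_mul, leadCoeff, div_mul_cancel₀ _ n, linSymb_two_center, delay_three (π / 2),
      delay_one_pi_div_two, hopfCoeff]
    linear_combination ((6 / 5 : ℂ) - Complex.I) * Complex.I_sq
  have h1 := norm_delay_sub_le ω (π / 2) 3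
  have h2 := norm_linSymb_sub_le s 1 ω (π / 2) 2
  norm_num at h1 h2
  have h3 : ‖hopfCoeff * (linSymb s ω 2 - linSymb 1 (π / 2) 2)‖ ≤ 0.6325 * 0.0386 := by
    rw [norm_mul]
    exact mul_le_mul norm_hopfCoeff_le (by linarith [S.freq, S.ratio]) (norm_nonneg _)
      (by norm_num)
  refine le_of_mul_le_norm S.symb_two (x := 3 * 0.0096 + 0.6325 * 0.0386) ?_ (by norm_num)
  rw [e]
  refine (norm_sub_le _ _).trans (add_le_add ?_ h3)
  linarith [S.freq]

lemma norm_leadCoeff_le (S : Sharp ε ω s d) : ‖leadCoeff s ω‖ ≤ 0.657 := by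
  have h1 := norm_leadCoeff_sub_hopfCoeff_le S
  have h2 := norm_le_norm_add_norm_sub' (leadCoeff s ω) hopfCoeff
  linarith [norm_hopfCoeff_le]

lemma norm_leadCoeff_sub_le {h : ℝ} (S : Sharp ε ω s d) (S' : Sharp ε' ω' s' d')
    (D : DiffBound h ω ω' s s' d d') : ‖leadCoeff s ω - leadCoeff s' ω'‖ ≤ 0.567 * h := by
  have n := IsFixed.symb_two_ne S
  have n' := IsFixed.symb_two_ne S'
  have e : (leadCoeff s ω - leadCoeff s' ω') * linSymb s ω 2 =
      (delay ω 3 - delay ω' 3) - leadCoeff s' ω' * (linSymb s ω 2 - linSymb s' ω' 2) := by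
    rw [leadCoeff, leadCoeff]; field_simp; ring
  have h1 := norm_delay_sub_le ω ω' 3
  have h2 := norm_linSymb_sub_le s s' ω ω' 2
  norm_num at h1 h2
  have h3 : ‖leadCoeff s' ω' * (linSymb s ω 2 - linSymb s' ω' 2)‖ ≤ 0.657 * (0.88 * h) := by
    rw [norm_mul]
    exact mul_le_mul (norm_leadCoeff_le S') (by linarith [D.freq, D.ratio]) (norm_nonneg _)
      (by norm_num)
  have hh : 0 ≤ h := by linarith [D.freq, abs_nonneg (ω - ω')]
  refine le_of_mul_le_norm S.symb_two (x := 0.66 * h + 0.657 * (0.88 * h)) ?_ (by linarith)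
  rw [e]
  refine (norm_sub_le _ _).trans (add_le_add ?_ h3)
  linarith [D.freq]

lemma norm_remCoeff_le (hε : ε ≤ 0.1) (S : Sharp ε ω s d) : ‖remCoeff s ω d‖ ≤ 0.0169 := by
  have n := IsFixed.symb_two_ne S
  refine le_of_mul_le_norm S.symb_two (x := 2 * 0.0185) ?_ (by norm_num)
  rw [remCoeff, div_mul_cancel₀ _ n, norm_mul]
  exact mul_le_mul (norm_delay_add_le _ _ _) (S.small hε).2.2.2.1 (norm_nonneg _) (by norm_num)

lemma norm_remCoeff_sub_le {h : ℝ} (hε' : ε' ≤ 0.1) (S : Sharp ε ω s d) (S' : Sharp ε' ω' s' d')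
    (D : DiffBound h ω ω' s s' d d') : ‖remCoeff s ω d - remCoeff s' ω' d'‖ ≤ 0.424 * h := by
  have n := IsFixed.symb_two_ne S
  have n' := IsFixed.symb_two_ne S'
  have e : (remCoeff s ω d - remCoeff s' ω' d') * linSymb s ω 2 =
      (delay ω 2 + delay ω (-1)) * (secondRem ω d - secondRem ω' d') +
      ((delay ω 2 - delay ω' 2) + (delay ω (-1) - delay ω' (-1))) * secondRem ω' d' -
      remCoeff s' ω' d' * (linSymb s ω 2 - linSymb s' ω' 2) := by
    rw [remCoeff, remCoeff]; field_simp; ring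
  have h1 := norm_delay_sub_le ω ω' 2
  have h1' := norm_delay_sub_le ω ω' (-1)
  have h2 := norm_linSymb_sub_le s s' ω ω' 2
  norm_num at h1 h1' h2
  have h3 : ‖remCoeff s' ω' d' * (linSymb s ω 2 - linSymb s' ω' 2)‖ ≤ 0.0169 * (0.88 * h) := by
    rw [norm_mul]
    exact mul_le_mul (norm_remCoeff_le hε' S') (by linarith [D.freq, D.ratio]) (norm_nonneg _)
      (by norm_num)
  have h4 : ‖(delay ω 2 + delay ω (-1)) * (secondRem ω d - secondRem ω' d')‖ ≤
      2 * (0.45 * h) := by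
    rw [norm_mul]
    exact mul_le_mul (norm_delay_add_le _ _ _) D.second (norm_nonneg _) (by norm_num)
  have h5 : ‖((delay ω 2 - delay ω' 2) + (delay ω (-1) - delay ω' (-1))) * secondRem ω' d'‖ ≤
      (0.66 * h) * 0.0185 := by
    rw [norm_mul]
    have h6 := norm_add_le (delay ω 2 - delay ω' 2) (delay ω (-1) - delay ω' (-1))
    have hh : 0 ≤ h := by linarith [D.freq, abs_nonneg (ω - ω')]
    exact mul_le_mul (by linarith [D.freq]) (S'.small hε').2.2.2.1 (norm_nonneg _)
      (by linarith)
  have hh : 0 ≤ h := by linarith [D.freq, abs_nonneg (ω - ω')]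
  refine le_of_mul_le_norm S.symb_two (x := 2 * (0.45 * h) + (0.66 * h) * 0.0185 +
    0.0169 * (0.88 * h)) ?_ (by linarith)
  rw [e]
  exact (norm_sub_le _ _).trans (add_le_add ((norm_add_le _ _).trans (add_le_add h4 h5)) h3)

/-- The reduced equation is, up to a small relative error, quadratic in the amplitude. -/
lemma IsFixed.norm_resid_sub_sub_le (h0 : 0 ≤ ε') (hεε : ε' ≤ ε) (hε : ε ≤ 0.1)
    (h : IsFixed ε ω s d) (h' : IsFixed ε' ω' s' d') :
    ‖resid ε ω d - resid ε' ω' d' - ((ε ^ 2 - ε' ^ 2 : ℝ) : ℂ) * hopfCoeff‖ ≤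
      0.0535 * (ε ^ 2 - ε' ^ 2) + 0.24 * (ε' * (ε - ε')) := by
  have hε' := hεε.trans hε
  have S := h.sharp (h0.trans hεε) hε
  have S' := h'.sharp h0 hε'
  have D := h.diffBound h0 hεε hε h'
  have hh : 0 ≤ ε - ε' := by linarith
  have hp : 0 ≤ ε ^ 2 - ε' ^ 2 := by nlinarith
  -- The splitting is `ε² A - ε'² A' = (ε² - ε'²) A + ε'² (A - A')`, and similarly for the term
  -- linear in the amplitude.
  have e : resid ε ω d - resid ε' ω' d' - ((ε ^ 2 - ε' ^ 2 : ℝ) : ℂ) * hopfCoeff =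
      ((ε ^ 2 - ε' ^ 2 : ℝ) : ℂ) * ((leadCoeff s ω - hopfCoeff) + remCoeff s ω d) +
      ((ε' ^ 2 : ℝ) : ℂ) * ((leadCoeff s ω - leadCoeff s' ω') +
        (remCoeff s ω d - remCoeff s' ω' d')) -
      (((ε - ε' : ℝ) : ℂ) * quad ω (smooth d) 1 +
        (ε' : ℂ) * (quad ω (smooth d) 1 - quad ω' (smooth d') 1)) := by
    rw [h.resid_eq S, h'.resid_eq S']; push_cast; ring
  have t1 := (norm_add_le (leadCoeff s ω - hopfCoeff) (remCoeff s ω d)).trans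
    (add_le_add (norm_leadCoeff_sub_hopfCoeff_le S) (norm_remCoeff_le hε S))
  have t2 := (norm_add_le (leadCoeff s ω - leadCoeff s' ω')
    (remCoeff s ω d - remCoeff s' ω' d')).trans
    (add_le_add (norm_leadCoeff_sub_le S S' D) (norm_remCoeff_sub_le hε' S S' D))
  have u1 := mul_le_mul_of_nonneg_left t1 hp
  have u2 := mul_le_mul_of_nonneg_left t2 (sq_nonneg ε')
  have u3 := mul_le_mul_of_nonneg_left S.quad_one hh
  have u4 := mul_le_mul_of_nonneg_left D.quad_one h0
  rw [e]
  refine (norm_sub_le _ _).trans ((add_le_add (norm_add_le _ _) (norm_add_le _ _)).trans ?_)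
  rw [norm_mul, norm_mul, norm_mul, norm_mul, Complex.norm_real, Complex.norm_real,
    Complex.norm_real, Complex.norm_real, Real.norm_eq_abs, Real.norm_eq_abs, Real.norm_eq_abs,
    Real.norm_eq_abs, abs_of_nonneg hp, abs_of_nonneg hh, abs_of_nonneg h0,
    abs_of_nonneg (sq_nonneg ε')]
  have v0 : 0 ≤ ε' * (ε - ε') := mul_nonneg h0 hh
  have v1 : ε' ^ 2 * (ε - ε') ≤ 0.1 * (ε' * (ε - ε')) := by
    rw [sq, mul_assoc]; exact mul_le_mul_of_nonneg_right hε' (by positivity)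
  have v2 : ε ^ 3 * (ε - ε') ≤ 0.01 * (ε ^ 2 - ε' ^ 2) := by
    have w1 : ε ^ 2 ≤ 0.01 := by nlinarith
    have w2 : ε * (ε - ε') ≤ ε ^ 2 - ε' ^ 2 := by nlinarith
    have w3 : 0 ≤ ε * (ε - ε') := mul_nonneg (h0.trans hεε) hh
    calc ε ^ 3 * (ε - ε') = ε ^ 2 * (ε * (ε - ε')) := by ring
      _ ≤ 0.01 * (ε ^ 2 - ε' ^ 2) := mul_le_mul w1 w2 w3 (by norm_num)
  -- The totals are `0.0245 + 0.0169 + 1.2 * 0.01 ≤ 0.0535` and `0.1 * (0.567 + 0.424) + 0.14 ≤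
  -- 0.24`.
  linarith

/-- Bounds for the differences of frequencies and ratios `s = ω/α`. -/
lemma IsFixed.freq_ratio_sub (h0 : 0 ≤ ε') (hεε : ε' ≤ ε) (hε : ε ≤ 0.1)
    (h : IsFixed ε ω s d) (h' : IsFixed ε' ω' s' d') {θ : ℝ} (hθ : θ ≤ 0.3)
    (hb : 0.0535 * (ε ^ 2 - ε' ^ 2) + 0.24 * (ε' * (ε - ε')) ≤ θ * (ε ^ 2 - ε' ^ 2)) :
    -(1.001 * (0.2 + θ) * (ε ^ 2 - ε' ^ 2)) ≤ ω - ω' ∧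
      s - s' ≤ -((0.594 - θ) * (ε ^ 2 - ε' ^ 2)) := by
  have S := h.sharp (h0.trans hεε) hε
  have S' := h'.sharp h0 (hεε.trans hε)
  have hp : 0 ≤ ε ^ 2 - ε' ^ 2 := by nlinarith
  have hr := (h.norm_resid_sub_sub_le h0 hεε hε h').trans hb
  obtain ⟨f1, f2⟩ := h.freq_sub_le h' (by norm_num) S.resid S'.resid
  have r1 := (Complex.abs_re_le_norm _).trans hr
  have r2 := (Complex.abs_im_le_norm _).trans hr
  have g1 : hopfCoeff.re = 1 / 5 := by simp [hopfCoeff]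
  have g2 : hopfCoeff.im = -3 / 5 := by simp [hopfCoeff]
  rw [Complex.sub_re, Complex.sub_re, Complex.re_ofReal_mul, g1] at r1
  rw [Complex.sub_im, Complex.sub_im, Complex.im_ofReal_mul, g2] at r2
  have hre : |(resid ε ω d).re - (resid ε' ω' d').re| ≤ (0.2 + θ) * (ε ^ 2 - ε' ^ 2) := by
    have := abs_sub_abs_le_abs_sub ((resid ε ω d).re - (resid ε' ω' d').re)
      ((ε ^ 2 - ε' ^ 2) * (1 / 5))
    rw [abs_of_nonneg (a := (ε ^ 2 - ε' ^ 2) * (1 / 5)) (by positivity)] at this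
    linarith
  -- For `θ ≤ 0.3` the error `0.0101 * (0.2 + θ)` fits into the gap between `0.6` and `0.594`.
  have hθp : θ * (ε ^ 2 - ε' ^ 2) ≤ 0.3 * (ε ^ 2 - ε' ^ 2) :=
    mul_le_mul_of_nonneg_right hθ hp
  constructor
  · linarith [(abs_le.1 f1).1]
  · linarith [(abs_le.1 f2).2, (abs_le.1 r2).2]

lemma IsFixed.ratio_pos (h : IsFixed ε ω s d) : 0 < s := by
  have := (abs_le.1 h.region.near.2).1
  linarith

lemma IsFixed.freq_pos (h : IsFixed ε ω s d) : 0 < ω := by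
  have := (abs_le.1 h.region.near.1).1
  linarith [pi_gt_three]

/-- The parameter `α = ω/s` increases strictly with the amplitude. -/
lemma IsFixed.param_lt (h0 : 0 ≤ ε') (hεε : ε' < ε) (hε : ε ≤ 0.1)
    (h : IsFixed ε ω s d) (h' : IsFixed ε' ω' s' d') : ω' / s' < ω / s := by
  have hp : 0 < ε ^ 2 - ε' ^ 2 := by nlinarith
  -- Since `ε' (ε - ε') ≤ (ε² - ε'²) / 2`, the value `θ = 0.0535 + 0.24 / 2` is admissible.
  obtain ⟨a, b⟩ := h.freq_ratio_sub h0 hεε.le hε h' (θ := 0.1735) (by norm_num) (by nlinarith)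
  have S' := h'.sharp h0 (hεε.le.trans hε)
  have hω := (abs_le.1 S'.freq).1
  have hs := (abs_le.1 S'.ratio)
  have hpi := pi_gt_d2
  rw [div_lt_div_iff₀ h'.ratio_pos h.ratio_pos]
  have e1 : -(0.3739 * (ε ^ 2 - ε' ^ 2)) * s' ≤ (ω - ω') * s' :=
    mul_le_mul_of_nonneg_right (by linarith) h'.ratio_pos.le
  have e2 : ω' * (s - s') ≤ ω' * -(0.4205 * (ε ^ 2 - ε' ^ 2)) :=
    mul_le_mul_of_nonneg_left (by linarith) h'.freq_pos.le
  -- The decrease of `s`, multiplied by `ω' ≈ π/2`, outweighs that of `ω`.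
  have e3 : 0.3739 * s' < ω' * 0.4205 := by linarith
  nlinarith

lemma resid_zero (ω : ℝ) (d : Coeff) : resid 0 ω d = 0 := by simp [resid]

lemma IsFixed.zero (h : IsFixed 0 ω s d) : ω = π / 2 ∧ s = 1 ∧ d = 0 := by
  have e1 := h.freq
  have e2 := h.ratio
  have e3 := h.coeff
  rw [newRatio, h.freq, resid_zero] at e2
  rw [newFreq, resid_zero] at e1
  have e1' : ω = π / 2 := by rw [← e1]; simp
  refine ⟨e1', ?_, ?_⟩
  · rw [← e2, e1']; simp
  · rw [← e3, newCoeff]; simp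

/-- At amplitude `0.1` the parameter exceeds the required range. -/
lemma IsFixed.param_at_end (h : IsFixed 0.1 ω s d) : π / 2 + 5.53e-3 ≤ ω / s := by
  obtain ⟨ω', s', d', h'⟩ := exists_isFixed (ε := 0) le_rfl (by norm_num)
  obtain ⟨rfl, rfl, rfl⟩ := h'.zero
  -- Against amplitude 0 the mixed term vanishes, so the smaller `θ` suffices.
  obtain ⟨a, b⟩ := h.freq_ratio_sub le_rfl (by norm_num) le_rfl h' (θ := 0.0535) (by norm_num)
    (by norm_num)
  norm_num at a b
  rw [le_div_iff₀ h.ratio_pos]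
  have hpi := pi_gt_d2
  have hpi' := pi_lt_d2
  nlinarith

end Wright
end

/-! ### From coefficient sequences to functions -/

noncomputable section
namespace Wright
open Coeff

/-! ### Fourier series with summable coefficients -/

/-- The `k`-th Fourier mode. -/
def mode (k : ℤ) (θ : ℝ) : ℂ := Complex.exp (Complex.I * k * θ)

lemma norm_mode (k : ℤ) (θ : ℝ) : ‖mode k θ‖ = 1 := by
  rw [mode, show Complex.I * k * θ = ((k * θ : ℝ) : ℂ) * Complex.I by push_cast; ring,
    Complex.norm_exp_ofReal_mul_I]

lemma mode_add (k : ℤ) (θ φ : ℝ) : mode k (θ + φ) = mode k θ * mode k φ := by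
  rw [mode, mode, mode, ← Complex.exp_add]; congr 1; push_cast; ring

lemma mode_add_left (j k : ℤ) (θ : ℝ) : mode (j + k) θ = mode j θ * mode k θ := by
  rw [mode, mode, mode, ← Complex.exp_add]; congr 1; push_cast; ring

lemma mode_neg (k : ℤ) (θ : ℝ) : mode (-k) θ = (starRingEnd ℂ) (mode k θ) := by
  rw [mode, mode, ← Complex.exp_conj]; congr 1; simp

lemma mode_neg_right (k : ℤ) (ω : ℝ) : mode k (-ω) = delay ω k := by
  rw [mode, delay]; congr 1; push_cast; ring

lemma mode_two_pi (k : ℤ) : mode k (2 * π) = 1 := by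
  rw [mode, Complex.exp_eq_one_iff]
  exact ⟨k, by push_cast; ring⟩

lemma hasDerivAt_mode (k : ℤ) (ω t : ℝ) :
    HasDerivAt (fun t : ℝ => mode k (ω * t)) (Complex.I * ω * k * mode k (ω * t)) t := by
  have h : HasDerivAt (fun t : ℝ => Complex.I * k * ((ω * t : ℝ) : ℂ)) (Complex.I * k * ω) t := by
    have := ((hasDerivAt_id t).const_mul ω).ofReal_comp.const_mul (Complex.I * (k : ℂ))
    simpa using this
  have := h.cexp
  simp only [mode]
  convert this using 1
  ring

/-- The function with the given Fourier coefficients. -/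
def synth (f : Coeff) (θ : ℝ) : ℂ := ∑' k, f k * mode k θ

lemma norm_mul_mode (f : Coeff) (k : ℤ) (θ : ℝ) : ‖f k * mode k θ‖ = ‖f k‖ := by
  rw [norm_mul, norm_mode, mul_one]

lemma summable_synth (f : Coeff) (θ : ℝ) : Summable fun k => f k * mode k θ :=
  Summable.of_norm (by simpa only [norm_mul_mode] using summable_norm f)

lemma norm_synth_le (f : Coeff) (θ : ℝ) : ‖synth f θ‖ ≤ ‖f‖ := by
  rw [norm_def, synth]
  refine (norm_tsum_le_tsum_norm ?_).trans (le_of_eq ?_) <;> simp only [norm_mul_mode]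
  exact summable_norm f

lemma synth_add (f g : Coeff) (θ : ℝ) : synth (f + g) θ = synth f θ + synth g θ := by
  rw [synth, synth, synth, ← (summable_synth f θ).tsum_add (summable_synth g θ)]
  exact tsum_congr fun k => by rw [add_apply, add_mul]

lemma synth_smul (c : ℂ) (f : Coeff) (θ : ℝ) : synth (c • f) θ = c * synth f θ := by
  rw [synth, synth, ← tsum_mul_left]
  exact tsum_congr fun k => by rw [smul_apply, mul_assoc]

lemma synth_single (i : ℤ) (a : ℂ) (θ : ℝ) :
    synth (lp.single 1 i a) θ = a * mode i θ := by
  rw [synth, tsum_eq_single i]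
  · rw [single_apply', if_pos rfl]
  · intro k hk
    rw [single_apply', if_neg hk, zero_mul]

lemma synth_shift (ω : ℝ) (f : Coeff) (θ : ℝ) : synth (shift ω f) θ = synth f (θ - ω) := by
  refine tsum_congr fun k => ?_
  rw [shift_apply, sub_eq_add_neg, mode_add, mode_neg_right]; ring

lemma synth_periodic (f : Coeff) (θ : ℝ) : synth f (θ + 2 * π) = synth f θ := by
  refine tsum_congr fun k => ?_
  rw [mode_add, mode_two_pi, mul_one]

lemma conj_synth {f : Coeff} (hf : Herm f) (θ : ℝ) :
    (starRingEnd ℂ) (synth f θ) = synth f θ := by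
  rw [synth, Complex.conj_tsum, ← (Equiv.neg ℤ).tsum_eq]
  refine tsum_congr fun k => ?_
  rw [Equiv.neg_apply, map_mul, ← hf, ← mode_neg, neg_neg]

lemma ofReal_re_synth {f : Coeff} (hf : Herm f) (θ : ℝ) : ((synth f θ).re : ℂ) = synth f θ :=
  Complex.conj_eq_iff_re.1 (conj_synth hf θ)

lemma synth_conv (f g : Coeff) (θ : ℝ) : synth (conv f g) θ = synth f θ * synth g θ := by
  let F (x : ℤ × ℤ) : ℂ := f x.2 * g (x.1 - x.2) * mode x.1 θ
  have hF : Summable F := by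
    refine Summable.of_norm ((summable_conv_prod f g).congr fun x => ?_)
    simp only [F]
    rw [norm_mul _ (mode _ _), norm_mode, mul_one]
  have h1 : synth (conv f g) θ = ∑' k, ∑' j, F (k, j) := by
    refine tsum_congr fun k => ?_
    rw [conv_apply, ← tsum_mul_right]
  have h2 : ∑' k, ∑' j, F (k, j) = ∑' j, ∑' k, F (k, j) :=
    (Summable.tsum_comm (f := fun k j => F (k, j)) hF).symm
  rw [h1, h2, synth, synth, ← tsum_mul_right]
  refine tsum_congr fun j => ?_
  rw [← tsum_mul_left, ← (Equiv.addRight j).tsum_eq]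
  refine tsum_congr fun k => ?_
  simp only [F, Equiv.coe_addRight, add_sub_cancel_right, mode_add_left]
  ring

lemma hasDerivAt_synth {f g : Coeff} {ω : ℝ} (hg : ∀ k, g k = Complex.I * ω * k * f k) (t : ℝ) :
    HasDerivAt (fun t : ℝ => synth f (ω * t)) (synth g (ω * t)) t := by
  have h := hasDerivAt_tsum (u := fun k => ‖g k‖) (g := fun (k : ℤ) (t : ℝ) => f k * mode k (ω * t))
    (g' := fun (k : ℤ) (t : ℝ) => f k * (Complex.I * ω * k * mode k (ω * t))) (y₀ := 0)
    (summable_norm g) (fun k y => (hasDerivAt_mode k ω y).const_mul (f k))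
    (fun k y => by
      rw [← norm_mul_mode g k (ω * y), hg]
      apply le_of_eq; congr 1; ring)
    (summable_synth f _) t
  have e : synth g (ω * t) = ∑' k : ℤ, f k * (Complex.I * ω * k * mode k (ω * t)) :=
    tsum_congr fun k => by rw [hg]; ring
  rw [e]; exact h

lemma continuous_mode (k : ℤ) : Continuous (mode k) := by unfold mode; fun_prop

lemma integral_mode (k : ℤ) :
    ∫ θ in (0 : ℝ)..2 * π, mode k θ = if k = 0 then 2 * π else 0 := by
  split_ifs with hk
  · subst hk; simp [mode]
  · have hk' : Complex.I * k ≠ 0 := mul_ne_zero Complex.I_ne_zero (by exact_mod_cast hk)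
    have := mode_two_pi k
    rw [mode] at this
    simp only [mode]
    rw [integral_exp_mul_complex hk']
    push_cast at this ⊢
    rw [this]; simp

lemma integral_synth (f : Coeff) : ∫ θ in (0 : ℝ)..2 * π, synth f θ = 2 * π * f 0 := by
  have h := intervalIntegral.hasSum_intervalIntegral_of_summable_norm (a := 0) (b := 2 * π)
    (f := fun k : ℤ => (⟨fun θ => f k * mode k θ, (continuous_mode k).const_mul _⟩ : C(ℝ, ℂ)))
    (by
      refine Summable.of_nonneg_of_le (fun _ => norm_nonneg _) (fun k => ?_) (summable_norm f)
      refine (ContinuousMap.norm_le _ (norm_nonneg _)).2 fun x => ?_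
      exact (norm_mul_mode f k x).le)
  have h2 := h.tsum_eq
  simp only [ContinuousMap.coe_mk, intervalIntegral.integral_const_mul, integral_mode] at h2
  rw [show (fun θ => synth f θ) = fun θ => ∑' k, f k * mode k θ from rfl, ← h2,
    tsum_eq_single 0]
  · simp; ring
  · intro k hk; simp [hk]

lemma integral_synth_mul_mode (f : Coeff) (k : ℤ) :
    ∫ θ in (0 : ℝ)..2 * π, synth f θ * mode (-k) θ = 2 * π * f k := by
  have h := integral_synth (conv f (lp.single 1 (-k) 1))
  simp only [synth_conv, synth_single, one_mul] at h
  rw [h, conv_comm, conv_single_left]; simp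

lemma synth_injective {f g : Coeff} (h : ∀ θ, synth f θ = synth g θ) : f = g := by
  refine ext' fun k => ?_
  have h1 := integral_synth_mul_mode f k
  simp only [h] at h1
  rw [integral_synth_mul_mode] at h1
  have : (2 * π : ℂ) ≠ 0 := by
    have := pi_ne_zero
    exact mul_ne_zero two_ne_zero (by exact_mod_cast this)
  exact (mul_left_cancel₀ this h1).symm

end Wright
end

/-! ### Fixed points give periodic solutions -/

noncomputable section
namespace Wright
open Coeff

/-- A constant perturbation of Wright's equation has no periodic solution with mean zero. -/
lemma eq_zero_of_periodic_perturbation {α C T : ℝ} (hT : 0 < T) {y Φ : ℝ → ℝ}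
    (hy : ∀ t, HasDerivAt y (-α * y (t - 1) * (1 + y t) + C) t) (hpos : ∀ t, 0 < 1 + y t)
    (hyT : Function.Periodic y T) (hΦ : ∀ t, HasDerivAt Φ (y t) t)
    (hΦT : Function.Periodic Φ T) : C = 0 := by
  -- As `y' / (1 + y) = -α y(t-1) + C / (1 + y)`, the primitive cancels the delayed term and `F' = C
  -- / (1 + y)`. Since `F` is periodic, Rolle's theorem gives a zero of `F'`.
  let F (t : ℝ) : ℝ := log (1 + y t) + α * Φ (t - 1)
  have hF : ∀ t, HasDerivAt F (C / (1 + y t)) t := fun t => by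
    have h1 := ((hy t).const_add 1).log (hpos t).ne'
    have h2 : HasDerivAt (fun t => Φ (t - 1)) (y (t - 1)) t := by
      simpa using (hΦ (t - 1)).comp_sub_const t 1
    have h3 := h1.add (h2.const_mul α)
    refine h3.congr_deriv ?_
    have := (hpos t).ne'
    field_simp
    ring
  have hFT : F 0 = F T := by
    have h1 := hyT 0
    have h2 := hΦT (-1)
    simp only [F]
    rw [show T - 1 = -1 + T by ring, h2, ← zero_add T, h1]; simp
  obtain ⟨ξ, -, hξ⟩ := exists_hasDerivAt_eq_zero hT
    (fun t _ => (hF t).continuousAt.continuousWithinAt) hFT (fun t _ => hF t)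
  rcases div_eq_zero_iff.1 hξ with h | h
  · exact h
  · exact absurd h (hpos ξ).ne'

variable {ε ω s : ℝ} {d : Coeff}

/-- The Fourier coefficients of the solution belonging to a fixed point. -/
def solCoeff (ε : ℝ) (d : Coeff) : Coeff := (ε : ℂ) • (cosSeq + smooth d)

/-- The solution belonging to a fixed point. -/
def sol (ε ω : ℝ) (d : Coeff) (t : ℝ) : ℝ := (synth (solCoeff ε d) (ω * t)).re

lemma herm_solCoeff (hd : Herm d) : Herm (solCoeff ε d) :=
  (herm_cosSeq.add (herm_smooth hd)).smul ε

lemma cosSeq_add_smooth_one (d : Coeff) : (cosSeq + smooth d) 1 = 1 := by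
  rw [add_apply, cosSeq_apply, smooth_apply_of_lt d (by norm_num)]; norm_num

lemma cosSeq_add_smooth_zero (d : Coeff) : (cosSeq + smooth d) 0 = 0 := by
  rw [add_apply, cosSeq_apply, smooth_apply_of_lt d (by norm_num)]; norm_num

lemma cosSeq_add_smooth_of_two_le (d : Coeff) {k : ℤ} (hk : 2 ≤ k) :
    (cosSeq + smooth d) k = smooth d k := by
  rw [add_apply, cosSeq_apply, if_neg (by omega), if_neg (by omega)]; simp

lemma abs_mul_norm_cosSeq_add_le (d : Coeff) (k : ℤ) :
    |(k : ℝ)| * ‖(cosSeq + smooth d) k‖ ≤ ‖cosSeq k‖ + ‖d k‖ := by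
  rw [add_apply]
  have h1 := norm_add_le (cosSeq k) (smooth d k)
  have h2 := abs_mul_norm_smooth_apply_le d k
  have h3 : |(k : ℝ)| * ‖cosSeq k‖ ≤ ‖cosSeq k‖ := by
    rw [cosSeq_apply]
    split_ifs with a b b
    · omega
    · subst a; simp
    · subst b; simp
    · simp
  have := mul_le_mul_of_nonneg_left h1 (abs_nonneg (k : ℝ))
  linarith

/-- The coefficients of the derivative. -/
def derivCoeff (ε ω : ℝ) (d : Coeff) : Coeff :=
  ofSummable (fun k => Complex.I * ω * k * solCoeff ε d k) <| by
    refine Summable.of_nonneg_of_le (fun _ => norm_nonneg _) (fun k => ?_)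
      (((summable_norm cosSeq).add (summable_norm d)).mul_left (|ω| * |ε|))
    have := mul_le_mul_of_nonneg_left (abs_mul_norm_cosSeq_add_le d k)
      (by positivity : 0 ≤ |ω| * |ε|)
    rw [solCoeff, smul_apply]
    simp only [norm_mul, Complex.norm_I, Complex.norm_real, Real.norm_eq_abs, one_mul,
      Complex.norm_intCast]
    linarith

/-- The coefficients of a primitive. -/
def primCoeff (ε ω : ℝ) (d : Coeff) : Coeff :=
  -- At `k = 0` the inverse is 0 by convention, which is right because the solution has no mean.
  ofSummable (fun k => (Complex.I * ω * k)⁻¹ * solCoeff ε d k) <| by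
    refine Summable.of_nonneg_of_le (fun _ => norm_nonneg _) (fun k => ?_)
      ((summable_norm (solCoeff ε d)).mul_left (|ω|⁻¹))
    rw [norm_mul]
    refine mul_le_mul_of_nonneg_right ?_ (norm_nonneg _)
    rw [norm_inv, norm_mul, norm_mul, Complex.norm_I, Complex.norm_real, Real.norm_eq_abs,
      Complex.norm_intCast, one_mul, mul_inv]
    rcases eq_or_ne k 0 with rfl | hk
    · simp
    · refine mul_le_of_le_one_right (by positivity) (inv_le_one_of_one_le₀ ?_)
      exact_mod_cast Int.one_le_abs hk

/-- The symbol at `k = 1` is `cos ω + i (s - sin ω)`; `newFreq` and `newRatio` match its real and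
imaginary parts with the residual, which is small enough for `arccos` to invert `cos`. -/
lemma IsFixed.first_mode (h0 : 0 ≤ ε) (hε : ε ≤ 0.1) (h : IsFixed ε ω s d) :
    linSymb s ω 1 = -(ε : ℂ) * nonlin ω (smooth d) 1 := by
  have hr := h.region.norm_resid_le h0 hε
  have hre := abs_le.1 ((Complex.abs_re_le_norm _).trans hr)
  have e1 : arccos (resid ε ω d).re = ω := h.freq
  have e2 := h.ratio
  rw [newRatio, h.freq] at e2
  have e3 := cos_arccos (x := (resid ε ω d).re) (by linarith) (by linarith)
  rw [e1] at e3
  change _ = resid ε ω d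
  rw [← Complex.re_add_im (resid ε ω d), ← e3, show (resid ε ω d).im = s - sin ω by linarith,
    linSymb, delay, show -(Complex.I * ω * ((1 : ℤ) : ℂ)) = ((-ω : ℝ) : ℂ) * Complex.I by
      push_cast; ring, Complex.exp_mul_I, ← Complex.ofReal_cos, ← Complex.ofReal_sin, cos_neg,
      sin_neg]
  push_cast; ring

lemma IsFixed.mode_eq (h0 : 0 ≤ ε) (hε : ε ≤ 0.1) (h : IsFixed ε ω s d) {k : ℤ} (hk : k ≠ 0) :
    linSymb s ω k * (cosSeq + smooth d) k +
      ε * conv (shift ω (cosSeq + smooth d)) (cosSeq + smooth d) k = 0 := by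
  have hpos : ∀ k : ℤ, 0 < k → linSymb s ω k * (cosSeq + smooth d) k +
      ε * conv (shift ω (cosSeq + smooth d)) (cosSeq + smooth d) k = 0 := by
    intro k hk
    rw [conv_shift_eq_nonlin _ _ hk.ne']
    rcases (show k = 1 ∨ 2 ≤ k by omega) with rfl | hk2
    · rw [cosSeq_add_smooth_one, h.first_mode h0 hε]; ring
    · rw [cosSeq_add_smooth_of_two_le d hk2, h.mode (by rw [abs_of_pos hk]; omega)]; ring
  rcases lt_or_gt_of_ne hk with hk | hk
  · have hu : Herm (cosSeq + smooth d) := herm_cosSeq.add (herm_smooth h.region.herm)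
    have hc := (herm_shift (ω := ω) hu).conv hu
    have := congrArg (starRingEnd ℂ) (hpos (-k) (by omega))
    rw [map_add, map_mul, map_mul, ← linSymb_neg, ← hu, ← hc, neg_neg, Complex.conj_ofReal,
      map_zero] at this
    exact this
  · exact hpos k hk

lemma sol_periodic (hω : 0 < ω) : Function.Periodic (sol ε ω d) (2 * π / ω) := fun t => by
  have : ω * (t + 2 * π / ω) = ω * t + 2 * π := by field_simp
  simp only [sol, this, synth_periodic]

/-- The mode 0 is not part of the fixed point problem, so a constant `κ` is left over. It vanishes
by `eq_zero_of_periodic_perturbation`, as the series has a periodic primitive and modulus below 1.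
-/
lemma IsFixed.isPeriodicSolution (h0 : 0 < ε) (hε : ε ≤ 0.1) (h : IsFixed ε ω s d) :
    IsPeriodicSolution (ω / s) ω (sol ε ω d) := by
  set a := solCoeff ε d with ha
  set u := cosSeq + smooth d with hu
  have hherm : Herm a := herm_solCoeff h.region.herm
  have hω := h.freq_pos
  have hs := h.ratio_pos
  have hT : 0 < 2 * π / ω := div_pos two_pi_pos hω
  have hY : ∀ t, ((sol ε ω d t : ℝ) : ℂ) = synth a (ω * t) := fun t => ofReal_re_synth hherm _
  set b := derivCoeff ε ω d with hb
  set α := ω / s with hα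
  set κ := (α : ℂ) * conv (shift ω a) a 0 with hκ
  have hbal : b + (α : ℂ) • (shift ω a + conv (shift ω a) a) = lp.single 1 0 κ := by
    refine ext' fun k => ?_
    rw [add_apply, smul_apply, add_apply, single_apply', shift_apply, hb, derivCoeff,
      ofSummable_apply, ← ha]
    have hak : a k = ε * u k := rfl
    split_ifs with hk
    · subst hk
      rw [hak, cosSeq_add_smooth_zero]; simp [hκ]
    · have e := h.mode_eq h0.le hε hk
      rw [← hu] at e
      have e2 : conv (shift ω a) a k = ε * (ε * conv (shift ω u) u k) := by
        rw [ha, solCoeff, shift_smul, conv_smul_left, conv_smul_right, smul_apply, smul_apply]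
      have e3 : (ω : ℂ) = α * s := by
        rw [hα]; push_cast
        have : (s : ℂ) ≠ 0 := by exact_mod_cast hs.ne'
        field_simp
      rw [e2, hak, e3]
      rw [linSymb] at e
      rw [← e3]
      rw [show Complex.I * (ω : ℂ) * k * (ε * u k) = Complex.I * (α * s) * k * (ε * u k) by rw [e3]]
      linear_combination (α * ε : ℂ) * e
  have hderiv : ∀ t, HasDerivAt (sol ε ω d)
      (-α * sol ε ω d (t - 1) * (1 + sol ε ω d t) + κ.re) t := by
    intro t
    have h1 := hasDerivAt_synth (f := a) (g := b) (ω := ω) (fun k => rfl) t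
    have h2 : HasDerivAt (sol ε ω d) (synth b (ω * t)).re t := by
      have h3 : HasDerivAt (fun t => (synth a (ω * t)).re) (synth b (ω * t)).re t := by
        simpa [Function.comp_def] using Complex.reCLM.hasFDerivAt.comp_hasDerivAt t h1
      exact h3
    have e : synth b (ω * t) + α * (synth a (ω * (t - 1)) +
        synth a (ω * (t - 1)) * synth a (ω * t)) = κ := by
      have := congrArg (fun f => synth f (ω * t)) hbal
      simp only [synth_add, synth_smul, synth_conv, synth_shift, synth_single] at this
      rw [show ω * (t - 1) = ω * t - ω by ring, this]
      simp [Wright.mode]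
    rw [← hY, ← hY] at e
    refine h2.congr_deriv ?_
    have := congrArg Complex.re e
    rw [← Complex.ofReal_mul, ← Complex.ofReal_add, ← Complex.ofReal_mul, Complex.add_re,
      Complex.ofReal_re] at this
    linarith
  have hsmall : ∀ t, |sol ε ω d t| ≤ 0.231 := by
    intro t
    refine (Complex.abs_re_le_norm _).trans ((norm_synth_le _ _).trans ?_)
    rw [solCoeff, norm_smul, Complex.norm_real, Real.norm_eq_abs, abs_of_pos h0]
    have h1 := (norm_add_le cosSeq (smooth d)).trans
      (add_le_add norm_cosSeq_le h.region.norm_smooth_le)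
    calc ε * ‖cosSeq + smooth d‖ ≤ 0.1 * (2 + 0.31) := by gcongr
      _ = 0.231 := by norm_num
  have hprim : ∀ t, HasDerivAt (fun t => (synth (primCoeff ε ω d) (ω * t)).re)
      (sol ε ω d t) t := by
    intro t
    have h1 := hasDerivAt_synth (f := primCoeff ε ω d) (g := a) (ω := ω) (fun k => by
      rw [primCoeff, ofSummable_apply, ← ha]
      rcases eq_or_ne k 0 with rfl | hk
      · change (ε : ℂ) * u 0 = _
        rw [cosSeq_add_smooth_zero]; simp
      · have h1 : (ω : ℂ) ≠ 0 := by exact_mod_cast hω.ne'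
        have h2 : (k : ℂ) ≠ 0 := by exact_mod_cast hk
        have h3 := Complex.I_ne_zero
        field_simp) t
    have := Complex.reCLM.hasFDerivAt.comp_hasDerivAt t h1
    simpa [Function.comp_def, sol] using this
  have hκ0 : κ.re = 0 := by
    refine eq_zero_of_periodic_perturbation hT hderiv (fun t => ?_) (sol_periodic hω) hprim ?_
    · linarith [(abs_le.1 (hsmall t)).1]
    · intro t
      have : ω * (t + 2 * π / ω) = ω * t + 2 * π := by field_simp
      simp only [this, synth_periodic]
  refine ⟨fun t => by simpa [hκ0] using hderiv t, hω, sol_periodic hω, ?_⟩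
  rintro ⟨x, hx⟩
  have : a = lp.single 1 0 (x : ℂ) := synth_injective fun θ => by
    have := hY (θ / ω)
    rw [hx, mul_div_cancel₀ _ hω.ne'] at this
    rw [← this, synth_single]; simp [Wright.mode]
  have h1 : a 1 = 0 := by rw [this, single_apply', if_neg one_ne_zero]
  have h2 : a 1 = ε * u 1 := rfl
  rw [h2, cosSeq_add_smooth_one, mul_one] at h1
  exact h0.ne' (Complex.ofReal_eq_zero.1 h1)

/-- The one-sided sequence of Fourier coefficients of index `k ≥ 2`. -/
def oneSided (d : Coeff) : lp (fun _ : ℕ => ℂ) 1 :=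
  ⟨fun k => smooth d k, memℓp_gen (by
    simpa [Function.comp_def] using
      (summable_norm (smooth d)).comp_injective (Nat.cast_injective (R := ℤ)))⟩

lemma oneSided_apply (d : Coeff) (k : ℕ) : oneSided d k = smooth d k := rfl

lemma norm_oneSided_sub_le (d d' : Coeff) : ‖oneSided d - oneSided d'‖ ≤ ‖d - d'‖ := by
  have h := lp.hasSum_norm (p := 1) (by simp) (oneSided d - oneSided d')
  simp only [ENNReal.toReal_one, Real.rpow_one] at h
  rw [← h.tsum_eq]
  have e : ∀ k : ℕ, ‖(oneSided d - oneSided d') k‖ = ‖smooth (d - d') k‖ := fun k => by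
    rw [smooth_sub]; rfl
  simp only [e]
  have h1 : ∑' k : ℕ, ‖smooth (d - d') k‖ ≤ ∑' k : ℤ, ‖smooth (d - d') k‖ :=
    tsum_comp_le_tsum_of_inj (summable_norm (smooth (d - d'))) (fun _ => norm_nonneg _)
      (Nat.cast_injective (R := ℤ))
  have h2 := norm_smooth_le (d - d')
  rw [norm_def] at h2
  have h3 := norm_nonneg (d - d')
  linarith

lemma sol_eq_fourierProfile (hd : Herm d) :
    sol ε ω d = fourierProfile ε ω (oneSided d) := by
  funext t
  have hc := herm_smooth hd
  have hs := (summable_synth (smooth d) (ω * t)).hasSum.nat_add_neg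
  rw [smooth_apply_of_lt d (k := 0) (by norm_num), zero_mul, add_zero] at hs
  have e : ∀ n : ℕ, smooth d n * mode n (ω * t) + smooth d (-n) * mode (-n) (ω * t) =
      ((2 * (oneSided d n * Complex.exp (Complex.I * ω * n * t)).re : ℝ) : ℂ) := by
    intro n
    rw [hc, mode_neg, ← map_mul, Complex.add_conj, oneSided_apply]
    congr 3
    rw [mode]; push_cast; ring_nf
  simp only [e] at hs
  have hs' := (Complex.hasSum_re hs).tsum_eq
  simp only [Complex.ofReal_re] at hs'
  rw [sol, solCoeff, synth_smul, synth_add, Complex.re_ofReal_mul, Complex.add_re, fourierProfile,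
    hs', mul_add]
  congr 2
  rw [cosSeq, synth_add, synth_single, synth_single, one_mul, one_mul, mode_neg, Complex.add_conj,
    Complex.ofReal_re, mode, show Complex.I * ((1 : ℤ) : ℂ) * ((ω * t : ℝ) : ℂ) =
      ((ω * t : ℝ) : ℂ) * Complex.I by push_cast; ring, Complex.exp_ofReal_mul_I_re]

end Wright
end

/-! ### Periodic solutions have small Fourier coefficients in ℓ¹ -/

noncomputable section
namespace Wright
open Coeff

/-! ### Fourier coefficients of periodic functions -/

/-- The `n`-th Fourier coefficient of a `2π`-periodic function. -/
def fcoeff (F : ℝ → ℂ) (n : ℤ) : ℂ := (2 * π : ℂ)⁻¹ * ∫ θ in (0 : ℝ)..2 * π, F θ * mode (-n) θ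

lemma two_pi_ne_zero' : (2 * π : ℂ) ≠ 0 :=
  mul_ne_zero two_ne_zero (Complex.ofReal_ne_zero.2 pi_ne_zero)

lemma fcoeff_synth (f : Coeff) (n : ℤ) : fcoeff (synth f) n = f n := by
  rw [fcoeff, integral_synth_mul_mode, inv_mul_cancel_left₀ two_pi_ne_zero']

lemma fourierCoeffOn_eq_fcoeff (F : ℝ → ℂ) (n : ℤ) :
    fourierCoeffOn two_pi_pos F n = fcoeff F n := by
  rw [fourierCoeffOn_eq_integral, fcoeff, Complex.real_smul]
  congr 1
  · push_cast; simp
  · refine intervalIntegral.integral_congr fun x _ => ?_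
    simp only [fourier_coe_apply, smul_eq_mul]
    rw [mul_comm, mode]
    congr 2
    push_cast
    have := two_pi_ne_zero'
    have h2 : (π : ℂ) ≠ 0 := Complex.ofReal_ne_zero.2 pi_ne_zero
    rw [sub_zero]
    field_simp

lemma fcoeff_deriv {F G : ℝ → ℂ} (hF : ∀ θ, HasDerivAt F (G θ) θ) (hG : Continuous G)
    (hper : Function.Periodic F (2 * π)) (n : ℤ) : fcoeff G n = Complex.I * n * fcoeff F n := by
  have hm : ∀ θ : ℝ, HasDerivAt (mode (-n)) (-(Complex.I * n) * mode (-n) θ) θ := fun θ => by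
    have := hasDerivAt_mode (-n) 1 θ
    simp only [one_mul] at this
    refine this.congr_deriv ?_
    push_cast; ring
  have h := intervalIntegral.integral_deriv_mul_eq_sub (a := 0) (b := 2 * π)
    (fun x _ => hF x) (fun x _ => hm x) (hG.intervalIntegrable _ _)
    ((((continuous_mode (-n)).const_mul (-(Complex.I * n)))).intervalIntegrable _ _)
  have hc : Continuous F := continuous_iff_continuousAt.2 fun θ => (hF θ).continuousAt
  have e0 : F (2 * π) * mode (-n) (2 * π) - F 0 * mode (-n) 0 = 0 := by
    have := hper 0
    rw [zero_add] at this
    rw [this, mode_two_pi]; simp [mode]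
  rw [e0, intervalIntegral.integral_add (f := fun θ => G θ * mode (-n) θ)
    (g := fun θ => F θ * (-(Complex.I * n) * mode (-n) θ))
    ((hG.mul (continuous_mode _)).intervalIntegrable _ _)
    ((hc.mul ((continuous_mode (-n)).const_mul _)).intervalIntegrable _ _)] at h
  have e1 : ∫ θ in (0 : ℝ)..2 * π, F θ * (-(Complex.I * n) * mode (-n) θ) =
      -(Complex.I * n) * ∫ θ in (0 : ℝ)..2 * π, F θ * mode (-n) θ := by
    rw [← intervalIntegral.integral_const_mul]
    congr 1; ext θ; ring
  rw [e1] at h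
  rw [fcoeff, fcoeff]
  linear_combination (2 * π : ℂ)⁻¹ * h

lemma memLp_two_Icc {E : Type*} [NormedAddCommGroup E] [SecondCountableTopologyEither ℝ E]
    {g : ℝ → E} (hg : Continuous g) (a b : ℝ) :
    MemLp g 2 (volume.restrict (Icc a b)) := by
  obtain ⟨C, hC⟩ := isCompact_Icc.exists_bound_of_continuousOn (hg.continuousOn (s := Icc a b))
  exact MemLp.of_bound hg.aestronglyMeasurable C
    ((ae_restrict_iff' measurableSet_Icc).2 (Filter.Eventually.of_forall hC))

lemma hasSum_sq_fcoeff {G : ℝ → ℂ} (hG : Continuous G) :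
    HasSum (fun n => ‖fcoeff G n‖ ^ 2) ((2 * π)⁻¹ * ∫ θ in (0 : ℝ)..2 * π, ‖G θ‖ ^ 2) := by
  have hL : MemLp G 2 (volume.restrict (Ioc 0 (2 * π))) :=
    (memLp_two_Icc hG 0 (2 * π)).mono_measure
      (Measure.restrict_mono Ioc_subset_Icc_self le_rfl)
  have := hasSum_sq_fourierCoeffOn two_pi_pos hL
  simpa only [fourierCoeffOn_eq_fcoeff, sub_zero, smul_eq_mul] using this

lemma hasSum_int_inv_sq : HasSum (fun n : ℤ => 1 / (n : ℝ) ^ 2) (π ^ 2 / 3) := by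
  have h : HasSum (fun n : ℕ => 1 / ((n : ℤ) : ℝ) ^ 2) (π ^ 2 / 6) := by
    simpa only [Int.cast_natCast] using hasSum_zeta_two
  have h' : HasSum (fun n : ℕ => 1 / ((-(n : ℤ) : ℤ) : ℝ) ^ 2) (π ^ 2 / 6) := by
    simpa only [Int.cast_neg, Int.cast_natCast, neg_sq] using hasSum_zeta_two
  have h2 := HasSum.of_nat_of_neg (f := fun n : ℤ => 1 / (n : ℝ) ^ 2) h h'
  -- The term at `n = 0`, counted twice, is `1 / 0 = 0`.
  have e : π ^ 2 / 6 + π ^ 2 / 6 - 1 / ((0 : ℤ) : ℝ) ^ 2 = π ^ 2 / 3 := by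
    rw [Int.cast_zero, zero_pow two_ne_zero, div_zero]; ring
  rw [← e]
  exact h2

/-- A sequence with mean zero whose derivative has small `ℓ²` norm has small `ℓ¹` norm. -/
lemma summable_of_sq {a : ℤ → ℂ} {P lam : ℝ} (hlam : 0 < lam) (h0 : a 0 = 0)
    (hP : HasSum (fun n : ℤ => ‖Complex.I * n * a n‖ ^ 2) P) :
    (Summable fun n => ‖a n‖) ∧ ∑' n, ‖a n‖ ≤ (lam * (π ^ 2 / 3) + P / lam) / 2 := by
  have hs := ((hasSum_int_inv_sq.mul_left lam).add (hP.mul_right lam⁻¹)).div_const 2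
  have hle : ∀ n, ‖a n‖ ≤ (lam * (1 / (n : ℝ) ^ 2) +
      ‖Complex.I * n * a n‖ ^ 2 * lam⁻¹) / 2 := by
    intro n
    rcases eq_or_ne n 0 with rfl | hn
    · simp [h0]
    · have hn' : 0 < |(n : ℝ)| := abs_pos.2 (by exact_mod_cast hn)
      rw [norm_mul, norm_mul, Complex.norm_I, one_mul, Complex.norm_intCast, ← sq_abs (n : ℝ)]
      -- Weighted AM-GM: `2 |a_n| ≤ lam / n² + n² |a_n|² / lam`, to be summed over `n`.
      have key : 0 ≤ (lam * (1 / |(n : ℝ)|) - |(n : ℝ)| * ‖a n‖) ^ 2 * lam⁻¹ := by positivity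
      have e : (lam * (1 / |(n : ℝ)|) - |(n : ℝ)| * ‖a n‖) ^ 2 * lam⁻¹ =
          lam * (1 / |(n : ℝ)| ^ 2) + (|(n : ℝ)| * ‖a n‖) ^ 2 * lam⁻¹ - 2 * ‖a n‖ := by
        field_simp
        ring
      linarith
  have hsum := Summable.of_nonneg_of_le (fun n => norm_nonneg (a n)) hle hs.summable
  refine ⟨hsum, ?_⟩
  have := hasSum_le hle hsum.hasSum hs
  simpa [div_eq_mul_inv] using this

lemma synth_fcoeff {F : ℝ → ℂ} (hF : Continuous F) (hper : Function.Periodic F (2 * π))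
    (hs : Summable fun n => ‖fcoeff F n‖) (θ : ℝ) :
    synth (ofSummable (fcoeff F) hs) θ = F θ := by
  have : Fact (0 < 2 * π) := ⟨two_pi_pos⟩
  let f : C(AddCircle (2 * π), ℂ) := ⟨hper.lift, continuous_coinduced_dom.2 hF⟩
  have hf : ∀ x : ℝ, f x = F x := fun x => hper.lift_coe x
  have hmode : ∀ (n : ℤ) (x : ℝ), fourier n (x : AddCircle (2 * π)) = mode n x := fun n x => by
    rw [fourier_coe_apply, mode]
    congr 1
    push_cast
    have h2 : (π : ℂ) ≠ 0 := Complex.ofReal_ne_zero.2 pi_ne_zero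
    field_simp
  have hc : ∀ n, fourierCoeff f n = fcoeff F n := fun n => by
    rw [fourierCoeff_eq_intervalIntegral _ _ 0, fcoeff, zero_add, Complex.real_smul]
    congr 1
    · push_cast; simp
    · refine intervalIntegral.integral_congr fun x _ => ?_
      simp only [hmode, hf, smul_eq_mul]
      ring
  have hsum : Summable (fourierCoeff f) := by
    rw [show fourierCoeff f = fcoeff F from funext hc]; exact hs.of_norm
  have := (has_pointwise_sum_fourier_series_of_summable hsum (θ : AddCircle (2 * π))).tsum_eq
  rw [hf] at this
  rw [← this]
  refine tsum_congr fun n => ?_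
  rw [hc, hmode, ofSummable_apply, smul_eq_mul]

lemma fcoeff_herm (y : ℝ → ℝ) (n : ℤ) :
    fcoeff (fun θ => (y θ : ℂ)) (-n) = (starRingEnd ℂ) (fcoeff (fun θ => (y θ : ℂ)) n) := by
  rw [fcoeff, fcoeff, map_mul, intervalIntegral.integral_of_le two_pi_pos.le,
    intervalIntegral.integral_of_le two_pi_pos.le, ← integral_conj]
  congr 1
  · rw [map_inv₀, map_mul, map_ofNat, Complex.conj_ofReal]
  · refine integral_congr_ae (Filter.Eventually.of_forall fun x => ?_)
    simp only [map_mul, Complex.conj_ofReal, ← mode_neg]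

/-! ### Solutions of Wright's equation -/

variable {α ω : ℝ} {y : ℝ → ℝ}

lemma _root_.IsPeriodicSolution.continuous (h : IsPeriodicSolution α ω y) : Continuous y :=
  continuous_iff_continuousAt.2 fun t => (h.solves t).continuousAt

/-- Periodic solutions have mean zero. -/
lemma _root_.IsPeriodicSolution.integral_eq_zero (h : IsPeriodicSolution α ω y) (hα : α ≠ 0) :
    ∫ t in (0 : ℝ)..2 * π / ω, y t = 0 := by
  set T := 2 * π / ω with hT
  let P (t : ℝ) : ℝ := ∫ x in (0 : ℝ)..t, y x
  have hP : ∀ t, HasDerivAt P (y t) t := fun t =>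
    intervalIntegral.integral_hasDerivAt_right (h.continuous.intervalIntegrable _ _)
      (h.continuous.stronglyMeasurableAtFilter _ _) h.continuous.continuousAt
  -- A first integral, because `P' = y`. Once `1 + y 0 ≠ 0`, periodicity of `y` forces `P (T - 1) =
  -- P (-1)`.
  let F (t : ℝ) : ℝ := (1 + y t) * exp (α * P (t - 1))
  have hF : ∀ t, HasDerivAt F 0 t := fun t => by
    have h2 : HasDerivAt (fun t => P (t - 1)) (y (t - 1)) t := by
      simpa using (hP (t - 1)).comp_sub_const t 1
    refine (((h.solves t).const_add 1).mul (h2.const_mul α).exp).congr_deriv ?_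
    ring
  have hconst : ∀ t, F t = F 0 := fun t =>
    is_const_of_deriv_eq_zero (fun t => (hF t).differentiableAt) (fun t => (hF t).deriv) t 0
  have hy0 : 1 + y 0 ≠ 0 := by
    -- A zero of the first integral would make `y` constantly `-1`.
    intro h0
    refine h.nonconstant ⟨-1, fun t => ?_⟩
    have := hconst t
    simp only [F, h0, zero_mul, mul_eq_zero, (exp_pos _).ne', or_false] at this
    linarith
  have h1 := hconst T
  have hyT : y T = y 0 := by simpa using h.periodic 0
  simp only [F, hyT] at h1
  have h2 := exp_injective (mul_left_cancel₀ hy0 h1)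
  have h3 := mul_left_cancel₀ hα h2
  have h4 := h.periodic.intervalIntegral_add_eq (-1) 0
  rw [zero_add] at h4
  rw [← h4, show -1 + T = T - 1 by ring, ← intervalIntegral.integral_interval_sub_left
    (h.continuous.intervalIntegrable 0 _) (h.continuous.intervalIntegrable 0 _)]
  rw [zero_sub] at h3
  exact sub_eq_zero.2 h3

/-- The solution with time rescaled to period `2π`. -/
def rescale (ω : ℝ) (y : ℝ → ℝ) (θ : ℝ) : ℂ := (y (θ / ω) : ℝ)

/-- The derivative of the rescaled solution. -/
def rescaleDeriv (α ω : ℝ) (y : ℝ → ℝ) (θ : ℝ) : ℂ :=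
  -(α / ω : ℂ) * (rescale ω y (θ - ω) * (1 + rescale ω y θ))

lemma continuous_rescale (h : IsPeriodicSolution α ω y) : Continuous (rescale ω y) :=
  Complex.continuous_ofReal.comp (h.continuous.comp (continuous_id.div_const ω))

lemma continuous_rescaleDeriv (h : IsPeriodicSolution α ω y) : Continuous (rescaleDeriv α ω y) := by
  have := continuous_rescale h
  unfold rescaleDeriv
  fun_prop

lemma rescaleDeriv_eq (h : IsPeriodicSolution α ω y) (θ : ℝ) :
    rescaleDeriv α ω y θ = ((deriv y (θ / ω) / ω : ℝ) : ℂ) := by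
  have hω := h.freq_pos.ne'
  rw [(h.solves _).deriv, rescaleDeriv, rescale, rescale,
    show (θ - ω) / ω = θ / ω - 1 by field_simp]
  push_cast; ring

lemma hasDerivAt_rescale (h : IsPeriodicSolution α ω y) (θ : ℝ) :
    HasDerivAt (rescale ω y) (rescaleDeriv α ω y θ) θ := by
  have h1 : HasDerivAt (fun θ => y (θ / ω)) (deriv y (θ / ω) / ω) θ := by
    have h2 := (h.solves (θ / ω)).differentiableAt.hasDerivAt
    have h3 := (hasDerivAt_id θ).div_const ω
    have := h2.comp θ h3
    simpa [Function.comp_def, div_eq_mul_inv] using this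
  rw [rescaleDeriv_eq h]
  exact h1.ofReal_comp

lemma periodic_rescale (h : IsPeriodicSolution α ω y) :
    Function.Periodic (rescale ω y) (2 * π) := fun θ => by
  rw [rescale, rescale, add_div, h.periodic]

lemma fcoeff_rescale_zero (h : IsPeriodicSolution α ω y) (hα : α ≠ 0) :
    fcoeff (rescale ω y) 0 = 0 := by
  have hω := h.freq_pos.ne'
  have h1 : ∫ θ in (0 : ℝ)..2 * π, y (θ / ω) = 0 := by
    rw [intervalIntegral.integral_comp_div _ hω, zero_div, h.integral_eq_zero hα, smul_zero]
  have h2 : ∫ θ in (0 : ℝ)..2 * π, rescale ω y θ * mode (-0) θ = 0 := by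
    have : ∀ θ, rescale ω y θ * mode (-0) θ = ((y (θ / ω) : ℝ) : ℂ) := fun θ => by
      simp [rescale, mode]
    simp only [this]
    rw [intervalIntegral.integral_ofReal, h1, Complex.ofReal_zero]
  rw [fcoeff, h2, mul_zero]

lemma hasSum_sq_rescale (h : IsPeriodicSolution α ω y) :
    HasSum (fun n : ℤ => ‖Complex.I * n * fcoeff (rescale ω y) n‖ ^ 2)
      ((2 * π * ω)⁻¹ * ∫ t in (0 : ℝ)..2 * π / ω, ‖deriv y t‖ ^ 2) := by
  have hω := h.freq_pos.ne'
  have h1 := hasSum_sq_fcoeff (continuous_rescaleDeriv h)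
  simp only [fcoeff_deriv (hasDerivAt_rescale h) (continuous_rescaleDeriv h)
    (periodic_rescale h)] at h1
  convert h1 using 1
  have e : ∀ θ, ‖rescaleDeriv α ω y θ‖ ^ 2 = (fun t => ω⁻¹ ^ 2 * ‖deriv y t‖ ^ 2) (θ / ω) :=
    fun θ => by
      rw [rescaleDeriv_eq h, Complex.norm_real, norm_div, div_eq_mul_inv]
      simp only [mul_pow, norm_eq_abs, sq_abs, inv_pow]
      ring
  simp only [e]
  rw [intervalIntegral.integral_comp_div (fun t => ω⁻¹ ^ 2 * ‖deriv y t‖ ^ 2) hω, zero_div,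
    intervalIntegral.integral_const_mul, smul_eq_mul, mul_inv]
  field_simp

lemma integral_sq_deriv_le (h : IsPeriodicSolution α ω y) (hn : InNeighbourhood ω y) :
    ∫ t in (0 : ℝ)..2 * π / ω, ‖deriv y t‖ ^ 2 ≤ 0.302 ^ 2 := by
  have hT : 0 ≤ 2 * π / ω := (div_pos two_pi_pos h.freq_pos).le
  have hd : deriv y = fun t => -α * y (t - 1) * (1 + y t) := funext fun t => (h.solves t).deriv
  have hc : Continuous (deriv y) := by
    have := h.continuous
    rw [hd]; fun_prop
  have hm : MemLp (deriv y) 2 (volume.restrict (Icc 0 (2 * π / ω))) :=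
    memLp_two_Icc hc _ _
  have h1 := hn.2
  rw [hm.eLpNorm_eq_integral_rpow_norm two_ne_zero ENNReal.ofNat_ne_top,
    ENNReal.ofReal_le_ofReal_iff (by norm_num)] at h1
  simp only [ENNReal.toReal_ofNat, Real.rpow_ofNat] at h1
  rw [intervalIntegral.integral_of_le hT, ← integral_Icc_eq_integral_Ioc]
  have h0 : 0 ≤ ∫ t in Icc 0 (2 * π / ω), ‖deriv y t‖ ^ 2 := integral_nonneg fun _ => by positivity
  have h2 := pow_le_pow_left₀ (by positivity) h1 2
  rwa [← Real.rpow_natCast (_ ^ _) 2, ← Real.rpow_mul h0, show (2 : ℝ)⁻¹ * ((2 : ℕ) : ℝ) = 1 by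
    norm_num, Real.rpow_one] at h2

lemma summable_fcoeff (h : IsPeriodicSolution α ω y) (hα : α ≠ 0) :
    Summable fun n => ‖fcoeff (rescale ω y) n‖ :=
  (summable_of_sq one_pos (fcoeff_rescale_zero h hα) (hasSum_sq_rescale h)).1

lemma tsum_norm_fcoeff_le (h : IsPeriodicSolution α ω y) (hα : α ≠ 0)
    (hn : InNeighbourhood ω y) : ∑' n, ‖fcoeff (rescale ω y) n‖ ≤ 0.18 := by
  -- This is close to the minimizer `√(P / (π² / 3))` for `P = 0.00982`.
  refine (summable_of_sq (lam := 0.05463) (by norm_num) (fcoeff_rescale_zero h hα)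
    (hasSum_sq_rescale h)).2.trans ?_
  have h1 := integral_sq_deriv_le h hn
  have h2 := (abs_le.1 hn.1).1
  have p1 := pi_gt_d4
  have p2 := pi_lt_d4
  have h3 : 9.288 ≤ 2 * π * ω := by nlinarith
  have h4 : (2 * π * ω)⁻¹ * ∫ t in (0 : ℝ)..2 * π / ω, ‖deriv y t‖ ^ 2 ≤ 0.00982 := by
    rw [inv_mul_le_iff₀ (by linarith)]
    norm_num at h1 ⊢
    linarith
  have h5 : π ^ 2 / 3 ≤ 3.29 := by nlinarith
  have h6 : ((2 * π * ω)⁻¹ * ∫ t in (0 : ℝ)..2 * π / ω, ‖deriv y t‖ ^ 2) / 0.05463 ≤ 0.17976 := by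
    rw [div_le_iff₀ (by norm_num)]; linarith
  linarith

/-- The Fourier coefficients of a periodic solution. -/
structure IsCoeff (α ω : ℝ) (a : Coeff) : Prop where
  herm : Herm a
  zero : a 0 = 0
  eqn : ∀ k : ℤ, k ≠ 0 → Complex.I * ω * k * a k +
    α * (delay ω k * a k + conv (shift ω a) a k) = 0

lemma exists_isCoeff (h : IsPeriodicSolution α ω y) (hα : α ≠ 0) (hn : InNeighbourhood ω y) :
    ∃ a : Coeff, IsCoeff α ω a ∧ ‖a‖ ≤ 0.18 ∧ ∀ t, (y t : ℂ) = synth a (ω * t) := by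
  have hω := h.freq_pos.ne'
  set a := ofSummable _ (summable_fcoeff h hα) with ha
  have hsy : ∀ θ, synth a θ = rescale ω y θ :=
    synth_fcoeff (continuous_rescale h) (periodic_rescale h) _
  refine ⟨a, ⟨fun k => fcoeff_herm _ k, fcoeff_rescale_zero h hα, fun k _ => ?_⟩, ?_, fun t => ?_⟩
  · have h1 := fcoeff_deriv (hasDerivAt_rescale h) (continuous_rescaleDeriv h)
      (periodic_rescale h) k
    have h2 : rescaleDeriv α ω y =
        synth (-(α / ω : ℂ) • (shift ω a + conv (shift ω a) a)) := by
      funext θ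
      rw [synth_smul, synth_add, synth_conv, synth_shift, hsy, hsy, rescaleDeriv]; ring
    rw [h2, fcoeff_synth, smul_apply, add_apply, shift_apply] at h1
    have h3 : fcoeff (rescale ω y) k = a k := rfl
    have hω' : (ω : ℂ) ≠ 0 := Complex.ofReal_ne_zero.2 hω
    rw [h3] at h1
    rw [show Complex.I * ω * k * a k = ω * (Complex.I * k * a k) by ring, ← h1]
    field_simp
    ring
  · rw [norm_def]; exact tsum_norm_fcoeff_le h hα hn
  · rw [hsy, rescale, mul_div_cancel_left₀ _ hω]

end Wright
end

/-! ### Solutions in the neighbourhood lie on the branch -/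

noncomputable section
namespace Wright
open Coeff

/-! ### Time translations -/

/-- The coefficients of a translate. -/
def translate (φ : ℝ) (a : Coeff) : Coeff := mul (fun k => mode k φ) a

lemma translate_apply (φ : ℝ) (a : Coeff) (k : ℤ) : translate φ a k = mode k φ * a k :=
  mul_apply (C := 1) (fun k => (norm_mode k φ).le) a k

lemma herm_translate (φ : ℝ) {a : Coeff} (ha : Herm a) : Herm (translate φ a) :=
  ha.mul (C := 1) (fun k => (norm_mode k φ).le) fun k => mode_neg k φ

lemma norm_translate_le (φ : ℝ) (a : Coeff) : ‖translate φ a‖ ≤ ‖a‖ := by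
  exact (norm_mul_le (C := 1) (fun k => (norm_mode k φ).le) a).trans_eq (one_mul _)

lemma shift_translate (ω φ : ℝ) (a : Coeff) :
    shift ω (translate φ a) = translate φ (shift ω a) := ext' fun k => by
  simp only [shift_apply, translate_apply]; ring

lemma conv_translate (φ : ℝ) (a b : Coeff) :
    conv (translate φ a) (translate φ b) = translate φ (conv a b) := ext' fun k => by
  rw [translate_apply, conv_apply, conv_apply, ← tsum_mul_left]
  refine tsum_congr fun j => ?_
  have : mode k φ = mode j φ * mode (k - j) φ := by rw [← mode_add_left]; congr 1; ring
  rw [translate_apply, translate_apply, this]; ring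

lemma synth_translate (φ : ℝ) (a : Coeff) (θ : ℝ) :
    synth (translate φ a) θ = synth a (θ + φ) :=
  tsum_congr fun k => by rw [translate_apply, mode_add]; ring

variable {α ε ω s : ℝ} {a d : Coeff}

lemma IsCoeff.translate (h : IsCoeff α ω a) (φ : ℝ) : IsCoeff α ω (translate φ a) where
  herm := herm_translate φ h.herm
  zero := by rw [translate_apply, h.zero, mul_zero]
  eqn k hk := by
    rw [shift_translate, conv_translate, translate_apply, translate_apply]
    linear_combination mode k φ * h.eqn k hk

lemma exists_translate_real (a : Coeff) : ∃ φ, translate φ a 1 = (‖a 1‖ : ℂ) := by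
  refine ⟨-Complex.arg (a 1), ?_⟩
  rw [translate_apply, mode]
  nth_rw 2 [← Complex.norm_mul_exp_arg_mul_I (a 1)]
  rw [mul_left_comm, ← Complex.exp_add]
  push_cast
  ring_nf
  simp

/-! ### Every solution in the neighbourhood comes from a fixed point -/

lemma IsCoeff.linSymb_mul (h : IsCoeff α ω a) (hα : α ≠ 0) {k : ℤ} (hk : k ≠ 0) :
    linSymb (ω / α) ω k * a k = -conv (shift ω a) a k := by
  have e := h.eqn k hk
  have hα' : (α : ℂ) ≠ 0 := Complex.ofReal_ne_zero.2 hα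
  rw [linSymb]
  push_cast
  field_simp
  linear_combination e

lemma IsCoeff.norm_weighted_le (h : IsCoeff α ω a) (hα : α ≠ 0) (hn : NearHopf (ω / α) ω)
    (k : ℤ) : ‖(if |k| < 2 then 0 else ((|(k : ℝ)| : ℝ) : ℂ) * a k : ℂ)‖ ≤
      16 / 11 * ‖conv (shift ω a) a k‖ := by
  split_ifs with hk
  · rw [norm_zero]; positivity
  · have h1 := hn.abs_le_norm hk
    have h2 := congrArg norm (h.linSymb_mul hα (k := k) (by rintro rfl; simp at hk))
    rw [norm_neg, norm_mul] at h2
    rw [norm_mul, Complex.norm_real, norm_eq_abs, abs_abs, ← h2]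
    have := mul_le_mul_of_nonneg_right h1 (norm_nonneg (a k))
    linarith

/-- The sequence `|k| a k`, `|k| ≥ 2`. -/
lemma IsCoeff.exists_weighted (h : IsCoeff α ω a) (hα : α ≠ 0) (hn : NearHopf (ω / α) ω) :
    ∃ b : Coeff, (∀ k, b k = if |k| < 2 then 0 else ((|(k : ℝ)| : ℝ) : ℂ) * a k) ∧ Herm b ∧
      ‖b‖ ≤ 16 / 11 * ‖a‖ ^ 2 := by
  have hle := h.norm_weighted_le hα hn
  refine ⟨ofSummable _ (Summable.of_nonneg_of_le (fun _ => norm_nonneg _) hle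
    ((summable_norm _).mul_left _)), fun k => rfl, fun k => ?_, ?_⟩
  · simp only [ofSummable_apply, Int.cast_neg, abs_neg, h.herm k]
    split_ifs
    · simp
    · rw [map_mul, Complex.conj_ofReal]
  · refine (norm_le_of_le (g := conv (shift ω a) a) hle).trans ?_
    have h1 := norm_conv_le (shift ω a) a
    have h2 := mul_le_mul_of_nonneg_right (norm_shift_le ω a) (norm_nonneg a)
    linarith

/-- From `‖b‖ ≤ (16/11) * 0.18 * ‖a‖` and `‖a‖ ≤ 2ε + ‖b‖ / 2` follows `‖b‖ ≤ 0.62 ε`, the radius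
used in `Region`. In particular `ε = 0` would force `a = 0`. Moreover `ε ≤ ‖a‖ / 2 ≤ 0.09`. -/
lemma IsCoeff.exists_eq_solCoeff (h : IsCoeff α ω a) (hα : α ≠ 0) (hn : NearHopf (ω / α) ω)
    (ha : ‖a‖ ≤ 0.18) (hr : a 1 = (ε : ℂ)) (h0 : 0 ≤ ε) (hne : a ≠ 0) :
    0 < ε ∧ ε ≤ 0.1 ∧ ∃ d, Herm d ∧ ‖d‖ ≤ 0.62 ∧ (∀ k : ℤ, |k| < 2 → d k = 0) ∧
      a = solCoeff ε d := by
  obtain ⟨b, hb, hbh, hbn⟩ := h.exists_weighted hα hn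
  have hr' : a (-1) = (ε : ℂ) := by rw [h.herm, hr, Complex.conj_ofReal]
  have e : a = (ε : ℂ) • cosSeq + smooth b := ext' fun k => by
    rw [Coeff.add_apply, Coeff.smul_apply, cosSeq_apply]
    by_cases hk : |k| < 2
    · rw [smooth_apply_of_lt b hk]
      obtain ⟨k1, k2⟩ := abs_lt.1 hk
      obtain rfl | rfl | rfl : k = -1 ∨ k = 0 ∨ k = 1 := by omega
      · rw [hr']; norm_num
      · rw [h.zero]; norm_num
      · rw [hr]; norm_num
    · have h1 : k ≠ 1 := by rintro rfl; norm_num at hk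
      have h2 : k ≠ -1 := by rintro rfl; norm_num at hk
      have h3 := abs_cast_ge hk
      have h4 : ((|(k : ℝ)| : ℝ) : ℂ) ≠ 0 := by
        have : |(k : ℝ)| ≠ 0 := by push_cast at h3; linarith
        exact_mod_cast this
      rw [smooth_apply, invAbs, hb, if_neg hk, if_neg hk, if_neg h1, if_neg h2]
      push_cast
      field_simp
      simp
  have hna : ‖a‖ ≤ 2 * ε + ‖b‖ / 2 := by
    have h1 := norm_add_le ((ε : ℂ) • cosSeq) (smooth b)
    rw [← e, norm_smul, Complex.norm_real, norm_eq_abs, abs_of_nonneg h0] at h1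
    have h2 := mul_le_mul_of_nonneg_left norm_cosSeq_le h0
    have h3 := norm_smooth_le b
    linarith
  have hbε : ‖b‖ ≤ 0.62 * ε := by
    have := mul_le_mul_of_nonneg_right ha (norm_nonneg a)
    norm_num at this ⊢
    nlinarith
  have hpos : 0 < ε := by
    refine h0.lt_of_ne fun h1 => hne ?_
    rw [← h1] at hna hbε
    have h2 : ‖b‖ = 0 := le_antisymm (by linarith) (norm_nonneg b)
    exact norm_eq_zero.1 (le_antisymm (by linarith) (norm_nonneg a))
  have hε : ε ≤ 0.1 := by
    have h1 := norm_apply_le_half h.herm h.zero 1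
    rw [hr, Complex.norm_real, norm_eq_abs, abs_of_nonneg h0] at h1
    norm_num at h1 ha ⊢
    linarith
  refine ⟨hpos, hε, ((ε⁻¹ : ℝ) : ℂ) • b, hbh.smul _, ?_, fun k hk => ?_, ?_⟩
  · rw [norm_smul, Complex.norm_real, norm_eq_abs, abs_of_pos (inv_pos.2 hpos),
      inv_mul_le_iff₀ hpos]
    linarith
  · rw [Coeff.smul_apply, hb, if_pos hk, mul_zero]
  · have hε' : (ε : ℂ) ≠ 0 := Complex.ofReal_ne_zero.2 hpos.ne'
    refine e.trans (ext' fun k => ?_)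
    rw [solCoeff, Coeff.add_apply, Coeff.smul_apply, Coeff.smul_apply, Coeff.add_apply, smooth_apply, smooth_apply,
      Coeff.smul_apply]
    push_cast
    field_simp

/-- Converse of `IsFixed.mode` and `IsFixed.first_mode`; the mode 1 recovers `ω` because `ω` lies in
`[0, π]`, where `arccos` inverts `cos`. -/
lemma IsCoeff.isFixed (h : IsCoeff α ω (solCoeff ε d)) (hα : α ≠ 0) (hn : NearHopf (ω / α) ω)
    (hε : 0 < ε) (hd : Herm d) (hd' : ‖d‖ ≤ 0.62) (hlow : ∀ k : ℤ, |k| < 2 → d k = 0) :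
    IsFixed ε ω (ω / α) d := by
  have hε' : (ε : ℂ) ≠ 0 := Complex.ofReal_ne_zero.2 hε.ne'
  have key : ∀ k : ℤ, k ≠ 0 → linSymb (ω / α) ω k * (cosSeq + smooth d) k =
      -(ε : ℂ) * nonlin ω (smooth d) k := by
    intro k hk
    have h1 := h.linSymb_mul hα hk
    rw [solCoeff, shift_smul, conv_smul_left, conv_smul_right, Coeff.smul_apply, Coeff.smul_apply, Coeff.smul_apply,
      conv_shift_eq_nonlin _ _ hk] at h1
    refine mul_left_cancel₀ hε' ?_
    linear_combination h1
  have hres : linSymb (ω / α) ω 1 = resid ε ω d := by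
    rw [resid, ← key 1 one_ne_zero, cosSeq_add_smooth_one, mul_one]
  have hL : linSymb (ω / α) ω 1 = ((cos ω : ℝ) : ℂ) + ((ω / α - sin ω : ℝ) : ℂ) * Complex.I := by
    rw [linSymb, delay, show -(Complex.I * ω * ((1 : ℤ) : ℂ)) = ((-ω : ℝ) : ℂ) * Complex.I by
      push_cast; ring, Complex.exp_mul_I, ← Complex.ofReal_cos, ← Complex.ofReal_sin, cos_neg,
      sin_neg]
    push_cast; ring
  have hre : (resid ε ω d).re = cos ω := by rw [← hres, hL]; simp [-Complex.ofReal_cos]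
  have him : (resid ε ω d).im = ω / α - sin ω := by
    rw [← hres, hL, Complex.add_im, Complex.ofReal_im, Complex.im_ofReal_mul, Complex.I_im]; ring
  have hω := abs_le.1 hn.1
  have hfreq : newFreq ε ω d = ω := by
    rw [newFreq, hre, arccos_cos] <;> linarith [pi_gt_three]
  refine ⟨⟨hn, hd', hd⟩, hfreq, ?_, ext' fun k => ?_⟩
  · rw [newRatio, hfreq, him]; ring
  · rw [newCoeff_apply hn, invSymb]
    by_cases hk : |k| < 2
    · rw [if_pos hk, hlow k hk]; ring
    · have h1 := hn.abs_le_norm hk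
      have h3 := abs_cast_ge hk
      push_cast at h3
      have h4 : linSymb (ω / α) ω k ≠ 0 := fun h0 => by
        rw [h0, norm_zero] at h1; linarith
      have h5 : ((|(k : ℝ)| : ℝ) : ℂ) ≠ 0 := by
        have : |(k : ℝ)| ≠ 0 := by linarith
        exact_mod_cast this
      have k1 : k ≠ 1 := by rintro rfl; norm_num at hk
      have k2 : k ≠ -1 := by rintro rfl; norm_num at hk
      have h6 := key k (by rintro rfl; simp at hk)
      rw [Coeff.add_apply, cosSeq_apply, if_neg k1, if_neg k2, add_zero, zero_add, smooth_apply, invAbs,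
        if_neg hk] at h6
      rw [if_neg hk, div_mul_eq_mul_div, mul_div_assoc', div_eq_iff h4, mul_left_comm, ← h6]
      push_cast
      field_simp

/-- The radius `0.0625` for `s` accommodates the extreme quotient `(π/2 - 0.0924) / (π/2 + 0.00553)
≈ 0.938`. -/
lemma nearHopf_of_mem (hα : α ∈ Ioc (π / 2) (π / 2 + 5.53e-3)) (hω : |ω - π / 2| ≤ 0.0924) :
    NearHopf (ω / α) ω := by
  have p1 := pi_gt_d4
  have p2 := pi_lt_d4
  obtain ⟨h1, h2⟩ := hα
  obtain ⟨h3, h4⟩ := abs_le.1 hω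
  have hα0 : 0 < α := by linarith
  norm_num at h2 h3 h4
  refine ⟨hω, abs_le.2 ⟨?_, ?_⟩⟩
  · rw [le_sub_iff_add_le, le_div_iff₀ hα0]; norm_num; linarith
  · rw [sub_le_iff_le_add, div_le_iff₀ hα0]; norm_num; linarith

/-- Every periodic solution in the neighbourhood is a translate of one given by a fixed point. -/
lemma exists_isFixed_of_isPeriodicSolution {y : ℝ → ℝ} (hα : α ∈ Ioc (π / 2) (π / 2 + 5.53e-3))
    (h : IsPeriodicSolution α ω y) (hn : InNeighbourhood ω y) :
    ∃ ε d, 0 < ε ∧ ε ≤ 0.1 ∧ IsFixed ε ω (ω / α) d ∧ ∃ τ, ∀ t, y t = sol ε ω d (t + τ) := by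
  have hα0 : α ≠ 0 := (pi_div_two_pos.trans hα.1).ne'
  have hH := nearHopf_of_mem hα hn.1
  obtain ⟨a, ha, han, hay⟩ := exists_isCoeff h hα0 hn
  obtain ⟨φ, hφ⟩ := exists_translate_real a
  have hω := h.freq_pos.ne'
  have hy : ∀ t, (y t : ℂ) = synth (translate φ a) (ω * (t + -(φ / ω))) := fun t => by
    rw [synth_translate, hay]
    congr 1
    field_simp
    ring
  have hne : translate φ a ≠ 0 := fun h0 => h.nonconstant ⟨0, fun t => by
    have := hy t
    rw [h0] at this
    simpa [synth] using this⟩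
  obtain ⟨h1, h2, d, hd, hdn, hlow, e⟩ := (ha.translate φ).exists_eq_solCoeff hα0 hH
    ((norm_translate_le φ a).trans han) hφ (norm_nonneg _) hne
  have hc := ha.translate φ
  rw [e] at hc
  refine ⟨_, d, h1, h2, hc.isFixed hα0 hH h1 hd hdn hlow, -(φ / ω), fun t => ?_⟩
  rw [sol, ← e, ← hy, Complex.ofReal_re]

/-! ### The branch -/

lemma exists_branch : ∃ (ω s : ℝ → ℝ) (d : ℝ → Coeff),
    ∀ ε ∈ Icc (0 : ℝ) 0.1, IsFixed ε (ω ε) (s ε) (d ε) := by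
  have h : ∀ ε : ℝ, ∃ (ω s : ℝ) (d : Coeff), ε ∈ Icc (0 : ℝ) 0.1 → IsFixed ε ω s d := fun ε => by
    by_cases hε : ε ∈ Icc (0 : ℝ) 0.1
    · obtain ⟨ω, s, d, h⟩ := exists_isFixed hε.1 hε.2
      exact ⟨ω, s, d, fun _ => h⟩
    · exact ⟨0, 0, 0, fun h => absurd h hε⟩
  choose ω s d h using h
  exact ⟨ω, s, d, h⟩

lemma continuousOn_of_norm_sub_le {E : Type*} [SeminormedAddCommGroup E] {f : ℝ → E} {S : Set ℝ}
    {C : ℝ} (h : ∀ x ∈ S, ∀ y ∈ S, ‖f x - f y‖ ≤ C * |x - y|) : ContinuousOn f S := by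
  have : LipschitzOnWith (Real.toNNReal C) f S := LipschitzOnWith.of_dist_le' fun x hx y hy => by
    rw [dist_eq_norm, Real.dist_eq]; exact h x hx y hy
  exact this.continuousOn

lemma isHopfBranch {ω s : ℝ → ℝ} {d : ℝ → Coeff}
    (h : ∀ ε ∈ Icc (0 : ℝ) 0.1, IsFixed ε (ω ε) (s ε) (d ε)) :
    IsHopfBranch 0.1 (fun ε => ω ε / s ε) ω fun ε => oneSided (d ε) := by
  have hsub := fun x (hx : x ∈ Icc (0 : ℝ) 0.1) y (hy : y ∈ Icc (0 : ℝ) 0.1) =>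
    (h x hx).sub_le hx.1 hx.2 hy.1 hy.2 (h y hy)
  have hω : ContinuousOn ω (Icc 0 0.1) :=
    continuousOn_of_norm_sub_le fun x hx y hy => (hsub x hx y hy).1
  have hs : ContinuousOn s (Icc 0 0.1) :=
    continuousOn_of_norm_sub_le fun x hx y hy => (hsub x hx y hy).2.1
  have hz := (h 0 ⟨le_rfl, by norm_num⟩).zero
  refine ⟨by norm_num, hω.div hs fun ε hε => (h ε hε).ratio_pos.ne', hω,
    continuousOn_of_norm_sub_le fun x hx y hy =>
      (norm_oneSided_sub_le _ _).trans (hsub x hx y hy).2.2,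
    by rw [hz.1, hz.2.1, div_one], hz.1, ?_, fun ε _ => ?_, fun ε _ => ?_, fun ε hε => ?_⟩
  · refine lp.ext (funext fun k => ?_)
    rw [oneSided_apply, hz.2.2, smooth_apply, zero_apply, mul_zero]
    rfl
  · rw [oneSided_apply, smooth_apply_of_lt _ (by norm_num)]
  · rw [oneSided_apply, smooth_apply_of_lt _ (by norm_num)]
  · have hf := h ε (Ioc_subset_Icc_self hε)
    rw [← sol_eq_fourierProfile hf.region.herm]
    exact hf.isPeriodicSolution hε.1 hε.2

end Wright
end

/-! ### Conclusion -/

open Wright in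
theorem theorem4p9 :
    (∀ α ∈ Ioc (π / 2) (π / 2 + 5.53e-3), ∀ (ω₁ ω₂ : ℝ) (y₁ y₂ : ℝ → ℝ),
      IsPeriodicSolution α ω₁ y₁ → InNeighbourhood ω₁ y₁ →
      IsPeriodicSolution α ω₂ y₂ → InNeighbourhood ω₂ y₂ →
      EqUpToTranslation y₁ y₂) ∧
    ∃ (ε₀ : ℝ) (αh ωh : ℝ → ℝ) (ch : ℝ → lp (fun _ : ℕ => ℂ) 1),
      IsHopfBranch ε₀ αh ωh ch ∧
      ∀ α ∈ Ioc (π / 2) (π / 2 + 5.53e-3),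
        (∃! ε : ℝ, ε ∈ Ioc 0 ε₀ ∧ αh ε = α) ∧
        ∀ (ω : ℝ) (y : ℝ → ℝ), IsPeriodicSolution α ω y → InNeighbourhood ω y →
          ∃ ε ∈ Ioc 0 ε₀, αh ε = α ∧ ωh ε = ω ∧
            EqUpToTranslation y (fourierProfile ε (ωh ε) (ch ε)) := by
  obtain ⟨ω, s, d, h⟩ := exists_branch
  have hB := isHopfBranch h
  have hinj : ∀ x ∈ Ioc (0 : ℝ) 0.1, ∀ y ∈ Ioc (0 : ℝ) 0.1, ω x / s x = ω y / s y → x = y := by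
    intro x hx y hy e
    have fx := h x (Ioc_subset_Icc_self hx)
    have fy := h y (Ioc_subset_Icc_self hy)
    rcases lt_trichotomy x y with hxy | hxy | hxy
    · exact absurd e (fy.param_lt hx.1.le hxy hy.2 fx).ne
    · exact hxy
    · exact absurd e (fx.param_lt hy.1.le hxy hx.2 fy).ne'
  have hmem : ∀ α ∈ Ioc (π / 2) (π / 2 + 5.53e-3), ∀ (ω' : ℝ) (y : ℝ → ℝ),
      IsPeriodicSolution α ω' y → InNeighbourhood ω' y →
      ∃ ε ∈ Ioc (0 : ℝ) 0.1, ω ε / s ε = α ∧ ω ε = ω' ∧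
        EqUpToTranslation y (fourierProfile ε (ω ε) (oneSided (d ε))) := by
    intro α hα ω' y hy hn
    obtain ⟨ε, d', h0, hε, hf, τ, hτ⟩ := exists_isFixed_of_isPeriodicSolution hα hy hn
    have hfix := h ε ⟨h0.le, hε⟩
    obtain ⟨e1, e2, e3⟩ := IsFixed.unique h0.le hε hfix hf
    have hω' := hy.freq_pos.ne'
    refine ⟨ε, ⟨h0, hε⟩, ?_, e1, τ, ?_⟩
    · rw [e1, e2, div_div_cancel₀ hω']
    · rw [← sol_eq_fourierProfile hfix.region.herm, e1, e3]
      exact hτ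
  refine ⟨fun α hα ω₁ ω₂ y₁ y₂ h₁ n₁ h₂ n₂ => ?_, 0.1, _, ω, _, hB, fun α hα => ⟨?_, hmem α hα⟩⟩
  · obtain ⟨ε₁, m₁, a₁, -, τ₁, e₁⟩ := hmem α hα ω₁ y₁ h₁ n₁
    obtain ⟨ε₂, m₂, a₂, -, τ₂, e₂⟩ := hmem α hα ω₂ y₂ h₂ n₂
    obtain rfl := hinj ε₁ m₁ ε₂ m₂ (a₁.trans a₂.symm)
    refine ⟨τ₁ - τ₂, fun t => ?_⟩
    rw [e₁, e₂]
    congr 1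
    ring
  -- The parameter runs continuously from `π/2` at `ε = 0` past the right end at `ε = 0.1`, so it
  -- takes the value `α`; injectivity gives uniqueness.
  · have hend : π / 2 + 5.53e-3 ≤ ω 0.1 / s 0.1 := (h 0.1 ⟨by norm_num, le_rfl⟩).param_at_end
    have hzero : ω 0 / s 0 = π / 2 := hB.α_zero
    obtain ⟨ε, hε, e⟩ := intermediate_value_Ioc (by norm_num) hB.continuous_α
      (show α ∈ Ioc (ω 0 / s 0) (ω 0.1 / s 0.1) from ⟨hzero ▸ hα.1, hα.2.trans hend⟩)
    exact ⟨ε, ⟨hε, e⟩, fun x hx => hinj x hx.1 ε hε (hx.2.trans e.symm)⟩
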